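/- Let $Y$ be a metric space that is uniformly discrete (there is $\delta>0$ with $d(x,y)\ge\delta$ for all $x\neq y$), proper (all closed balls are compact), and of coarsely bounded geometry, i.e. there is a subset $\Gamma\subset Y$ such that some $c>0$ satisfies $B_c(\Gamma)=Y$, and such that for every $r>0$ there is $K_r$ with $\#(\Gamma\cap B_r(y))\le K_r$ for all $y\in Y$. Then $$K_0^u(Y)\;\cong\;\ell^\infty_{\mathbb Z}(Y)\qquad\text{and}\qquad K_1^u(Y)=0,$$ where $\ell^\infty_{\mathbb Z}(Y)$ is the additive group of bounded functions $Y\to\mathbb Z$ and $K_p^u(Y)$ is uniform $K$-homology, defined as follows. A $p$-multigraded uniform Fredholm module over $Y$ ($p\ge 0$) is a triple $(H,\rho,T)$. Here $H$ is a separable complex Hilbert space with a selfadjoint unitary grading operator and $p$ odd, pairwise anticommuting unitary operators $\epsilon_1,\dots,\epsilon_p$ with $\epsilon_j^2=-1$; $\rho\colon C_0(Y)\to\mathfrak B(H)$ is a (possibly degenerate) $*$-representation by even operators commuting with all $\epsilon_j$; and $T\in\mathfrak B(H)$ is odd and commutes with all $\epsilon_j$. It is required that $[T,\rho(f)]$,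 $\rho(f)(T^2-1)$, $(T^2-1)\rho(f)$, $\rho(f)(T-T^*)$ and $(T-T^*)\rho(f)$ are compact for all $f\in C_0(Y)$, and that for all $L,R>0$ each of the collections $$\{[T,\rho(f)]\},\qquad \{\rho(f)(T^2-1),\,(T^2-1)\rho(f)\},\qquad \{\rho(f)(T-T^*),\,(T-T^*)\rho(f)\},$$ with $f$ ranging over the $L$-Lipschitz functions in $C_c(Y)$ with $\operatorname{diam}(\operatorname{supp} f)\le R$ and $\|f\|_\infty\le1$, is uniformly approximable: for every $\varepsilon>0$ there is $N$ such that every member of the collection is at distance less than $\varepsilon$ in operator norm from an operator of rank at most $N$. The group $K_p^u(Y)$ is the abelian group generated by the unitary equivalence classes of $p$-multigraded uniform Fredholm modules over $Y$, with the relations $[x]=[y]$ whenever $x$ and $y$ are operator homotopic (joined by a norm continuous path $(T_t)_{t\in[0,1]}$ of operators for which all $(H,\rho,T_t)$, with $H$ and $\rho$ fixed, are $p$-multigraded uniform Fredholm modules), and $[x]+[y]=[x\oplus y]$. -/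

import Mathlib

open scoped ZeroAtInfty NNReal

noncomputable section

namespace UniformKHomology

/-! ### Metric notions -/

/-- Distinct points have distance bounded away from zero. -/
def UniformlyDiscrete (X : Type*) [MetricSpace X] : Prop :=
  ∃ δ : ℝ, 0 < δ ∧ ∀ x y : X, x ≠ y → δ ≤ dist x y

/-- A quasi-lattice: a coarsely dense subset that meets the balls of each fixed radius in
uniformly boundedly many points. -/
structure IsQuasiLattice {X : Type*} [MetricSpace X] (Γ : Set X) : Prop where
  coarselyDense : ∃ c : ℝ, 0 < c ∧ Metric.thickening c Γ = Set.univ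
  boundedCard : ∀ r : ℝ, 0 < r → ∃ K : ℕ, ∀ y : X, (Γ ∩ Metric.ball y r).encard ≤ K

/-- A metric space has coarsely bounded geometry if it admits a quasi-lattice. -/
def CoarselyBoundedGeometry (X : Type*) [MetricSpace X] : Prop :=
  ∃ Γ : Set X, IsQuasiLattice Γ

/-- The functions `f ∈ C_c(X)` that are `L`-Lipschitz, have a support of diameter at most `R`
and satisfy `‖f‖_∞ ≤ 1`. -/
def lipFunctions (X : Type*) [MetricSpace X] (L : ℝ≥0) (R : ℝ) : Set C₀(X, ℂ) :=
  {f | HasCompactSupport f ∧ LipschitzWith L f ∧ Metric.diam (tsupport f) ≤ R ∧ ∀ x, ‖f x‖ ≤ 1}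

/-! ### Operators -/

section Operators

variable {H : Type*} [NormedAddCommGroup H] [InnerProductSpace ℂ H]

/-- For every `ε > 0` there is an `N` such that each member of the collection is `ε`-close to an
operator of rank at most `N`. If `H` is complete, the members are then automatically compact. -/
def UniformlyApproximable (𝒜 : Set (H →L[ℂ] H)) : Prop :=
  ∀ ε : ℝ, 0 < ε → ∃ N : ℕ, ∀ S ∈ 𝒜, ∃ k : H →L[ℂ] H,
    LinearMap.rank (k : H →ₗ[ℂ] H) ≤ N ∧ ‖S - k‖ < ε

variable [CompleteSpace H] {X : Type*} [MetricSpace X] (ρ : C₀(X, ℂ) →⋆ₙₐ[ℂ] (H →L[ℂ] H))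
  (S : H →L[ℂ] H)

def LocallyCompactOp : Prop :=
  ∀ f : C₀(X, ℂ), IsCompactOperator (ρ f * S) ∧ IsCompactOperator (S * ρ f)

def PseudolocalOp : Prop :=
  ∀ f : C₀(X, ℂ), IsCompactOperator (S * ρ f - ρ f * S)

def UniformlyLocallyCompactOp : Prop :=
  ∀ (L : ℝ≥0) (R : ℝ), 0 < L → 0 < R →
    UniformlyApproximable {A | ∃ f ∈ lipFunctions X L R, A = ρ f * S ∨ A = S * ρ f}

def UniformlyPseudolocalOp : Prop :=
  ∀ (L : ℝ≥0) (R : ℝ), 0 < L → 0 < R →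
    UniformlyApproximable {A | ∃ f ∈ lipFunctions X L R, A = S * ρ f - ρ f * S}

end Operators

/-! ### Multigraded uniform Fredholm modules -/

/-- A separable `p`-multigraded Hilbert space (for `p ≥ 0`) with a representation of `C₀(X)` by
even multigraded operators. Up to unitary equivalence every separable Hilbert space lives in the
lowest universe. -/
structure MultigradedRep (p : ℕ) (X : Type*) [MetricSpace X] where
  /-- the Hilbert space -/
  H : Type
  [instNACG : NormedAddCommGroup H]
  [instIPS : InnerProductSpace ℂ H]
  [instComplete : CompleteSpace H]
  [instSeparable : TopologicalSpace.SeparableSpace H]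
  /-- the grading operator -/
  γ : H →L[ℂ] H
  γ_selfAdjoint : IsSelfAdjoint γ
  γ_sq : γ * γ = 1
  /-- the multigrading operators -/
  e : Fin p → (H →L[ℂ] H)
  e_unitary : ∀ i, e i ∈ unitary (H →L[ℂ] H)
  e_odd : ∀ i, e i * γ = -(γ * e i)
  e_sq : ∀ i, e i * e i = -1
  e_anticomm : ∀ i j, i ≠ j → e i * e j + e j * e i = 0
  /-- the representation -/
  ρ : C₀(X, ℂ) →⋆ₙₐ[ℂ] (H →L[ℂ] H)
  ρ_even : ∀ f, ρ f * γ = γ * ρ f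
  ρ_multigraded : ∀ f i, ρ f * e i = e i * ρ f

attribute [instance] MultigradedRep.instNACG MultigradedRep.instIPS MultigradedRep.instComplete
  MultigradedRep.instSeparable

variable {p : ℕ} {X : Type*} [MetricSpace X]

/-- `T` makes `M` into a `p`-multigraded Fredholm module. -/
structure IsFredholm (M : MultigradedRep p X) (T : M.H →L[ℂ] M.H) : Prop where
  odd : T * M.γ = -(M.γ * T)
  multigraded : ∀ i, T * M.e i = M.e i * T
  sq_sub_one : LocallyCompactOp M.ρ (T * T - 1)
  sub_star : LocallyCompactOp M.ρ (T - star T)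
  pseudolocal : PseudolocalOp M.ρ T

/-- `T` makes `M` into a `p`-multigraded uniform Fredholm module. -/
structure IsUniformFredholm (M : MultigradedRep p X) (T : M.H →L[ℂ] M.H) : Prop
    extends IsFredholm M T where
  uniformly_pseudolocal : UniformlyPseudolocalOp M.ρ T
  uniformly_sq_sub_one : UniformlyLocallyCompactOp M.ρ (T * T - 1)
  uniformly_sub_star : UniformlyLocallyCompactOp M.ρ (T - star T)

variable (p X) in
/-- A `p`-multigraded uniform Fredholm module `(H, ρ, T)` over `X`. -/
structure UniformFredholmModule extends MultigradedRep p X where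
  /-- the operator -/
  T : H →L[ℂ] H
  isUniformFredholm : IsUniformFredholm toMultigradedRep T

/-- There is a unitary that intertwines all the structure of `x` and `y`. -/
def UnitarilyEquivalent (x y : UniformFredholmModule p X) : Prop :=
  ∃ U : x.H ≃ₗᵢ[ℂ] y.H,
    (∀ v, U (x.γ v) = y.γ (U v)) ∧
    (∀ i v, U (x.e i v) = y.e i (U v)) ∧
    (∀ f v, U (x.ρ f v) = y.ρ f (U v)) ∧
    (∀ v, U (x.T v) = y.T (U v))

/-- `x` and `y` are the end points of a norm continuous path of operators, on one Hilbert space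
with one representation, that all define uniform Fredholm modules. -/
def OperatorHomotopic (x y : UniformFredholmModule p X) : Prop :=
  ∃ (M : MultigradedRep p X) (T : unitInterval → (M.H →L[ℂ] M.H))
    (hT : ∀ t, IsUniformFredholm M (T t)),
    Continuous T ∧ x = ⟨M, T 0, hT 0⟩ ∧ y = ⟨M, T 1, hT 1⟩

/-! ### Direct sums -/

section DirectSum

variable {H₁ H₂ : Type*} [NormedAddCommGroup H₁] [InnerProductSpace ℂ H₁]
  [NormedAddCommGroup H₂] [InnerProductSpace ℂ H₂]

/-- The operator `A ⊕ B` on the Hilbert space direct sum. -/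
def opSum (A : H₁ →L[ℂ] H₁) (B : H₂ →L[ℂ] H₂) :
    WithLp 2 (H₁ × H₂) →L[ℂ] WithLp 2 (H₁ × H₂) :=
  (WithLp.prodContinuousLinearEquiv 2 ℂ H₁ H₂).symm.toContinuousLinearMap ∘L
    (A.prodMap B) ∘L (WithLp.prodContinuousLinearEquiv 2 ℂ H₁ H₂).toContinuousLinearMap

@[simp] lemma opSum_fst (A : H₁ →L[ℂ] H₁) (B : H₂ →L[ℂ] H₂) (v : WithLp 2 (H₁ × H₂)) :
    (opSum A B v).fst = A v.fst := rfl

@[simp] lemma opSum_snd (A : H₁ →L[ℂ] H₁) (B : H₂ →L[ℂ] H₂) (v : WithLp 2 (H₁ × H₂)) :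
    (opSum A B v).snd = B v.snd := rfl

lemma sum_ext {H₁ H₂ : Type*} {v w : WithLp 2 (H₁ × H₂)} (h₁ : v.fst = w.fst) (h₂ : v.snd = w.snd) : v = w :=
  WithLp.ofLp_injective 2 (Prod.ext h₁ h₂)

lemma opSum_mul (A A' : H₁ →L[ℂ] H₁) (B B' : H₂ →L[ℂ] H₂) :
    opSum A B * opSum A' B' = opSum (A * A') (B * B') := rfl

lemma opSum_one : opSum (1 : H₁ →L[ℂ] H₁) (1 : H₂ →L[ℂ] H₂) = 1 := rfl

lemma opSum_zero : opSum (0 : H₁ →L[ℂ] H₁) (0 : H₂ →L[ℂ] H₂) = 0 := rfl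

lemma opSum_add (A A' : H₁ →L[ℂ] H₁) (B B' : H₂ →L[ℂ] H₂) :
    opSum A B + opSum A' B' = opSum (A + A') (B + B') := rfl

lemma opSum_sub (A A' : H₁ →L[ℂ] H₁) (B B' : H₂ →L[ℂ] H₂) :
    opSum A B - opSum A' B' = opSum (A - A') (B - B') := rfl

lemma opSum_neg (A : H₁ →L[ℂ] H₁) (B : H₂ →L[ℂ] H₂) : -opSum A B = opSum (-A) (-B) := rfl

lemma opSum_smul (c : ℂ) (A : H₁ →L[ℂ] H₁) (B : H₂ →L[ℂ] H₂) :
    c • opSum A B = opSum (c • A) (c • B) := rfl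

lemma opSum_star [CompleteSpace H₁] [CompleteSpace H₂] (A : H₁ →L[ℂ] H₁) (B : H₂ →L[ℂ] H₂) :
    star (opSum A B) = opSum (star A) (star B) := by
  rw [ContinuousLinearMap.star_eq_adjoint]
  refine ((ContinuousLinearMap.eq_adjoint_iff _ _).2 fun v w => ?_).symm
  simp [WithLp.prod_inner_apply, ContinuousLinearMap.star_eq_adjoint,
    ContinuousLinearMap.adjoint_inner_left]

lemma opSum_norm_le {A : H₁ →L[ℂ] H₁} {B : H₂ →L[ℂ] H₂} {c : ℝ} (hA : ‖A‖ ≤ c) (hB : ‖B‖ ≤ c) :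
    ‖opSum A B‖ ≤ c := by
  have hc : 0 ≤ c := (norm_nonneg A).trans hA
  refine ContinuousLinearMap.opNorm_le_bound _ hc fun v => ?_
  refine abs_le_of_sq_le_sq' ?_ (by positivity) |>.2
  rw [mul_pow, WithLp.prod_norm_sq_eq_of_L2, WithLp.prod_norm_sq_eq_of_L2, mul_add,
    ← mul_pow, ← mul_pow]
  simp only [opSum_fst, opSum_snd]
  gcongr
  · exact A.le_of_opNorm_le hA _
  · exact B.le_of_opNorm_le hB _

lemma opSum_eq (A : H₁ →L[ℂ] H₁) (B : H₂ →L[ℂ] H₂) :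
    opSum A B = opSum A 0 + opSum 0 B := by
  rw [opSum_add, add_zero, zero_add]

lemma opSum_compact {A : H₁ →L[ℂ] H₁} {B : H₂ →L[ℂ] H₂} (hA : IsCompactOperator A)
    (hB : IsCompactOperator B) : IsCompactOperator (opSum A B) := by
  let E := (WithLp.prodContinuousLinearEquiv 2 ℂ H₁ H₂)
  rw [opSum_eq]
  refine IsCompactOperator.add (f := opSum A 0) (g := opSum 0 B) ?_ ?_
  · have h : (opSum A 0 : WithLp 2 (H₁ × H₂) →L[ℂ] WithLp 2 (H₁ × H₂)) =
        (E.symm.toContinuousLinearMap ∘L ContinuousLinearMap.inl ℂ H₁ H₂) ∘L A ∘L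
          (ContinuousLinearMap.fst ℂ H₁ H₂ ∘L E.toContinuousLinearMap) := rfl
    rw [h]
    exact (hA.comp_clm (ContinuousLinearMap.fst ℂ H₁ H₂ ∘L E.toContinuousLinearMap)).clm_comp
      (E.symm.toContinuousLinearMap ∘L ContinuousLinearMap.inl ℂ H₁ H₂)
  · have h : (opSum 0 B : WithLp 2 (H₁ × H₂) →L[ℂ] WithLp 2 (H₁ × H₂)) =
        (E.symm.toContinuousLinearMap ∘L ContinuousLinearMap.inr ℂ H₁ H₂) ∘L B ∘L
          (ContinuousLinearMap.snd ℂ H₁ H₂ ∘L E.toContinuousLinearMap) := rfl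
    rw [h]
    exact (hB.comp_clm (ContinuousLinearMap.snd ℂ H₁ H₂ ∘L E.toContinuousLinearMap)).clm_comp
      (E.symm.toContinuousLinearMap ∘L ContinuousLinearMap.inr ℂ H₁ H₂)

end DirectSum

section DirectSumModule

variable {H₁ H₂ : Type} [NormedAddCommGroup H₁] [InnerProductSpace ℂ H₁]
  [NormedAddCommGroup H₂] [InnerProductSpace ℂ H₂]

lemma opSum_rank {A : H₁ →L[ℂ] H₁} {B : H₂ →L[ℂ] H₂} {m n : ℕ}
    (hA : LinearMap.rank (A : H₁ →ₗ[ℂ] H₁) ≤ m) (hB : LinearMap.rank (B : H₂ →ₗ[ℂ] H₂) ≤ n) :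
    LinearMap.rank (opSum A B : WithLp 2 (H₁ × H₂) →ₗ[ℂ] WithLp 2 (H₁ × H₂)) ≤ (m + n : ℕ) := by
  let E := (WithLp.prodContinuousLinearEquiv 2 ℂ H₁ H₂)
  have h : (opSum A B : WithLp 2 (H₁ × H₂) →ₗ[ℂ] WithLp 2 (H₁ × H₂)) =
      ((E.symm.toContinuousLinearMap ∘L ContinuousLinearMap.inl ℂ H₁ H₂ :
          H₁ →L[ℂ] WithLp 2 (H₁ × H₂)) : H₁ →ₗ[ℂ] WithLp 2 (H₁ × H₂)) ∘ₗ (A : H₁ →ₗ[ℂ] H₁) ∘ₗ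
        ((ContinuousLinearMap.fst ℂ H₁ H₂ ∘L E.toContinuousLinearMap :
          WithLp 2 (H₁ × H₂) →L[ℂ] H₁) : WithLp 2 (H₁ × H₂) →ₗ[ℂ] H₁) +
      ((E.symm.toContinuousLinearMap ∘L ContinuousLinearMap.inr ℂ H₁ H₂ :
          H₂ →L[ℂ] WithLp 2 (H₁ × H₂)) : H₂ →ₗ[ℂ] WithLp 2 (H₁ × H₂)) ∘ₗ (B : H₂ →ₗ[ℂ] H₂) ∘ₗ
        ((ContinuousLinearMap.snd ℂ H₁ H₂ ∘L E.toContinuousLinearMap :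
          WithLp 2 (H₁ × H₂) →L[ℂ] H₂) : WithLp 2 (H₁ × H₂) →ₗ[ℂ] H₂) := by
    ext1 v
    refine sum_ext ?_ ?_
    · exact (add_zero (A v.fst)).symm
    · exact (zero_add (B v.snd)).symm
  rw [h, Nat.cast_add]
  refine (LinearMap.rank_add_le _ _).trans (add_le_add ?_ ?_)
  · exact (LinearMap.rank_comp_le_right _ _).trans ((LinearMap.rank_comp_le_left _ _).trans hA)
  · exact (LinearMap.rank_comp_le_right _ _).trans ((LinearMap.rank_comp_le_left _ _).trans hB)

lemma opSum_uniformlyApproximable {𝒜 : Set (H₁ →L[ℂ] H₁)} {ℬ : Set (H₂ →L[ℂ] H₂)}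
    {𝒞 : Set (WithLp 2 (H₁ × H₂) →L[ℂ] WithLp 2 (H₁ × H₂))}
    (hA : UniformlyApproximable 𝒜) (hB : UniformlyApproximable ℬ)
    (hC : ∀ S ∈ 𝒞, ∃ A ∈ 𝒜, ∃ B ∈ ℬ, S = opSum A B) : UniformlyApproximable 𝒞 := by
  intro ε hε
  obtain ⟨m, hm⟩ := hA (ε / 2) (half_pos hε)
  obtain ⟨n, hn⟩ := hB (ε / 2) (half_pos hε)
  refine ⟨m + n, fun S hS => ?_⟩
  obtain ⟨A, hA', B, hB', rfl⟩ := hC S hS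
  obtain ⟨k, hk, hk'⟩ := hm A hA'
  obtain ⟨l, hl, hl'⟩ := hn B hB'
  refine ⟨opSum k l, opSum_rank hk hl, ?_⟩
  rw [opSum_sub]
  exact (opSum_norm_le hk'.le hl'.le).trans_lt (half_lt_self hε)

variable [CompleteSpace H₁] [CompleteSpace H₂]

/-- The representation `ρ₁ ⊕ ρ₂`. -/
def repSum (ρ₁ : C₀(X, ℂ) →⋆ₙₐ[ℂ] (H₁ →L[ℂ] H₁)) (ρ₂ : C₀(X, ℂ) →⋆ₙₐ[ℂ] (H₂ →L[ℂ] H₂)) :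
    C₀(X, ℂ) →⋆ₙₐ[ℂ] (WithLp 2 (H₁ × H₂) →L[ℂ] WithLp 2 (H₁ × H₂)) where
  toFun f := opSum (ρ₁ f) (ρ₂ f)
  map_smul' c f := by simp [map_smul, opSum_smul]
  map_zero' := by simp [opSum_zero]
  map_add' f g := by simp [opSum_add]
  map_mul' f g := by simp [opSum_mul]
  map_star' f := by simp [opSum_star, map_star]

lemma repSum_apply (ρ₁ : C₀(X, ℂ) →⋆ₙₐ[ℂ] (H₁ →L[ℂ] H₁)) (ρ₂ : C₀(X, ℂ) →⋆ₙₐ[ℂ] (H₂ →L[ℂ] H₂))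
    (f : C₀(X, ℂ)) : repSum ρ₁ ρ₂ f = opSum (ρ₁ f) (ρ₂ f) := rfl

variable {ρ₁ : C₀(X, ℂ) →⋆ₙₐ[ℂ] (H₁ →L[ℂ] H₁)} {ρ₂ : C₀(X, ℂ) →⋆ₙₐ[ℂ] (H₂ →L[ℂ] H₂)}
  {S₁ : H₁ →L[ℂ] H₁} {S₂ : H₂ →L[ℂ] H₂}

lemma opSum_locallyCompact (h₁ : LocallyCompactOp ρ₁ S₁) (h₂ : LocallyCompactOp ρ₂ S₂) :
    LocallyCompactOp (repSum ρ₁ ρ₂) (opSum S₁ S₂) := by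
  intro f
  rw [repSum_apply, opSum_mul, opSum_mul]
  exact ⟨opSum_compact (h₁ f).1 (h₂ f).1, opSum_compact (h₁ f).2 (h₂ f).2⟩

lemma opSum_pseudolocal (h₁ : PseudolocalOp ρ₁ S₁) (h₂ : PseudolocalOp ρ₂ S₂) :
    PseudolocalOp (repSum ρ₁ ρ₂) (opSum S₁ S₂) := by
  intro f
  rw [repSum_apply, opSum_mul, opSum_mul, opSum_sub]
  exact opSum_compact (h₁ f) (h₂ f)

lemma opSum_uniformlyLocallyCompact (h₁ : UniformlyLocallyCompactOp ρ₁ S₁)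
    (h₂ : UniformlyLocallyCompactOp ρ₂ S₂) :
    UniformlyLocallyCompactOp (repSum ρ₁ ρ₂) (opSum S₁ S₂) := by
  intro L R hL hR
  refine opSum_uniformlyApproximable (h₁ L R hL hR) (h₂ L R hL hR) ?_
  rintro S ⟨f, hf, rfl | rfl⟩
  · exact ⟨ρ₁ f * S₁, ⟨f, hf, Or.inl rfl⟩, ρ₂ f * S₂, ⟨f, hf, Or.inl rfl⟩, by
      rw [repSum_apply, opSum_mul]⟩
  · exact ⟨S₁ * ρ₁ f, ⟨f, hf, Or.inr rfl⟩, S₂ * ρ₂ f, ⟨f, hf, Or.inr rfl⟩, by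
      rw [repSum_apply, opSum_mul]⟩

lemma opSum_uniformlyPseudolocal (h₁ : UniformlyPseudolocalOp ρ₁ S₁)
    (h₂ : UniformlyPseudolocalOp ρ₂ S₂) :
    UniformlyPseudolocalOp (repSum ρ₁ ρ₂) (opSum S₁ S₂) := by
  intro L R hL hR
  refine opSum_uniformlyApproximable (h₁ L R hL hR) (h₂ L R hL hR) ?_
  rintro S ⟨f, hf, rfl⟩
  exact ⟨S₁ * ρ₁ f - ρ₁ f * S₁, ⟨f, hf, rfl⟩, S₂ * ρ₂ f - ρ₂ f * S₂, ⟨f, hf, rfl⟩, by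
    rw [repSum_apply, opSum_mul, opSum_mul, opSum_sub]⟩

end DirectSumModule

instance separableSpace_sum {H₁ H₂ : Type} [NormedAddCommGroup H₁] [NormedAddCommGroup H₂]
    [TopologicalSpace.SeparableSpace H₁] [TopologicalSpace.SeparableSpace H₂] :
    TopologicalSpace.SeparableSpace (WithLp 2 (H₁ × H₂)) :=
  (WithLp.homeomorphProd 2 H₁ H₂).symm.surjective.denseRange.separableSpace
    (WithLp.homeomorphProd 2 H₁ H₂).symm.continuous

namespace MultigradedRep

/-- The direct sum of two multigraded Hilbert spaces with representations. -/
def directSum (M N : MultigradedRep p X) : MultigradedRep p X where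
  H := WithLp 2 (M.H × N.H)
  γ := opSum M.γ N.γ
  γ_selfAdjoint := by
    rw [IsSelfAdjoint, opSum_star, M.γ_selfAdjoint.star_eq, N.γ_selfAdjoint.star_eq]
  γ_sq := by rw [opSum_mul, M.γ_sq, N.γ_sq, opSum_one]
  e i := opSum (M.e i) (N.e i)
  e_unitary i := by
    rw [Unitary.mem_iff, opSum_star, opSum_mul, opSum_mul,
      Unitary.star_mul_self_of_mem (M.e_unitary i), Unitary.star_mul_self_of_mem (N.e_unitary i),
      Unitary.mul_star_self_of_mem (M.e_unitary i), Unitary.mul_star_self_of_mem (N.e_unitary i),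
      opSum_one]
    exact ⟨rfl, rfl⟩
  e_odd i := by rw [opSum_mul, opSum_mul, M.e_odd, N.e_odd, opSum_neg]
  e_sq i := by rw [opSum_mul, M.e_sq, N.e_sq, ← opSum_neg, opSum_one]
  e_anticomm i j hij := by
    rw [opSum_mul, opSum_mul, opSum_add, M.e_anticomm i j hij, N.e_anticomm i j hij, opSum_zero]
  ρ := repSum M.ρ N.ρ
  ρ_even f := by rw [repSum_apply, opSum_mul, opSum_mul, M.ρ_even, N.ρ_even]
  ρ_multigraded f i := by
    rw [repSum_apply, opSum_mul, opSum_mul, M.ρ_multigraded, N.ρ_multigraded]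

end MultigradedRep

lemma IsUniformFredholm.directSum {M N : MultigradedRep p X} {S : M.H →L[ℂ] M.H}
    {T : N.H →L[ℂ] N.H} (hS : IsUniformFredholm M S) (hT : IsUniformFredholm N T) :
    IsUniformFredholm (M.directSum N) (opSum S T) where
  odd := by
    change opSum S T * opSum M.γ N.γ = -(opSum M.γ N.γ * opSum S T)
    rw [opSum_mul, opSum_mul, hS.odd, hT.odd, opSum_neg]
  multigraded i := by
    change opSum S T * opSum (M.e i) (N.e i) = opSum (M.e i) (N.e i) * opSum S T
    rw [opSum_mul, opSum_mul, hS.multigraded, hT.multigraded]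
  sq_sub_one := by
    change LocallyCompactOp (repSum M.ρ N.ρ) (opSum (S * S - 1) (T * T - 1))
    exact opSum_locallyCompact hS.sq_sub_one hT.sq_sub_one
  sub_star := by
    change LocallyCompactOp (repSum M.ρ N.ρ) (opSum S T - star (opSum S T))
    rw [opSum_star, opSum_sub]
    exact opSum_locallyCompact hS.sub_star hT.sub_star
  pseudolocal := opSum_pseudolocal hS.pseudolocal hT.pseudolocal
  uniformly_pseudolocal :=
    opSum_uniformlyPseudolocal hS.uniformly_pseudolocal hT.uniformly_pseudolocal
  uniformly_sq_sub_one := by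
    change UniformlyLocallyCompactOp (repSum M.ρ N.ρ) (opSum (S * S - 1) (T * T - 1))
    exact opSum_uniformlyLocallyCompact hS.uniformly_sq_sub_one hT.uniformly_sq_sub_one
  uniformly_sub_star := by
    change UniformlyLocallyCompactOp (repSum M.ρ N.ρ) (opSum S T - star (opSum S T))
    rw [opSum_star, opSum_sub]
    exact opSum_uniformlyLocallyCompact hS.uniformly_sub_star hT.uniformly_sub_star

/-- The direct sum of two uniform Fredholm modules. -/
def UniformFredholmModule.directSum (x y : UniformFredholmModule p X) :
    UniformFredholmModule p X where
  toMultigradedRep := x.toMultigradedRep.directSum y.toMultigradedRep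
  T := opSum x.T y.T
  isUniformFredholm := x.isUniformFredholm.directSum y.isUniformFredholm

/-! ### The uniform K-homology groups -/

variable (p X) in
/-- The subgroup generated by the relations of uniform K-homology. -/
def relations : AddSubgroup (FreeAbelianGroup (UniformFredholmModule p X)) :=
  AddSubgroup.closure
    ({a | ∃ x y, UnitarilyEquivalent x y ∧
        a = FreeAbelianGroup.of x - FreeAbelianGroup.of y} ∪
      {a | ∃ x y, OperatorHomotopic x y ∧
        a = FreeAbelianGroup.of x - FreeAbelianGroup.of y} ∪
      {a | ∃ x y, a = FreeAbelianGroup.of x + FreeAbelianGroup.of y -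
        FreeAbelianGroup.of (x.directSum y)})

/-- The uniform K-homology group `K_p^u(X)`, for `p ≥ 0`: the abelian group generated by the
unitary equivalence classes of `p`-multigraded uniform Fredholm modules over `X`, subject to
`[x] = [y]` for operator homotopic `x` and `y`, and to `[x] + [y] = [x ⊕ y]`. -/
abbrev UniformKHomologyGroup (p : ℕ) (X : Type*) [MetricSpace X] : Type _ :=
  FreeAbelianGroup (UniformFredholmModule p X) ⧸ relations p X

/-- The group of bounded integer-valued sequences indexed by `Y`. -/
def boundedIntSequences (Y : Type*) : AddSubgroup (Y → ℤ) where
  carrier := {a | ∃ C : ℤ, ∀ y, |a y| ≤ C}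
  zero_mem' := ⟨0, fun _ => by simp⟩
  add_mem' := by
    rintro a b ⟨C, hC⟩ ⟨D, hD⟩
    exact ⟨C + D, fun y => (abs_add_le _ _).trans (add_le_add (hC y) (hD y))⟩
  neg_mem' := by
    rintro a ⟨C, hC⟩
    exact ⟨C, fun y => by simpa using hC y⟩

end UniformKHomology

end

/-!
Over a uniformly discrete proper space `Y`, which is countable and has finite balls, a representation
of `C₀(Y)` is given by the pairwise orthogonal projections `P y = ρ (pt y)`, and every bounded
function is Lipschitz. The uniform conditions on a Fredholm module are therefore conditions on
`ρ (chi F)`, where `F` runs through the finite sets of diameter at most `R`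
(`uniformlyLocallyCompactOp_iff`), and linear paths show that uniformly locally compact perturbations
of the operator `T` do not change the class (`cls_perturb`).

*Normal form.* The class of `(H, ρ, T)` is represented by the strong sum `S = ∑ P y A P y` of the
diagonal blocks of `A = (T + T*) / 2`, which is selfadjoint and commutes with `ρ` (`exists_diagonal`).
Over `F`, the difference of `S` and `A` is the average of the operators `s [A, s]` over all functions
`s = ± 1` on `F`. The number of points of `F` is not bounded in terms of `R`, but averages of any
number of operators from a bounded uniformly approximable family remain uniformly approximable,
because the Hilbert–Schmidt norm of operators of bounded rank and norm is bounded, and convex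
(`UnifApprox.average`).

*Vanishing.* If `S` is injective over each point, its sign over each point is a uniformly locally
compact perturbation of it, and defines a degenerate module, whose class vanishes by the Eilenberg
swindle (`IsDegenerate.cls_eq_zero`). If there is an odd multigraded symmetry of the kernel of `S`, it
can be added to `S` to make it injective, so that the class of `S` vanishes too
(`cls_eq_zero_of_kernel_symmetry`). The kernel over a set of diameter at most `R` has bounded
dimension (`exists_finrank_kerOver_le`), so that this is a permitted perturbation. For `p = 1` the
operator `i ε₁` on the kernel is such a symmetry; hence `K₁ = 0`. For `p = 0` there is one if over each
point the even and the odd part of the kernel have the same dimension.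

*Index.* The difference of these dimensions, `ind`, is constant along norm continuous paths, since the
kernel of a nearby operator is isomorphic to the kernel of an odd selfadjoint operator on the
finite-dimensional kernel of the given one (`gradedDim_eq_of_isUnit`). It defines the homomorphism
`indexHom` to the functions `Y → ℤ` that are uniformly summable over sets of bounded diameter. It is
surjective, as the zero operator on an `ℓ²` space with a basis of prescribed signs over each point
shows (`exists_ind_eq`). Modules of opposite indices have classes with sum zero, so every element of
`K₀` is the class of a module, and vanishes if its index does. Hence `indexHom` is bijective
(`indexHom_bijective`).

*Comparison with bounded functions.* If `Y` is infinite, the group of uniformly summable functions can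
be a proper subgroup of the group of bounded functions, because there may be sets of the same diameter
with arbitrarily many points. But the bounded functions are the locally constant functions on the
Stone–Čech compactification, which form a free group by Nöbeling's theorem; subgroups of free abelian
groups are free (`free_submodule_of_pid`); and both groups have the cardinality of the continuum, as
already the indicator functions of the subsets of a sparse sequence show. So both are free of the same
rank, and therefore isomorphic (`nonempty_addEquiv_boundedIntSequences`).
-/

noncomputable section

namespace UniformKHomology

/-! ### Approximation of families of operators by operators of bounded rank -/

section Approximation

variable {H : Type*} [NormedAddCommGroup H] [InnerProductSpace ℂ H]

/-- The version of `UniformlyApproximable` for indexed families of operators. -/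
def UnifApprox {ι : Type*} (a : ι → (H →L[ℂ] H)) : Prop :=
  ∀ ε : ℝ, 0 < ε → ∃ N : ℕ, ∀ i, ∃ k : H →L[ℂ] H,
    LinearMap.rank (k : H →ₗ[ℂ] H) ≤ N ∧ ‖a i - k‖ < ε

lemma rank_mul_le_left (a b : H →L[ℂ] H) :
    LinearMap.rank ((a * b : H →L[ℂ] H) : H →ₗ[ℂ] H) ≤ LinearMap.rank (a : H →ₗ[ℂ] H) :=
  LinearMap.rank_comp_le_left (b : H →ₗ[ℂ] H) (a : H →ₗ[ℂ] H)

lemma rank_mul_le_right (a b : H →L[ℂ] H) :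
    LinearMap.rank ((a * b : H →L[ℂ] H) : H →ₗ[ℂ] H) ≤ LinearMap.rank (b : H →ₗ[ℂ] H) :=
  LinearMap.rank_comp_le_right (b : H →ₗ[ℂ] H) (a : H →ₗ[ℂ] H)

lemma finiteDimensional_range_of_rank_le {k : H →L[ℂ] H} {N : ℕ}
    (hk : LinearMap.rank (k : H →ₗ[ℂ] H) ≤ N) :
    FiniteDimensional ℂ (LinearMap.range (k : H →ₗ[ℂ] H)) :=
  Module.rank_lt_aleph0_iff.1 (hk.trans_lt (Cardinal.natCast_lt_aleph0))

lemma finrank_range_le_of_rank_le {k : H →L[ℂ] H} {N : ℕ}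
    (hk : LinearMap.rank (k : H →ₗ[ℂ] H) ≤ N) :
    Module.finrank ℂ (LinearMap.range (k : H →ₗ[ℂ] H)) ≤ N :=
  Module.finrank_le_of_rank_le hk

lemma rank_le_of_finrank {k : H →L[ℂ] H} {U : Submodule ℂ H} [FiniteDimensional ℂ U] {N : ℕ}
    (hU : Module.finrank ℂ U ≤ N) (hk : ∀ v, k v ∈ U) : LinearMap.rank (k : H →ₗ[ℂ] H) ≤ N := by
  have h : LinearMap.range (k : H →ₗ[ℂ] H) ≤ U := by
    rintro _ ⟨v, rfl⟩
    exact hk v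
  refine (Submodule.rank_mono h).trans ?_
  rw [← Module.finrank_eq_rank]
  exact_mod_cast hU

namespace UnifApprox

variable {ι κ : Type*} {a b : ι → (H →L[ℂ] H)}

lemma congr (ha : UnifApprox a) (h : ∀ i, b i = a i) : UnifApprox b := by
  rwa [show b = a from funext h]

lemma comp (ha : UnifApprox a) (φ : κ → ι) : UnifApprox fun j => a (φ j) := fun ε hε =>
  (ha ε hε).imp fun _ h j => h (φ j)

lemma add (ha : UnifApprox a) (hb : UnifApprox b) : UnifApprox fun i => a i + b i := by
  intro ε hε
  obtain ⟨m, hm⟩ := ha (ε / 2) (half_pos hε)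
  obtain ⟨n, hn⟩ := hb (ε / 2) (half_pos hε)
  refine ⟨m + n, fun i => ?_⟩
  obtain ⟨k, hk, hk'⟩ := hm i
  obtain ⟨l, hl, hl'⟩ := hn i
  refine ⟨k + l, ?_, ?_⟩
  · push_cast
    exact (LinearMap.rank_add_le _ _).trans (add_le_add hk hl)
  · rw [add_sub_add_comm]
    exact (norm_add_le _ _).trans_lt (by linarith)

lemma mul_left (ha : UnifApprox a) {C : ℝ} (hb : ∀ i, ‖b i‖ ≤ C) :
    UnifApprox fun i => b i * a i := by
  intro ε hε
  have hC : 0 < |C| + 1 := by positivity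
  obtain ⟨m, hm⟩ := ha (ε / (|C| + 1)) (by positivity)
  refine ⟨m, fun i => ?_⟩
  obtain ⟨k, hk, hk'⟩ := hm i
  refine ⟨b i * k, (rank_mul_le_right _ _).trans hk, ?_⟩
  rw [← mul_sub]
  refine (norm_mul_le _ _).trans_lt ?_
  calc ‖b i‖ * ‖a i - k‖ ≤ (|C| + 1) * ‖a i - k‖ := by
        gcongr
        linarith [hb i, le_abs_self C]
    _ < (|C| + 1) * (ε / (|C| + 1)) := by gcongr
    _ = ε := by field_simp

lemma mul_right (ha : UnifApprox a) {C : ℝ} (hb : ∀ i, ‖b i‖ ≤ C) :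
    UnifApprox fun i => a i * b i := by
  intro ε hε
  have hC : 0 < |C| + 1 := by positivity
  obtain ⟨m, hm⟩ := ha (ε / (|C| + 1)) (by positivity)
  refine ⟨m, fun i => ?_⟩
  obtain ⟨k, hk, hk'⟩ := hm i
  refine ⟨k * b i, (rank_mul_le_left _ _).trans hk, ?_⟩
  rw [← sub_mul]
  refine (norm_mul_le _ _).trans_lt ?_
  calc ‖a i - k‖ * ‖b i‖ ≤ ‖a i - k‖ * (|C| + 1) := by
        gcongr
        linarith [hb i, le_abs_self C]
    _ < (ε / (|C| + 1)) * (|C| + 1) := by gcongr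
    _ = ε := by field_simp

lemma const_smul (ha : UnifApprox a) (c : ℂ) : UnifApprox fun i => c • a i :=
  (ha.mul_left (b := fun _ => c • 1) (fun _ => le_rfl)).congr fun i => by simp

lemma neg (ha : UnifApprox a) : UnifApprox fun i => -a i :=
  (ha.const_smul (-1)).congr fun i => by simp

lemma sub (ha : UnifApprox a) (hb : UnifApprox b) : UnifApprox fun i => a i - b i :=
  (ha.add hb.neg).congr fun _ => sub_eq_add_neg _ _

lemma of_rank_le {N : ℕ} (h : ∀ i, LinearMap.rank (a i : H →ₗ[ℂ] H) ≤ N) : UnifApprox a :=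
  fun ε hε => ⟨N, fun i => ⟨a i, h i, by simpa using hε⟩⟩

end UnifApprox

lemma isCompactOperator_of_rank_le {k : H →L[ℂ] H} {N : ℕ}
    (hk : LinearMap.rank (k : H →ₗ[ℂ] H) ≤ N) : IsCompactOperator k := by
  have := finiteDimensional_range_of_rank_le hk
  let R := LinearMap.range (k : H →ₗ[ℂ] H)
  have h1 : IsCompactOperator (k.codRestrict R fun v => ⟨v, rfl⟩) :=
    (isCompactOperator_id_iff_finiteDimensional.2 this).comp_clm (k.codRestrict R fun v => ⟨v, rfl⟩)
  exact h1.clm_comp R.subtypeL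

/-- An operator with square of the Hilbert--Schmidt norm at most `M` is `ε`-close to one of rank at
most `M / ε ^ 2`: project away from a maximal orthonormal family on which it is at least `ε`. -/
lemma exists_rank_le_norm_sub_le {k : H →L[ℂ] H} {M ε : ℝ} (hε : 0 < ε)
    (h : ∀ (n : ℕ) (e : Fin n → H), Orthonormal ℂ e → ∑ i, ‖k (e i)‖ ^ 2 ≤ M) :
    ∃ k' : H →L[ℂ] H, LinearMap.rank (k' : H →ₗ[ℂ] H) ≤ (⌊M / ε ^ 2⌋₊ : ℕ) ∧ ‖k - k'‖ ≤ ε := by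
  classical
  let Q : ℕ → Prop := fun n => ∃ e : Fin n → H, Orthonormal ℂ e ∧ ∀ i, ε < ‖k (e i)‖
  have hQ (n : ℕ) (hn : Q n) : n ≤ ⌊M / ε ^ 2⌋₊ := by
    obtain ⟨e, he, he'⟩ := hn
    refine Nat.le_floor ?_
    rw [le_div_iff₀ (by positivity)]
    refine le_trans ?_ (h n e he)
    calc (n : ℝ) * ε ^ 2 = ∑ _i : Fin n, ε ^ 2 := by simp
      _ ≤ _ := Finset.sum_le_sum fun i _ => by gcongr; exact (he' i).le
  have hQ0 : Q 0 := ⟨Fin.elim0, ⟨fun i => i.elim0, fun i => i.elim0⟩, fun i => i.elim0⟩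
  have hm : Q (Nat.findGreatest Q ⌊M / ε ^ 2⌋₊) := Nat.findGreatest_spec (Nat.zero_le _) hQ0
  have hmax : ¬ Q (Nat.findGreatest Q ⌊M / ε ^ 2⌋₊ + 1) := fun h' =>
    absurd (Nat.le_findGreatest (hQ _ h') h') (by simp)
  have hmle := hQ _ hm
  obtain ⟨e, he, he'⟩ := hm
  let U := Submodule.span ℂ (Set.range e)
  have : FiniteDimensional ℂ U := FiniteDimensional.span_of_finite ℂ (Set.finite_range e)
  refine ⟨k * U.starProjection, ?_, ?_⟩
  · refine (rank_mul_le_right _ _).trans (rank_le_of_finrank (U := U) ?_ fun v =>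
      U.starProjection_apply_mem v)
    refine (finrank_range_le_card e).trans ?_
    simpa using hmle
  · refine ContinuousLinearMap.opNorm_le_bound _ hε.le fun v => ?_
    have hw : v - U.starProjection v ∈ Uᗮ := U.sub_starProjection_mem_orthogonal v
    have hwn : ‖v - U.starProjection v‖ ≤ ‖v‖ := by
      have := U.norm_sq_eq_add_norm_sq_starProjection v
      rw [Submodule.starProjection_orthogonal_val] at this
      refine abs_le_of_sq_le_sq' ?_ (norm_nonneg _) |>.2
      nlinarith [sq_nonneg ‖U.starProjection v‖]
    have hv : (k - k * U.starProjection) v = k (v - U.starProjection v) := by simp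
    rw [hv]
    set w := v - U.starProjection v
    suffices ‖k w‖ ≤ ε * ‖w‖ from this.trans (by gcongr)
    by_contra! hlt
    have hw0 : ‖w‖ ≠ 0 := fun h0 => by simp [norm_eq_zero.1 h0] at hlt
    refine hmax ⟨Matrix.vecCons ((‖w‖⁻¹ : ℂ) • w) e, orthonormal_vecCons_iff.2 ⟨?_, fun i => ?_, he⟩,
      fun i => ?_⟩
    · rw [norm_smul]; simp [hw0]
    · rw [inner_smul_left, Submodule.inner_left_of_mem_orthogonal (K := U)
        (Submodule.subset_span ⟨i, rfl⟩) hw, mul_zero]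
    · refine Fin.cases ?_ (fun j => by simpa using he' j) i
      have hw1 : 0 < ‖w‖ := lt_of_le_of_ne (norm_nonneg w) hw0.symm
      simp only [Matrix.cons_val_zero, map_smul, norm_smul, norm_inv, Complex.norm_real, norm_norm]
      rw [inv_mul_eq_div, lt_div_iff₀ hw1]
      exact hlt

variable [CompleteSpace H]

/-- The square of the Hilbert--Schmidt norm of an operator of rank at most `N` and norm at most `C`
is at most `N * C ^ 2`. -/
lemma sum_norm_sq_le_of_rank_le {k : H →L[ℂ] H} {N : ℕ} {C : ℝ}
    (hk : LinearMap.rank (k : H →ₗ[ℂ] H) ≤ N) (hC : ‖k‖ ≤ C) {n : ℕ} {e : Fin n → H}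
    (he : Orthonormal ℂ e) : ∑ i, ‖k (e i)‖ ^ 2 ≤ N * C ^ 2 := by
  have := finiteDimensional_range_of_rank_le hk
  let b := stdOrthonormalBasis ℂ (LinearMap.range (k : H →ₗ[ℂ] H))
  have h (i : Fin n) : ‖k (e i)‖ ^ 2 =
      ∑ j, ‖inner ℂ (e i) (ContinuousLinearMap.adjoint k (b j : H))‖ ^ 2 := by
    have := b.sum_sq_norm_inner_right ⟨k (e i), e i, rfl⟩
    rw [Submodule.coe_norm] at this
    rw [← this]
    refine Finset.sum_congr rfl fun j _ => ?_
    rw [ContinuousLinearMap.adjoint_inner_right, norm_inner_symm]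
    rfl
  simp_rw [h]
  rw [Finset.sum_comm]
  have hC0 : 0 ≤ C := (norm_nonneg k).trans hC
  calc _ ≤ ∑ j, ‖ContinuousLinearMap.adjoint k (b j : H)‖ ^ 2 :=
        Finset.sum_le_sum fun j _ => he.sum_inner_products_le _
    _ ≤ ∑ _j : Fin (Module.finrank ℂ (LinearMap.range (k : H →ₗ[ℂ] H))), C ^ 2 := by
        refine Finset.sum_le_sum fun j _ => ?_
        gcongr
        refine (ContinuousLinearMap.le_of_opNorm_le _ (c := C) ?_ _).trans ?_
        · rwa [LinearIsometryEquiv.norm_map]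
        · have : ‖(b j : H)‖ = 1 := b.orthonormal.1 j
          rw [this, mul_one]
    _ ≤ N * C ^ 2 := by
        rw [Finset.sum_const, Finset.card_univ, Fintype.card_fin, nsmul_eq_mul]
        gcongr
        exact finrank_range_le_of_rank_le hk

/-- Averages over a bounded uniformly approximable family are uniformly approximable, no matter how
many members are averaged: averaging does not increase the Hilbert--Schmidt norm. -/
lemma UnifApprox.average {ι κ : Type*} {a : ι → (H →L[ℂ] H)} (ha : UnifApprox a) {C : ℝ}
    (hC : ∀ i, ‖a i‖ ≤ C) {S : κ → Type*} [∀ j, Fintype (S j)] [∀ j, Nonempty (S j)]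
    (φ : ∀ j, S j → ι) {b : κ → (H →L[ℂ] H)}
    (hb : ∀ j, b j = (Fintype.card (S j) : ℂ)⁻¹ • ∑ s, a (φ j s)) :
    UnifApprox b := by
  intro ε hε
  obtain ⟨N, hN⟩ := ha (ε / 4) (by positivity)
  choose k hk hk' using hN
  refine ⟨⌊(N * (C + ε / 4) ^ 2) / (ε / 2) ^ 2⌋₊, fun j => ?_⟩
  have hcard : (0 : ℝ) < Fintype.card (S j) := by exact_mod_cast Fintype.card_pos (α := S j)
  have hcard' : (Fintype.card (S j) : ℂ) ≠ 0 := by exact_mod_cast hcard.ne'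
  have hkn (i : ι) : ‖k i‖ ≤ C + ε / 4 := by
    have := norm_sub_norm_le (k i) (a i)
    rw [norm_sub_rev] at this
    linarith [hC i, hk' i]
  let kk : H →L[ℂ] H := ((Fintype.card (S j) : ℂ)⁻¹) • ∑ i, k (φ j i)
  have hkk : ‖b j - kk‖ ≤ ε / 4 := by
    rw [hb j, ← smul_sub, ← Finset.sum_sub_distrib, norm_smul, norm_inv, Complex.norm_natCast,
      inv_mul_le_iff₀ hcard]
    refine (norm_sum_le _ _).trans ((Finset.sum_le_sum fun i _ => (hk' _).le).trans ?_)
    simp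
  have hHS (n : ℕ) (e : Fin n → H) (he : Orthonormal ℂ e) :
      ∑ i, ‖kk (e i)‖ ^ 2 ≤ N * (C + ε / 4) ^ 2 := by
    have h1 (x : H) : ‖kk x‖ ^ 2 ≤ (Fintype.card (S j) : ℝ)⁻¹ * ∑ i, ‖k (φ j i) x‖ ^ 2 := by
      have h2 : ‖kk x‖ ≤ (Fintype.card (S j) : ℝ)⁻¹ * ∑ i, ‖k (φ j i) x‖ := by
        simp only [kk, smul_apply, sum_apply, norm_smul,
          norm_inv, Complex.norm_natCast]
        gcongr
        exact norm_sum_le _ _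
      calc ‖kk x‖ ^ 2 ≤ ((Fintype.card (S j) : ℝ)⁻¹ * ∑ i, ‖k (φ j i) x‖) ^ 2 := by gcongr
        _ = (Fintype.card (S j) : ℝ)⁻¹ ^ 2 * (∑ i, ‖k (φ j i) x‖) ^ 2 := by ring
        _ ≤ (Fintype.card (S j) : ℝ)⁻¹ ^ 2 * (Fintype.card (S j) * ∑ i, ‖k (φ j i) x‖ ^ 2) := by
            gcongr
            exact sq_sum_le_card_mul_sum_sq
        _ = _ := by field_simp
    calc ∑ i, ‖kk (e i)‖ ^ 2 ≤ ∑ i, (Fintype.card (S j) : ℝ)⁻¹ * ∑ l, ‖k (φ j l) (e i)‖ ^ 2 :=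
          Finset.sum_le_sum fun i _ => h1 _
      _ = (Fintype.card (S j) : ℝ)⁻¹ * ∑ l, ∑ i, ‖k (φ j l) (e i)‖ ^ 2 := by
          rw [← Finset.mul_sum, Finset.sum_comm]
      _ ≤ (Fintype.card (S j) : ℝ)⁻¹ * ∑ _l : S j, (N : ℝ) * (C + ε / 4) ^ 2 := by
          gcongr with l
          exact sum_norm_sq_le_of_rank_le (hk _) (hkn _) he
      _ = _ := by
          rw [Finset.sum_const, nsmul_eq_mul, Finset.card_univ]
          field_simp
  obtain ⟨k', hk1, hk2⟩ := exists_rank_le_norm_sub_le (half_pos hε) hHS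
  refine ⟨k', hk1, ?_⟩
  have : b j - k' = (b j - kk) + (kk - k') := by abel
  rw [this]
  exact (norm_add_le _ _).trans_lt (by linarith)

lemma UnifApprox.isCompactOperator {ι : Type*} {a : ι → (H →L[ℂ] H)} (ha : UnifApprox a) (i : ι) :
    IsCompactOperator (a i) := by
  have hcl : IsClosed {f : H →L[ℂ] H | IsCompactOperator f} :=
    isClosed_setOfPred_isCompactOperator
  refine (hcl.closure_subset : _) (Metric.mem_closure_iff.2 fun ε hε => ?_)
  obtain ⟨N, hN⟩ := ha ε hε
  obtain ⟨k, hk, hk'⟩ := hN i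
  exact ⟨k, isCompactOperator_of_rank_le hk, by rwa [dist_eq_norm]⟩

/-- The Fredholm alternative, for an operator that is within `1` of the identity up to finite
rank. -/
lemma isUnit_of_injective_of_rank_le {A k : H →L[ℂ] H} {N : ℕ}
    (hk : LinearMap.rank (k : H →ₗ[ℂ] H) ≤ N) (h : ‖A - 1 - k‖ < 1) (hA : Function.Injective A) :
    IsUnit A := by
  have hu : IsUnit (1 - -(A - 1 - k)) := isUnit_one_sub_of_norm_lt_one (by rwa [norm_neg])
  have hu' : 1 - -(A - 1 - k) = A - k := by abel
  rw [hu'] at hu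
  obtain ⟨u, hu⟩ := hu
  -- `u⁻¹ A = 1 + u⁻¹ k` is injective and preserves the finite-dimensional range of `u⁻¹ k`
  let B : H →L[ℂ] H := ↑u⁻¹ * k
  have hB : ↑u⁻¹ * A = 1 + B := by
    have : A = u + k := by rw [hu]; abel
    rw [this, mul_add, Units.inv_mul]
  have hBr : LinearMap.rank (B : H →ₗ[ℂ] H) ≤ N := (rank_mul_le_right _ _).trans hk
  have := finiteDimensional_range_of_rank_le hBr
  have hinj : Function.Injective (1 + B : H →L[ℂ] H) := by
    rw [← hB]
    intro v w hvw
    apply hA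
    have := congrArg (u : H →L[ℂ] H) hvw
    simpa only [← mul_apply_eq_comp, ← mul_assoc, Units.mul_inv, one_mul] using this
  have hsurj : Function.Surjective (1 + B : H →L[ℂ] H) := by
    let R := LinearMap.range (B : H →ₗ[ℂ] H)
    have hmem (v : H) (hv : v ∈ R) : ((1 + B : H →L[ℂ] H) : H →ₗ[ℂ] H) v ∈ R :=
      R.add_mem hv ⟨v, rfl⟩
    have hs : Function.Surjective (((1 + B : H →L[ℂ] H) : H →ₗ[ℂ] H).restrict hmem) := by
      refine LinearMap.injective_iff_surjective.1 fun v w hvw => ?_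
      exact Subtype.ext (hinj (congrArg Subtype.val hvw))
    intro y
    obtain ⟨r, hr⟩ := hs ⟨B y, y, rfl⟩
    refine ⟨y - r, ?_⟩
    have hr' : (1 + B) (r : H) = B y := congrArg Subtype.val hr
    rw [map_sub, hr']
    simp
  have hunit : IsUnit (1 + B) :=
    ContinuousLinearMap.isUnit_iff_bijective.2 ⟨hinj, hsurj⟩
  rw [← hB] at hunit
  have := (u.isUnit).mul hunit
  rwa [← mul_assoc, Units.mul_inv, one_mul] at this

end Approximation

/-! ### Functions on a uniformly discrete proper space -/

section Functions

variable {Y : Type*} [MetricSpace Y]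

lemma UniformlyDiscrete.discreteTopology (hY : UniformlyDiscrete Y) : DiscreteTopology Y := by
  obtain ⟨δ, hδ, h⟩ := hY
  refine DiscreteTopology.of_forall_le_dist hδ fun x y hxy => h x y hxy

lemma norm_le_of_forall {f : C₀(Y, ℂ)} {C : ℝ} (hC : 0 ≤ C) (h : ∀ y, ‖f y‖ ≤ C) : ‖f‖ ≤ C := by
  rw [← ZeroAtInftyContinuousMap.norm_toBCF_eq_norm]
  exact (BoundedContinuousFunction.norm_le hC).2 h

variable [DiscreteTopology Y]

/-- The function that agrees with `g` on the finite set `F` and vanishes elsewhere. -/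
def finFun (F : Finset Y) (g : Y → ℂ) : C₀(Y, ℂ) where
  toFun := (F : Set Y).indicator g
  continuous_toFun := continuous_of_discreteTopology
  zero_at_infty' := by
    refine tendsto_nhds_of_eventually_eq ?_
    rw [Filter.cocompact_eq_cofinite]
    filter_upwards [F.finite_toSet.compl_mem_cofinite] with y hy
    exact Set.indicator_of_notMem hy g

lemma finFun_apply (F : Finset Y) (g : Y → ℂ) (y : Y) :
    finFun F g y = (F : Set Y).indicator g y := rfl

/-- The indicator function of a point. -/
def pt (y : Y) : C₀(Y, ℂ) := finFun {y} 1

/-- The indicator function of a finite set. -/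
def chi (F : Finset Y) : C₀(Y, ℂ) := finFun F 1

lemma pt_apply_self (y : Y) : pt y y = 1 := by simp [pt, finFun_apply]

lemma pt_apply_ne {y z : Y} (h : z ≠ y) : pt y z = 0 := by simp [pt, finFun_apply, h]

lemma finFun_mul (F : Finset Y) (g h : Y → ℂ) : finFun F g * finFun F h = finFun F (g * h) := by
  ext y
  by_cases hy : y ∈ F <;> simp [finFun_apply, hy]

lemma mul_chi (F : Finset Y) (f : C₀(Y, ℂ)) : f * chi F = finFun F f := by
  ext y
  by_cases hy : y ∈ F <;> simp [finFun_apply, chi, hy]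

lemma pt_mul (y : Y) (f : C₀(Y, ℂ)) : pt y * f = f y • pt y := by
  ext z
  by_cases hz : z = y
  · subst hz; simp [pt_apply_self]
  · simp [pt_apply_ne hz]

lemma pt_mul_self (y : Y) : pt y * pt y = pt y := by rw [pt_mul, pt_apply_self, one_smul]

lemma pt_mul_ne {y z : Y} (h : y ≠ z) : pt y * pt z = 0 := by
  rw [pt_mul, pt_apply_ne h, zero_smul]

lemma star_finFun (F : Finset Y) (g : Y → ℂ) : star (finFun F g) = finFun F (star g) := by
  ext y
  by_cases hy : y ∈ F <;> simp [finFun_apply, hy]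

lemma star_pt (y : Y) : star (pt y) = pt y := by rw [pt, star_finFun, star_one]

lemma finFun_eq_sum (F : Finset Y) (g : Y → ℂ) : finFun F g = ∑ y ∈ F, g y • pt y := by
  classical
  ext z
  have h : (∑ y ∈ F, g y • pt y) z = ∑ y ∈ F, g y * pt y z := by
    induction F using Finset.induction_on with
    | empty => simp
    | insert a s ha ih => rw [Finset.sum_insert ha, Finset.sum_insert ha, ← ih]; rfl
  rw [h, finFun_apply]
  by_cases hz : z ∈ F
  · rw [Finset.sum_eq_single z (fun y _ hy => by rw [pt_apply_ne hy.symm, mul_zero])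
      (fun h' => absurd hz h'), pt_apply_self]
    simp [hz]
  · have h0 : ∀ y ∈ F, g y * pt y z = 0 := fun y hy => by
      have : z ≠ y := fun h' => hz (by rwa [h'])
      rw [pt_apply_ne this, mul_zero]
    rw [Finset.sum_eq_zero h0]
    simp [hz]

lemma chi_eq_sum (F : Finset Y) : chi F = ∑ y ∈ F, pt y := by
  simp [chi, finFun_eq_sum]

lemma chi_mul_self (F : Finset Y) : chi F * chi F = chi F := by
  rw [chi, finFun_mul, one_mul]

lemma pt_mul_chi {F : Finset Y} {y : Y} (hy : y ∈ F) : pt y * chi F = pt y := by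
  rw [pt_mul, show chi F y = 1 by simp [chi, finFun_apply, hy], one_smul]

lemma norm_finFun_le {F : Finset Y} {g : Y → ℂ} (hg : ∀ y, ‖g y‖ ≤ 1) : ‖finFun F g‖ ≤ 1 := by
  refine norm_le_of_forall zero_le_one fun y => ?_
  by_cases hy : y ∈ F <;> simp [finFun_apply, hy, hg]

lemma norm_pt_le (y : Y) : ‖pt y‖ ≤ 1 := norm_finFun_le fun y => by simp

/-- Finitely supported functions are dense in `C₀(Y)`. -/
lemma mem_of_forall_pt_mem {S : Submodule ℂ C₀(Y, ℂ)} (hS : IsClosed (S : Set C₀(Y, ℂ)))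
    (h : ∀ y, pt y ∈ S) (f : C₀(Y, ℂ)) : f ∈ S := by
  refine hS.closure_subset (Metric.mem_closure_iff.2 fun ε hε => ?_)
  have h0 := f.zero_at_infty'
  rw [Filter.cocompact_eq_cofinite] at h0
  have h1 : {y | ¬ ‖f y‖ < ε / 2}.Finite := by
    have := h0.eventually (Metric.ball_mem_nhds (0 : ℂ) (half_pos hε))
    simpa [Filter.eventually_cofinite] using this
  refine ⟨finFun h1.toFinset f, ?_, ?_⟩
  · rw [finFun_eq_sum]
    exact S.sum_mem fun y _ => S.smul_mem _ (h y)
  · rw [dist_eq_norm]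
    refine (norm_le_of_forall (half_pos hε).le fun y => ?_).trans_lt (half_lt_self hε)
    by_cases hy : ‖f y‖ < ε / 2
    · simp [finFun_apply, hy, hy.le]
    · have : y ∈ (h1.toFinset : Set Y) := by simpa using hy
      simp only [ZeroAtInftyContinuousMap.sub_apply, finFun_apply, Set.indicator_of_mem this]
      rw [sub_self, norm_zero]
      exact (half_pos hε).le

/-- The finite subsets of diameter at most `R`. -/
abbrev SmallSet (Y : Type*) [MetricSpace Y] (R : ℝ) : Type _ :=
  {F : Finset Y // Metric.diam (F : Set Y) ≤ R}

lemma exists_smallSet {L : ℝ≥0} {R : ℝ} {f : C₀(Y, ℂ)} (hf : f ∈ lipFunctions Y L R) :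
    ∃ F : SmallSet Y R, f * chi F.1 = f := by
  obtain ⟨hc, -, hd, -⟩ := hf
  have hfin : (tsupport f).Finite := hc.isCompact.finite_of_discrete
  refine ⟨⟨hfin.toFinset, by simpa using hd⟩, ?_⟩
  rw [mul_chi]
  ext y
  by_cases hy : y ∈ tsupport f
  · have : y ∈ (hfin.toFinset : Set Y) := by simpa using hy
    rw [finFun_apply, Set.indicator_of_mem this]
  · have : y ∉ (hfin.toFinset : Set Y) := by simpa using hy
    rw [finFun_apply, Set.indicator_of_notMem this, image_eq_zero_of_notMem_tsupport hy]

lemma exists_lipFunctions (hY : UniformlyDiscrete Y) : ∃ L : ℝ≥0, 0 < L ∧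
    ∀ (R : ℝ) (F : SmallSet Y R) (g : Y → ℂ), (∀ y, ‖g y‖ ≤ 1) →
      finFun F.1 g ∈ lipFunctions Y L R := by
  obtain ⟨δ, hδ, hsep⟩ := hY
  have hL : 0 < 2 / δ := div_pos two_pos hδ
  refine ⟨(2 / δ).toNNReal, Real.toNNReal_pos.2 hL, fun R F g hg => ?_⟩
  have hb (y : Y) : ‖finFun F.1 g y‖ ≤ 1 := by
    by_cases hy : y ∈ F.1 <;> simp [finFun_apply, hy, hg]
  have hs : tsupport (finFun F.1 g) ⊆ (F.1 : Set Y) := by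
    refine closure_minimal ?_ (isClosed_discrete _)
    exact Set.support_indicator_subset
  refine ⟨F.1.finite_toSet.isCompact.of_isClosed_subset (isClosed_tsupport _) hs, ?_,
    (Metric.diam_mono hs F.1.finite_toSet.isBounded).trans F.2, hb⟩
  refine LipschitzWith.of_dist_le_mul fun x y => ?_
  by_cases hxy : x = y
  · simp [hxy]
  · rw [Real.coe_toNNReal _ hL.le]
    calc dist (finFun F.1 g x) (finFun F.1 g y) ≤ 1 + 1 := by
          rw [dist_eq_norm]
          exact (norm_sub_le _ _).trans (add_le_add (hb x) (hb y))
      _ = 2 / δ * δ := by field_simp; norm_num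
      _ ≤ 2 / δ * dist x y := by gcongr; exact hsep x y hxy

end Functions

/-! ### Uniform local compactness -/

section LocallyCompact

variable {Y : Type*} [MetricSpace Y] {H : Type*} [NormedAddCommGroup H] [InnerProductSpace ℂ H]
  [CompleteSpace H] {ρ : C₀(Y, ℂ) →⋆ₙₐ[ℂ] (H →L[ℂ] H)}

lemma norm_rep_le (ρ : C₀(Y, ℂ) →⋆ₙₐ[ℂ] (H →L[ℂ] H)) (f : C₀(Y, ℂ)) : ‖ρ f‖ ≤ ‖f‖ :=
  NonUnitalStarAlgHom.norm_apply_le ρ f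

lemma continuous_rep (ρ : C₀(Y, ℂ) →⋆ₙₐ[ℂ] (H →L[ℂ] H)) : Continuous ρ :=
  AddMonoidHomClass.continuous_of_bound ρ 1 fun f => by simpa using norm_rep_le ρ f

lemma UniformlyLocallyCompactOp.zero : UniformlyLocallyCompactOp ρ (0 : H →L[ℂ] H) := by
  intro L R _ _ ε hε
  refine ⟨0, ?_⟩
  rintro A ⟨f, _, rfl | rfl⟩ <;> exact ⟨0, by simp, by simpa using hε⟩

lemma UniformlyLocallyCompactOp.uniformlyPseudolocalOp {S : H →L[ℂ] H}
    (hS : UniformlyLocallyCompactOp ρ S) :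
    UniformlyPseudolocalOp ρ S := by
  intro L R hL hR ε hε
  obtain ⟨N, hN⟩ := hS L R hL hR (ε / 2) (half_pos hε)
  refine ⟨N + N, ?_⟩
  rintro A ⟨f, hf, rfl⟩
  obtain ⟨k, hk, hk'⟩ := hN _ ⟨f, hf, Or.inl rfl⟩
  obtain ⟨l, hl, hl'⟩ := hN _ ⟨f, hf, Or.inr rfl⟩
  refine ⟨l + -k, ?_, ?_⟩
  · push_cast
    refine (LinearMap.rank_add_le _ _).trans (add_le_add hl ?_)
    have : LinearMap.rank ((-k : H →L[ℂ] H) : H →ₗ[ℂ] H) ≤ LinearMap.rank (k : H →ₗ[ℂ] H) := by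
      simpa using rank_mul_le_right (-1) k
    exact this.trans hk
  · have : S * ρ f - ρ f * S - (l + -k) = (S * ρ f - l) - (ρ f * S - k) := by abel
    rw [this]
    exact (norm_sub_le _ _).trans_lt (by linarith)

variable [DiscreteTopology Y]

/-- A property of operators that is closed and linear, and holds for the images of the points, holds
for the images of all functions. -/
lemma rep_mem_of_forall_pt (ρ : C₀(Y, ℂ) →⋆ₙₐ[ℂ] (H →L[ℂ] H)) {S : Submodule ℂ (H →L[ℂ] H)}
    (hS : IsClosed (S : Set (H →L[ℂ] H))) (h : ∀ y, ρ (pt y) ∈ S) (f : C₀(Y, ℂ)) : ρ f ∈ S := by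
  let S' : Submodule ℂ C₀(Y, ℂ) :=
    { carrier := {f | ρ f ∈ S}
      add_mem' := fun {a b} ha hb => by simpa using S.add_mem ha hb
      zero_mem' := by simp
      smul_mem' := fun c a ha => by simpa using S.smul_mem c ha }
  exact mem_of_forall_pt_mem (S := S') (hS.preimage (continuous_rep ρ)) h f

lemma commute_rep_of_forall_pt {A : H →L[ℂ] H} (h : ∀ y, A * ρ (pt y) = ρ (pt y) * A)
    (f : C₀(Y, ℂ)) : A * ρ f = ρ f * A := by
  let S : Submodule ℂ (H →L[ℂ] H) :=
    { carrier := {B | A * B = B * A}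
      add_mem' := fun {a b} ha hb => by
        rw [Set.mem_ofPred_eq] at *
        rw [mul_add, add_mul, ha, hb]
      zero_mem' := by simp
      smul_mem' := fun c a ha => by
        rw [Set.mem_ofPred_eq] at *
        rw [mul_smul_comm, smul_mul_assoc, ha] }
  exact rep_mem_of_forall_pt ρ (S := S) (isClosed_eq (by fun_prop) (by fun_prop)) h f

lemma rep_mul_eq_zero_of_forall_pt {A : H →L[ℂ] H} (h : ∀ y, ρ (pt y) * A = 0)
    (f : C₀(Y, ℂ)) : ρ f * A = 0 := by
  let S : Submodule ℂ (H →L[ℂ] H) :=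
    { carrier := {B | B * A = 0}
      add_mem' := fun {a b} ha hb => by
        rw [Set.mem_ofPred_eq] at *
        rw [add_mul, ha, hb, add_zero]
      zero_mem' := by simp
      smul_mem' := fun c a ha => by
        rw [Set.mem_ofPred_eq] at *
        rw [smul_mul_assoc, ha, smul_zero] }
  exact rep_mem_of_forall_pt ρ (S := S) (isClosed_eq (by fun_prop) (by fun_prop)) h f

/-- Over a uniformly discrete space, uniform local compactness can be tested on indicator functions
of finite sets of bounded diameter. -/
lemma uniformlyLocallyCompactOp_iff (hY : UniformlyDiscrete Y) {S : H →L[ℂ] H} :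
    UniformlyLocallyCompactOp ρ S ↔ ∀ R : ℝ, 0 < R →
      UnifApprox (fun F : SmallSet Y R => ρ (chi F.1) * S) ∧
      UnifApprox (fun F : SmallSet Y R => S * ρ (chi F.1)) := by
  constructor
  · intro h R hR
    obtain ⟨L, hL, hmem⟩ := exists_lipFunctions hY
    refine ⟨fun ε hε => ?_, fun ε hε => ?_⟩
    · obtain ⟨N, hN⟩ := h L R hL hR ε hε
      exact ⟨N, fun F => hN (ρ (chi F.1) * S) ⟨chi F.1, hmem R F 1 (fun y => by simp), Or.inl rfl⟩⟩
    · obtain ⟨N, hN⟩ := h L R hL hR ε hε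
      exact ⟨N, fun F => hN (S * ρ (chi F.1)) ⟨chi F.1, hmem R F 1 (fun y => by simp), Or.inr rfl⟩⟩
  · intro h L R hL hR
    obtain ⟨h1, h2⟩ := h R hR
    have hsm (f : lipFunctions Y L R) : ∃ F : SmallSet Y R, f.1 * chi F.1 = f.1 :=
      exists_smallSet f.2
    choose F hF using hsm
    have hn (f : lipFunctions Y L R) : ‖ρ f.1‖ ≤ 1 :=
      (norm_rep_le ρ _).trans (norm_le_of_forall zero_le_one f.2.2.2.2)
    have h1' : UnifApprox (fun f : lipFunctions Y L R => ρ f.1 * S) := by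
      have := (h1.comp F).mul_left (b := fun f : lipFunctions Y L R => ρ f.1) hn
      refine this.congr fun f => ?_
      rw [← mul_assoc, ← map_mul, hF]
    have h2' : UnifApprox (fun f : lipFunctions Y L R => S * ρ f.1) := by
      have := (h2.comp F).mul_right (b := fun f : lipFunctions Y L R => ρ f.1) hn
      refine this.congr fun f => ?_
      rw [mul_assoc, ← map_mul, mul_comm (chi _), hF]
    intro ε hε
    obtain ⟨m, hm⟩ := h1' ε hε
    obtain ⟨n, hn⟩ := h2' ε hε
    refine ⟨max m n, ?_⟩
    rintro A ⟨f, hf, rfl | rfl⟩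
    · obtain ⟨k, hk, hk'⟩ := hm ⟨f, hf⟩
      exact ⟨k, hk.trans (by exact_mod_cast le_max_left m n), hk'⟩
    · obtain ⟨k, hk, hk'⟩ := hn ⟨f, hf⟩
      exact ⟨k, hk.trans (by exact_mod_cast le_max_right m n), hk'⟩

lemma UniformlyPseudolocalOp.unifApprox (hY : UniformlyDiscrete Y) {T : H →L[ℂ] H}
    (hT : UniformlyPseudolocalOp ρ T) {R : ℝ} (hR : 0 < R) :
    UnifApprox (fun q : SmallSet Y R × {g : Y → ℂ // ∀ y, ‖g y‖ ≤ 1} =>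
      T * ρ (finFun q.1.1 q.2.1) - ρ (finFun q.1.1 q.2.1) * T) := by
  obtain ⟨L, hL, hmem⟩ := exists_lipFunctions hY
  intro ε hε
  obtain ⟨N, hN⟩ := hT L R hL hR ε hε
  exact ⟨N, fun q => hN _ ⟨_, hmem R q.1 q.2.1 q.2.2, rfl⟩⟩

lemma UniformlyPseudolocalOp.unifApprox_chi (hY : UniformlyDiscrete Y) {T : H →L[ℂ] H}
    (hT : UniformlyPseudolocalOp ρ T) {R : ℝ} (hR : 0 < R) :
    UnifApprox (fun F : SmallSet Y R => T * ρ (chi F.1) - ρ (chi F.1) * T) :=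
  (hT.unifApprox hY hR).comp fun F => (F, ⟨1, fun y => by simp⟩)

namespace UniformlyLocallyCompactOp

variable {S T : H →L[ℂ] H}

lemma add (hY : UniformlyDiscrete Y) (hS : UniformlyLocallyCompactOp ρ S)
    (hT : UniformlyLocallyCompactOp ρ T) : UniformlyLocallyCompactOp ρ (S + T) := by
  rw [uniformlyLocallyCompactOp_iff hY] at *
  intro R hR
  exact ⟨((hS R hR).1.add (hT R hR).1).congr fun F => mul_add _ _ _,
    ((hS R hR).2.add (hT R hR).2).congr fun F => add_mul _ _ _⟩

lemma smul (hY : UniformlyDiscrete Y) (hS : UniformlyLocallyCompactOp ρ S) (c : ℂ) :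
    UniformlyLocallyCompactOp ρ (c • S) := by
  rw [uniformlyLocallyCompactOp_iff hY] at *
  intro R hR
  exact ⟨((hS R hR).1.const_smul c).congr fun F => mul_smul_comm _ _ _,
    ((hS R hR).2.const_smul c).congr fun F => smul_mul_assoc _ _ _⟩

lemma neg (hY : UniformlyDiscrete Y) (hS : UniformlyLocallyCompactOp ρ S) :
    UniformlyLocallyCompactOp ρ (-S) := by
  simpa using hS.smul hY (-1)

lemma sub (hY : UniformlyDiscrete Y) (hS : UniformlyLocallyCompactOp ρ S)
    (hT : UniformlyLocallyCompactOp ρ T) : UniformlyLocallyCompactOp ρ (S - T) := by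
  rw [sub_eq_add_neg]
  exact hS.add hY (hT.neg hY)

lemma mul_left (hY : UniformlyDiscrete Y) (hS : UniformlyLocallyCompactOp ρ S)
    (hT : UniformlyPseudolocalOp ρ T) : UniformlyLocallyCompactOp ρ (T * S) := by
  rw [uniformlyLocallyCompactOp_iff hY] at *
  intro R hR
  constructor
  · exact (((hS R hR).1.mul_left (b := fun _ => T) (fun _ => le_rfl)).sub
      ((hT.unifApprox_chi hY hR).mul_right (b := fun _ => S) (fun _ => le_rfl))).congr fun F => by
        noncomm_ring
  · exact ((hS R hR).2.mul_left (b := fun _ => T) (fun _ => le_rfl)).congr fun F => mul_assoc _ _ _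

lemma mul_right (hY : UniformlyDiscrete Y) (hS : UniformlyLocallyCompactOp ρ S)
    (hT : UniformlyPseudolocalOp ρ T) : UniformlyLocallyCompactOp ρ (S * T) := by
  rw [uniformlyLocallyCompactOp_iff hY] at *
  intro R hR
  constructor
  · exact ((hS R hR).1.mul_right (b := fun _ => T) (fun _ => le_rfl)).congr fun F =>
      (mul_assoc _ _ _).symm
  · exact (((hS R hR).2.mul_right (b := fun _ => T) (fun _ => le_rfl)).add
      ((hT.unifApprox_chi hY hR).mul_left (b := fun _ => S) (fun _ => le_rfl))).congr fun F => by
        noncomm_ring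

/-- Over a uniformly discrete space, uniform local compactness implies local compactness. -/
lemma locallyCompactOp (hY : UniformlyDiscrete Y) (hS : UniformlyLocallyCompactOp ρ S) :
    LocallyCompactOp ρ S := by
  rw [uniformlyLocallyCompactOp_iff hY] at hS
  obtain ⟨h1, h2⟩ := hS 1 one_pos
  have hcl : IsClosed {f : H →L[ℂ] H | IsCompactOperator f} :=
    isClosed_setOfPred_isCompactOperator
  intro f
  constructor
  · let V : Submodule ℂ (H →L[ℂ] H) :=
      { carrier := {B | IsCompactOperator (B * S)}
        add_mem' := fun {a b} ha hb => by
          rw [Set.mem_ofPred_eq, add_mul]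
          exact IsCompactOperator.add (f := a * S) (g := b * S) ha hb
        zero_mem' := by
          rw [Set.mem_ofPred_eq, zero_mul]
          exact isCompactOperator_zero
        smul_mem' := fun c a ha => by
          rw [Set.mem_ofPred_eq, smul_mul_assoc]
          exact IsCompactOperator.smul (f := a * S) ha c }
    refine rep_mem_of_forall_pt ρ (S := V) (hcl.preimage (f := fun B => B * S) (by fun_prop)) ?_ f
    exact fun y => h1.isCompactOperator ⟨{y}, by simp⟩
  · let V : Submodule ℂ (H →L[ℂ] H) :=
      { carrier := {B | IsCompactOperator (S * B)}
        add_mem' := fun {a b} ha hb => by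
          rw [Set.mem_ofPred_eq, mul_add]
          exact IsCompactOperator.add (f := S * a) (g := S * b) ha hb
        zero_mem' := by
          rw [Set.mem_ofPred_eq, mul_zero]
          exact isCompactOperator_zero
        smul_mem' := fun c a ha => by
          rw [Set.mem_ofPred_eq, mul_smul_comm]
          exact IsCompactOperator.smul (f := S * a) ha c }
    refine rep_mem_of_forall_pt ρ (S := V) (hcl.preimage (f := fun B => S * B) (by fun_prop)) ?_ f
    exact fun y => h2.isCompactOperator ⟨{y}, by simp⟩

end UniformlyLocallyCompactOp

end LocallyCompact

/-! ### Perturbations of uniform Fredholm modules -/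

section Perturbation

variable {Y : Type*} [MetricSpace Y] {p : ℕ} {M : MultigradedRep p Y}
  {K T : M.H →L[ℂ] M.H}

/-- Over a uniformly discrete space the compactness conditions follow from the uniform ones, if the
operator is the sum of a pseudolocal one and a uniformly locally compact one. -/
lemma IsUniformFredholm.add (hY : UniformlyDiscrete Y) (hT : IsUniformFredholm M T)
    (h_odd : K * M.γ = -(M.γ * K)) (he : ∀ i, K * M.e i = M.e i * K)
    (hK : UniformlyLocallyCompactOp M.ρ K) (hK' : UniformlyLocallyCompactOp M.ρ (star K)) :
    IsUniformFredholm M (T + K) := by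
  have := hY.discreteTopology
  have h1 : UniformlyLocallyCompactOp M.ρ ((T + K) * (T + K) - 1) := by
    have : (T + K) * (T + K) - 1 = (T * T - 1) + (T * K + K * T + K * K) := by noncomm_ring
    rw [this]
    exact hT.uniformly_sq_sub_one.add hY (((hK.mul_left hY hT.uniformly_pseudolocal).add hY
      (hK.mul_right hY hT.uniformly_pseudolocal)).add hY
        (hK.mul_left hY hK.uniformlyPseudolocalOp))
  have h2 : UniformlyLocallyCompactOp M.ρ (T + K - star (T + K)) := by
    have : T + K - star (T + K) = (T - star T) + (K - star K) := by rw [star_add]; abel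
    rw [this]
    exact hT.uniformly_sub_star.add hY (hK.sub hY hK')
  have hKc := hK.locallyCompactOp hY
  refine ⟨⟨?_, fun i => ?_, h1.locallyCompactOp hY, h2.locallyCompactOp hY, fun f => ?_⟩, ?_, h1, h2⟩
  · rw [add_mul, mul_add, hT.odd, h_odd, neg_add]
  · rw [add_mul, mul_add, hT.multigraded, he]
  · have : (T + K) * M.ρ f - M.ρ f * (T + K) =
        (T * M.ρ f - M.ρ f * T) + (K * M.ρ f - M.ρ f * K) := by noncomm_ring
    rw [this]
    exact IsCompactOperator.add (f := T * M.ρ f - M.ρ f * T) (g := K * M.ρ f - M.ρ f * K)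
      (hT.pseudolocal f) (IsCompactOperator.sub (f := K * M.ρ f) (g := M.ρ f * K)
        (hKc f).2 (hKc f).1)
  · intro L R hL hR ε hε
    obtain ⟨m, hm⟩ := hT.uniformly_pseudolocal L R hL hR (ε / 2) (half_pos hε)
    obtain ⟨n, hn⟩ := hK.uniformlyPseudolocalOp L R hL hR (ε / 2) (half_pos hε)
    refine ⟨m + n, ?_⟩
    rintro A ⟨f, hf, rfl⟩
    obtain ⟨k, hk, hk'⟩ := hm _ ⟨f, hf, rfl⟩
    obtain ⟨l, hl, hl'⟩ := hn _ ⟨f, hf, rfl⟩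
    refine ⟨k + l, ?_, ?_⟩
    · push_cast
      exact (LinearMap.rank_add_le _ _).trans (add_le_add hk hl)
    · have : (T + K) * M.ρ f - M.ρ f * (T + K) - (k + l) =
        (T * M.ρ f - M.ρ f * T - k) + (K * M.ρ f - M.ρ f * K - l) := by noncomm_ring
      rw [this]
      exact (norm_add_le _ _).trans_lt (by linarith)

end Perturbation

/-! ### Classes in uniform K-homology -/

section Classes

variable {Y : Type*} [MetricSpace Y] {p : ℕ}

/-- The class of a uniform Fredholm module. -/
def cls (x : UniformFredholmModule p Y) : UniformKHomologyGroup p Y :=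
  QuotientAddGroup.mk (FreeAbelianGroup.of x)

lemma cls_eq_of_sub_mem {x y : UniformFredholmModule p Y}
    (h : FreeAbelianGroup.of x - FreeAbelianGroup.of y ∈ relations p Y) : cls x = cls y := by
  rw [cls, cls, QuotientAddGroup.eq_iff_sub_mem]
  exact h

lemma UnitarilyEquivalent.cls_eq {x y : UniformFredholmModule p Y} (h : UnitarilyEquivalent x y) :
    cls x = cls y :=
  cls_eq_of_sub_mem (AddSubgroup.subset_closure (Or.inl (Or.inl ⟨x, y, h, rfl⟩)))

lemma OperatorHomotopic.cls_eq {x y : UniformFredholmModule p Y} (h : OperatorHomotopic x y) :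
    cls x = cls y :=
  cls_eq_of_sub_mem (AddSubgroup.subset_closure (Or.inl (Or.inr ⟨x, y, h, rfl⟩)))

lemma cls_directSum (x y : UniformFredholmModule p Y) : cls (x.directSum y) = cls x + cls y := by
  rw [cls, cls, cls, ← QuotientAddGroup.mk_add, eq_comm, QuotientAddGroup.eq_iff_sub_mem]
  exact AddSubgroup.subset_closure (Or.inr ⟨x, y, rfl⟩)

variable {M : MultigradedRep p Y} {K T : M.H →L[ℂ] M.H}

/-- Uniformly locally compact perturbations do not change the class. -/
lemma cls_perturb (hY : UniformlyDiscrete Y) (hT : IsUniformFredholm M T)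
    (h_odd : K * M.γ = -(M.γ * K)) (he : ∀ i, K * M.e i = M.e i * K)
    (hK : UniformlyLocallyCompactOp M.ρ K) (hK' : UniformlyLocallyCompactOp M.ρ (star K)) :
    OperatorHomotopic (⟨M, T, hT⟩ : UniformFredholmModule p Y)
      ⟨M, T + K, hT.add hY h_odd he hK hK'⟩ := by
  have := hY.discreteTopology
  have hpath (t : unitInterval) : IsUniformFredholm M (T + ((t : ℝ) : ℂ) • K) := by
    refine hT.add hY ?_ (fun i => ?_) (hK.smul hY _) ?_
    · rw [smul_mul_assoc, h_odd, mul_smul_comm, smul_neg]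
    · rw [smul_mul_assoc, he, mul_smul_comm]
    · rw [star_smul]
      exact hK'.smul hY _
  refine ⟨M, fun t => T + ((t : ℝ) : ℂ) • K, hpath, by fun_prop, ?_, ?_⟩
  · congr 1
    simp
  · congr 1
    simp

end Classes

/-! ### Strong sums of operators along orthogonal projections -/

section StrongSum

variable {H : Type*} [NormedAddCommGroup H] [InnerProductSpace ℂ H] {ι : Type*}

/-- The strong operator convergent sum of the family `B` is `A`. -/
def IsStrongSum (B : ι → (H →L[ℂ] H)) (A : H →L[ℂ] H) : Prop :=
  ∀ v, HasSum (fun i => B i v) (A v)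

lemma IsStrongSum.mul_comm_of_forall {B : ι → (H →L[ℂ] H)} {A X : H →L[ℂ] H}
    (h : IsStrongSum B A) (hX : ∀ i, B i * X = X * B i) : A * X = X * A := by
  ext v
  refine (h (X v)).unique ?_
  have := (h v).mapL X
  refine this.congr_fun fun i => ?_
  exact congrArg (fun C : H →L[ℂ] H => C v) (hX i)

lemma IsStrongSum.mul_anticomm_of_forall {B : ι → (H →L[ℂ] H)} {A X : H →L[ℂ] H}
    (h : IsStrongSum B A) (hX : ∀ i, B i * X = -(X * B i)) : A * X = -(X * A) := by
  ext v
  refine (h (X v)).unique ?_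
  have := ((h v).mapL X).neg
  refine this.congr_fun fun i => ?_
  exact congrArg (fun C : H →L[ℂ] H => C v) (hX i)

variable [CompleteSpace H]

lemma IsStrongSum.isSelfAdjoint {B : ι → (H →L[ℂ] H)} {A : H →L[ℂ] H}
    (h : IsStrongSum B A) (hB : ∀ i, IsSelfAdjoint (B i)) : IsSelfAdjoint A := by
  rw [ContinuousLinearMap.isSelfAdjoint_iff_isSymmetric]
  intro v w
  have h1 := (h w).mapL (innerSL ℂ v)
  have h2 : HasSum (fun i => inner ℂ (B i v) w) (inner ℂ (A v) w) := by
    have := ((h v).mapL (innerSL ℂ w)).map (starRingEnd ℂ) Complex.continuous_conj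
    simpa [Function.comp_def, inner_conj_symm] using this
  refine h2.unique (h1.congr_fun fun i => ?_)
  exact (ContinuousLinearMap.isSelfAdjoint_iff_isSymmetric.1 (hB i)) v w

/-- A family of pairwise orthogonal projections. -/
structure IsProjFamily (P : ι → (H →L[ℂ] H)) : Prop where
  isSelfAdjoint : ∀ i, IsSelfAdjoint (P i)
  idem : ∀ i, P i * P i = P i
  orth : ∀ i j, i ≠ j → P i * P j = 0

namespace IsProjFamily

variable {P : ι → (H →L[ℂ] H)} {B : ι → (H →L[ℂ] H)} {A : H →L[ℂ] H}

lemma inner_eq (hP : IsProjFamily P) (i : ι) (v w : H) :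
    inner ℂ (P i v) w = inner ℂ v (P i w) :=
  (ContinuousLinearMap.isSelfAdjoint_iff_isSymmetric.1 (hP.isSelfAdjoint i)) v w

lemma apply_apply (hP : IsProjFamily P) (i : ι) (v : H) : P i (P i v) = P i v :=
  congrArg (fun C : H →L[ℂ] H => C v) (hP.idem i)

lemma apply_apply_ne (hP : IsProjFamily P) {i j : ι} (h : i ≠ j) (v : H) : P i (P j v) = 0 :=
  congrArg (fun C : H →L[ℂ] H => C v) (hP.orth i j h)

lemma orthogonalFamily (hP : IsProjFamily P) :
    OrthogonalFamily ℂ (fun i => LinearMap.range (P i : H →ₗ[ℂ] H))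
      fun i => (LinearMap.range (P i : H →ₗ[ℂ] H)).subtypeₗᵢ := by
  rintro i j hij ⟨_, v, rfl⟩ ⟨_, w, rfl⟩
  change inner ℂ (P i v) (P j w) = 0
  rw [hP.inner_eq, hP.apply_apply_ne hij, inner_zero_right]

lemma norm_sum_sq (hP : IsProjFamily P) {x : ι → H} (hx : ∀ i, P i (x i) = x i) (s : Finset ι) :
    ‖∑ i ∈ s, x i‖ ^ 2 = ∑ i ∈ s, ‖x i‖ ^ 2 :=
  hP.orthogonalFamily.norm_sum (fun i => ⟨x i, x i, hx i⟩) s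

lemma summable_iff (hP : IsProjFamily P) {x : ι → H} (hx : ∀ i, P i (x i) = x i) :
    Summable x ↔ Summable fun i => ‖x i‖ ^ 2 :=
  hP.orthogonalFamily.summable_iff_norm_sq_summable fun i => ⟨x i, x i, hx i⟩

lemma sum_norm_sq_le (hP : IsProjFamily P) (v : H) (s : Finset ι) :
    ∑ i ∈ s, ‖P i v‖ ^ 2 ≤ ‖v‖ ^ 2 := by
  have h1 := hP.norm_sum_sq (x := fun i => P i v) (fun i => hP.apply_apply i v) s
  have h2 : ((∑ i ∈ s, ‖P i v‖ ^ 2 : ℝ) : ℂ) = inner ℂ (∑ i ∈ s, P i v) v := by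
    rw [sum_inner]
    push_cast
    refine Finset.sum_congr rfl fun i _ => ?_
    rw [← hP.apply_apply, hP.inner_eq, inner_self_eq_norm_sq_to_K, hP.apply_apply]
    rfl
  have h3 : ∑ i ∈ s, ‖P i v‖ ^ 2 ≤ ‖∑ i ∈ s, P i v‖ * ‖v‖ := by
    have h4 := norm_inner_le_norm (𝕜 := ℂ) (∑ i ∈ s, P i v) v
    rw [← h2, Complex.norm_real] at h4
    exact (le_abs_self _).trans h4
  rw [← h1] at h3 ⊢
  have h0 : ‖∑ i ∈ s, P i v‖ ≤ ‖v‖ := by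
    by_contra! hlt
    nlinarith [norm_nonneg v]
  gcongr

/-- A bounded family of operators on the ranges of orthogonal projections has a strong sum. -/
lemma exists_isStrongSum (hP : IsProjFamily P) (hl : ∀ i, P i * B i = B i)
    (hr : ∀ i, B i * P i = B i) {C : ℝ} (hC : ∀ i, ‖B i‖ ≤ C) :
    ∃ A : H →L[ℂ] H, IsStrongSum B A := by
  have hl' (v : H) (i : ι) : P i (B i v) = B i v := congrArg (fun C : H →L[ℂ] H => C v) (hl i)
  have hb (v : H) (s : Finset ι) : ∑ i ∈ s, ‖B i v‖ ^ 2 ≤ C ^ 2 * ‖v‖ ^ 2 := by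
    calc ∑ i ∈ s, ‖B i v‖ ^ 2 ≤ ∑ i ∈ s, C ^ 2 * ‖P i v‖ ^ 2 := by
          refine Finset.sum_le_sum fun i _ => ?_
          rw [← mul_pow]
          gcongr
          have : B i v = B i (P i v) := congrArg (fun C : H →L[ℂ] H => C v) (hr i).symm
          rw [this]
          exact (B i).le_of_opNorm_le (hC i) _
      _ = C ^ 2 * ∑ i ∈ s, ‖P i v‖ ^ 2 := by rw [Finset.mul_sum]
      _ ≤ _ := by gcongr; exact hP.sum_norm_sq_le v s
  have hs (v : H) : Summable fun i => B i v :=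
    (hP.summable_iff (hl' v)).2 (summable_of_sum_le (fun i => by positivity) (hb v))
  let A₀ : H →ₗ[ℂ] H :=
    { toFun := fun v => ∑' i, B i v
      map_add' := fun v w => by simp only [map_add]; exact (hs v).tsum_add (hs w)
      map_smul' := fun c v => by
        simp only [map_smul, RingHom.id_apply]
        exact (hs v).tsum_const_smul c }
  refine ⟨A₀.mkContinuous |C| fun v => ?_, fun v => (hs v).hasSum⟩
  refine le_of_tendsto ((hs v).hasSum.norm) (Filter.Eventually.of_forall fun s => ?_)
  refine abs_le_of_sq_le_sq' ?_ (by positivity) |>.2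
  rw [hP.norm_sum_sq (hl' v), mul_pow, sq_abs]
  exact hb v s

lemma strongSum_mul (hP : IsProjFamily P) (hA : IsStrongSum B A) (hr : ∀ i, B i * P i = B i)
    (i : ι) : A * P i = B i := by
  ext v
  refine (hA (P i v)).unique ?_
  have hr' (j : ι) (w : H) : B j (P j w) = B j w := congrArg (fun C : H →L[ℂ] H => C w) (hr j)
  rw [← hr' i v]
  refine hasSum_single i fun j hj => ?_
  rw [← hr' j, hP.apply_apply_ne hj, map_zero]

lemma mul_strongSum (hP : IsProjFamily P) (hA : IsStrongSum B A) (hl : ∀ i, P i * B i = B i)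
    (i : ι) : P i * A = B i := by
  ext v
  refine ((hA v).mapL (P i)).unique ?_
  have hl' (j : ι) (w : H) : P j (B j w) = B j w := congrArg (fun C : H →L[ℂ] H => C w) (hl j)
  have : B i v = P i (B i v) := (hl' i v).symm
  rw [this]
  refine hasSum_single i fun j hj => ?_
  rw [← hl' j, hP.apply_apply_ne hj.symm]

end IsProjFamily

end StrongSum

/-! ### Passing to selfadjoint operators that commute with the representation -/

section Signs

variable {Y : Type*}

/-- The function on `Y` that extends a choice of signs on `F`. -/
def signFun (F : Finset Y) (s : F → ℤˣ) : Y → ℂ := by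
  classical
  exact fun y => if h : y ∈ F then ((s ⟨y, h⟩ : ℤ) : ℂ) else 1

lemma signFun_mul_self (F : Finset Y) (s : F → ℤˣ) (y : Y) :
    signFun F s y * signFun F s y = 1 := by
  unfold signFun
  split_ifs with h
  · rcases Int.units_eq_one_or (s ⟨y, h⟩) with h | h <;> simp [h]
  · simp

lemma norm_signFun_le (F : Finset Y) (s : F → ℤˣ) (y : Y) : ‖signFun F s y‖ ≤ 1 := by
  unfold signFun
  split_ifs with h
  · rcases Int.units_eq_one_or (s ⟨y, h⟩) with h | h <;> simp [h]
  · simp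

lemma sum_signFun_mul [DecidableEq Y] (F : Finset Y) {y z : Y} (hy : y ∈ F) (hz : z ∈ F) :
    ∑ s : F → ℤˣ, signFun F s y * signFun F s z =
      if y = z then (Fintype.card (F → ℤˣ) : ℂ) else 0 := by
  split_ifs with h
  · subst h
    simp only [signFun_mul_self, Finset.sum_const, Finset.card_univ, nsmul_eq_mul, mul_one]
  · -- flipping the sign at `y` changes the sign of the sum
    have h1 := (Equiv.sum_comp (Equiv.mulLeft (Pi.mulSingle (⟨y, hy⟩ : F) (-1 : ℤˣ)))
      fun s : F → ℤˣ => signFun F s y * signFun F s z)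
    have h2 (s : F → ℤˣ) : signFun F (Equiv.mulLeft (Pi.mulSingle (⟨y, hy⟩ : F) (-1 : ℤˣ)) s) y *
        signFun F (Equiv.mulLeft (Pi.mulSingle (⟨y, hy⟩ : F) (-1 : ℤˣ)) s) z =
        -(signFun F s y * signFun F s z) := by
      have hne : (⟨z, hz⟩ : F) ≠ ⟨y, hy⟩ := fun h' => h (congrArg Subtype.val h').symm
      simp [signFun, hy, hz, Pi.mulSingle_eq_of_ne hne]
    simp only [h2, Finset.sum_neg_distrib] at h1
    exact self_eq_neg.1 h1.symm

end Signs

section Diagonal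

variable {Y : Type*} [MetricSpace Y] {p : ℕ} {M : MultigradedRep p Y}

lemma MultigradedRep.star_e (M : MultigradedRep p Y) (i : Fin p) : star (M.e i) = -M.e i := by
  have h1 := Unitary.star_mul_self_of_mem (M.e_unitary i)
  have h2 : star (M.e i) * (M.e i * M.e i) = M.e i := by rw [← mul_assoc, h1, one_mul]
  rw [M.e_sq, mul_neg, mul_one] at h2
  exact neg_eq_iff_eq_neg.1 h2

lemma odd_star {T : M.H →L[ℂ] M.H} (h : T * M.γ = -(M.γ * T)) :
    star T * M.γ = -(M.γ * star T) := by
  have := congrArg star h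
  rw [star_neg, star_mul, star_mul, M.γ_selfAdjoint.star_eq] at this
  rw [this, neg_neg]

lemma multigraded_star {T : M.H →L[ℂ] M.H} {i : Fin p} (h : T * M.e i = M.e i * T) :
    star T * M.e i = M.e i * star T := by
  have := congrArg star h
  rw [star_mul, star_mul, M.star_e, neg_mul, mul_neg, neg_inj] at this
  exact this.symm

variable [DiscreteTopology Y]

section Rep

variable {H : Type*} [NormedAddCommGroup H] [InnerProductSpace ℂ H] [CompleteSpace H]
  (ρ : C₀(Y, ℂ) →⋆ₙₐ[ℂ] (H →L[ℂ] H))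

lemma isProjFamily_rep : IsProjFamily fun y => ρ (pt y) where
  isSelfAdjoint y := by rw [IsSelfAdjoint, ← map_star, star_pt]
  idem y := by rw [← map_mul, pt_mul_self]
  orth y z h := by rw [← map_mul, pt_mul_ne h, map_zero]

lemma average_signFun [DecidableEq Y] (F : Finset Y) (T : H →L[ℂ] H) :
    (Fintype.card (F → ℤˣ) : ℂ)⁻¹ • ∑ s : F → ℤˣ,
      ρ (finFun F (signFun F s)) * T * ρ (finFun F (signFun F s)) =
        ∑ y ∈ F, ρ (pt y) * T * ρ (pt y) := by
  have h1 (s : F → ℤˣ) : ρ (finFun F (signFun F s)) * T * ρ (finFun F (signFun F s)) =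
      ∑ y ∈ F, ∑ z ∈ F, (signFun F s y * signFun F s z) • (ρ (pt y) * T * ρ (pt z)) := by
    rw [finFun_eq_sum, map_sum, Finset.sum_mul, Finset.sum_mul_sum]
    refine Finset.sum_congr rfl fun y _ => Finset.sum_congr rfl fun z _ => ?_
    simp only [map_smul, smul_mul_assoc, mul_smul_comm, smul_smul]
    rw [mul_comm (signFun F s z)]
  have h2 : ∑ s : F → ℤˣ, ρ (finFun F (signFun F s)) * T * ρ (finFun F (signFun F s)) =
      ∑ y ∈ F, ∑ z ∈ F, (if y = z then (Fintype.card (F → ℤˣ) : ℂ) else 0) •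
        (ρ (pt y) * T * ρ (pt z)) := by
    simp only [h1]
    rw [Finset.sum_comm]
    refine Finset.sum_congr rfl fun y hy => ?_
    rw [Finset.sum_comm]
    refine Finset.sum_congr rfl fun z hz => ?_
    rw [← Finset.sum_smul, sum_signFun_mul F hy hz]
  have hc : (Fintype.card (F → ℤˣ) : ℂ) ≠ 0 := by exact_mod_cast Fintype.card_ne_zero
  rw [h2, Finset.smul_sum]
  refine Finset.sum_congr rfl fun y hy => ?_
  simp only [ite_smul, zero_smul, Finset.sum_ite_eq, hy, if_true]
  rw [smul_smul, inv_mul_cancel₀ hc, one_smul]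

variable {ρ}

/-- The off-diagonal part of a uniformly pseudolocal operator is uniformly locally compact: it is an
average of commutators with functions of absolute value one. There is no bound on the cardinality of
a set of given diameter, so that it matters that such averages are uniformly approximable. -/
lemma UniformlyPseudolocalOp.sub_diagonal (hY : UniformlyDiscrete Y) {T D : H →L[ℂ] H}
    (hT : UniformlyPseudolocalOp ρ T) (hD : ∀ y, ρ (pt y) * D = ρ (pt y) * T * ρ (pt y))
    (hD' : ∀ y, D * ρ (pt y) = ρ (pt y) * T * ρ (pt y)) :
    UniformlyLocallyCompactOp ρ (D - T) := by
  classical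
  rw [uniformlyLocallyCompactOp_iff hY]
  intro R hR
  have h0 := hT.unifApprox hY hR
  have hn (q : SmallSet Y R × {g : Y → ℂ // ∀ y, ‖g y‖ ≤ 1}) : ‖ρ (finFun q.1.1 q.2.1)‖ ≤ 1 :=
    (norm_rep_le ρ _).trans (norm_finFun_le q.2.2)
  have hcomm (q : SmallSet Y R × {g : Y → ℂ // ∀ y, ‖g y‖ ≤ 1}) :
      ‖T * ρ (finFun q.1.1 q.2.1) - ρ (finFun q.1.1 q.2.1) * T‖ ≤ ‖T‖ + ‖T‖ := by
    refine (norm_sub_le _ _).trans (add_le_add ?_ ?_)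
    · exact (norm_mul_le _ _).trans (mul_le_of_le_one_right (norm_nonneg _) (hn q))
    · exact (norm_mul_le _ _).trans (mul_le_of_le_one_left (norm_nonneg _) (hn q))
  let φ : ∀ F : SmallSet Y R, (F.1 → ℤˣ) → SmallSet Y R × {g : Y → ℂ // ∀ y, ‖g y‖ ≤ 1} :=
    fun F s => (F, ⟨signFun F.1 s, norm_signFun_le F.1 s⟩)
  have hsq (F : SmallSet Y R) (s : F.1 → ℤˣ) :
      ρ (finFun F.1 (signFun F.1 s)) * ρ (finFun F.1 (signFun F.1 s)) = ρ (chi F.1) := by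
    rw [← map_mul, finFun_mul, show signFun F.1 s * signFun F.1 s = 1 from
      funext (signFun_mul_self F.1 s), chi]
  have hav (F : SmallSet Y R) (A : H →L[ℂ] H) :
      (Fintype.card (F.1 → ℤˣ) : ℂ)⁻¹ • ∑ _s : F.1 → ℤˣ, A = A := by
    have hc : (Fintype.card (F.1 → ℤˣ) : ℂ) ≠ 0 := by exact_mod_cast Fintype.card_ne_zero
    rw [Finset.sum_const, Finset.card_univ, ← Nat.cast_smul_eq_nsmul ℂ, smul_smul,
      inv_mul_cancel₀ hc, one_smul]
  constructor
  · refine (h0.mul_left hn).average (C := ‖T‖ + ‖T‖) (fun q => ?_) φ fun F => ?_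
    · exact (norm_mul_le _ _).trans ((mul_le_of_le_one_left (norm_nonneg _) (hn q)).trans (hcomm q))
    · have h2 (s : F.1 → ℤˣ) : ρ (finFun F.1 (signFun F.1 s)) *
          (T * ρ (finFun F.1 (signFun F.1 s)) - ρ (finFun F.1 (signFun F.1 s)) * T) =
          ρ (finFun F.1 (signFun F.1 s)) * T * ρ (finFun F.1 (signFun F.1 s)) -
            ρ (chi F.1) * T := by
        rw [mul_sub, ← mul_assoc, ← mul_assoc, hsq]
      simp only [φ, h2]
      rw [Finset.sum_sub_distrib, smul_sub, average_signFun, hav, mul_sub, chi_eq_sum, map_sum,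
        Finset.sum_mul]
      simp only [hD]
  · refine ((h0.neg).mul_right hn).average (C := ‖T‖ + ‖T‖) (fun q => ?_) φ fun F => ?_
    · refine (norm_mul_le _ _).trans ((mul_le_of_le_one_right (norm_nonneg _) (hn q)).trans ?_)
      rw [norm_neg]
      exact hcomm q
    · have h2 (s : F.1 → ℤˣ) :
          -(T * ρ (finFun F.1 (signFun F.1 s)) - ρ (finFun F.1 (signFun F.1 s)) * T) *
            ρ (finFun F.1 (signFun F.1 s)) =
          ρ (finFun F.1 (signFun F.1 s)) * T * ρ (finFun F.1 (signFun F.1 s)) -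
            T * ρ (chi F.1) := by
        rw [neg_sub, sub_mul, mul_assoc T, hsq]
      simp only [φ, h2]
      rw [Finset.sum_sub_distrib, smul_sub, average_signFun, hav, sub_mul, chi_eq_sum, map_sum,
        Finset.mul_sum]
      simp only [hD']

end Rep

/-- The class of a uniform Fredholm module is represented by a selfadjoint operator that commutes
with the representation. -/
theorem exists_diagonal (hY : UniformlyDiscrete Y) {T : M.H →L[ℂ] M.H}
    (hT : IsUniformFredholm M T) :
    ∃ (S : M.H →L[ℂ] M.H) (hS : IsUniformFredholm M S), IsSelfAdjoint S ∧
      (∀ f, S * M.ρ f = M.ρ f * S) ∧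
      (∀ y, M.ρ (pt y) * S = M.ρ (pt y) * ((1 / 2 : ℂ) • (T + star T)) * M.ρ (pt y)) ∧
      cls (⟨M, T, hT⟩ : UniformFredholmModule p Y) = cls ⟨M, S, hS⟩ := by
  set A : M.H →L[ℂ] M.H := (1 / 2 : ℂ) • (T + star T) with hAdef
  have hAsa : IsSelfAdjoint A := by
    rw [IsSelfAdjoint, hAdef, star_smul, star_add, star_star, add_comm]
    simp
  have hAodd : A * M.γ = -(M.γ * A) := by
    rw [hAdef, smul_mul_assoc, mul_smul_comm, add_mul, mul_add, hT.odd, odd_star hT.odd, ← neg_add,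
      smul_neg]
  have hAe (i : Fin p) : A * M.e i = M.e i * A := by
    rw [hAdef, smul_mul_assoc, mul_smul_comm, add_mul, mul_add, hT.multigraded,
      multigraded_star (hT.multigraded i)]
  -- the first perturbation makes the operator selfadjoint
  have hK : UniformlyLocallyCompactOp M.ρ (A - T) := by
    have : A - T = (-1 / 2 : ℂ) • (T - star T) := by rw [hAdef]; module
    rw [this]
    exact hT.uniformly_sub_star.smul hY _
  have hK' : UniformlyLocallyCompactOp M.ρ (star (A - T)) := by
    have : star (A - T) = (1 / 2 : ℂ) • (T - star T) := by
      rw [star_sub, hAsa.star_eq, hAdef]; module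
    rw [this]
    exact hT.uniformly_sub_star.smul hY _
  have h1 := cls_perturb hY hT (K := A - T)
    (by rw [sub_mul, mul_sub, hAodd, hT.odd]; abel)
    (fun i => by rw [sub_mul, mul_sub, hAe, hT.multigraded]) hK hK'
  have hA : IsUniformFredholm M A := by
    have := hT.add hY (K := A - T)
      (by rw [sub_mul, mul_sub, hAodd, hT.odd]; abel)
      (fun i => by rw [sub_mul, mul_sub, hAe, hT.multigraded]) hK hK'
    rwa [add_sub_cancel] at this
  -- the second one makes it diagonal
  have hP := isProjFamily_rep M.ρ
  have hl (y : Y) : M.ρ (pt y) * (M.ρ (pt y) * A * M.ρ (pt y)) = M.ρ (pt y) * A * M.ρ (pt y) := by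
    rw [← mul_assoc, ← mul_assoc, hP.idem]
  have hr (y : Y) : M.ρ (pt y) * A * M.ρ (pt y) * M.ρ (pt y) = M.ρ (pt y) * A * M.ρ (pt y) := by
    rw [mul_assoc, hP.idem]
  obtain ⟨S, hS⟩ := hP.exists_isStrongSum hl hr (C := ‖A‖) fun y => by
    have hn : ‖M.ρ (pt y)‖ ≤ 1 := (norm_rep_le _ _).trans (norm_pt_le y)
    calc _ ≤ ‖M.ρ (pt y)‖ * ‖A‖ * ‖M.ρ (pt y)‖ := by
          refine (norm_mul_le _ _).trans ?_
          gcongr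
          exact norm_mul_le _ _
      _ ≤ 1 * ‖A‖ * 1 := by gcongr
      _ = ‖A‖ := by ring
  have hSl := hP.mul_strongSum hS hl
  have hSr := hP.strongSum_mul hS hr
  have hSsa : IsSelfAdjoint S := hS.isSelfAdjoint fun y => by
    rw [IsSelfAdjoint, star_mul, star_mul, hAsa.star_eq, (hP.isSelfAdjoint y).star_eq, mul_assoc]
  have hSodd : S * M.γ = -(M.γ * S) := hS.mul_anticomm_of_forall fun y => by
    rw [mul_assoc, M.ρ_even, ← mul_assoc, mul_assoc _ A, hAodd, mul_neg, neg_mul, ← mul_assoc,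
      M.ρ_even]
    simp only [mul_assoc]
  have hSe (i : Fin p) : S * M.e i = M.e i * S := hS.mul_comm_of_forall fun y => by
    rw [mul_assoc, M.ρ_multigraded, ← mul_assoc, mul_assoc _ A, hAe, ← mul_assoc,
      M.ρ_multigraded]
    simp only [mul_assoc]
  have hL : UniformlyLocallyCompactOp M.ρ (S - A) :=
    hA.uniformly_pseudolocal.sub_diagonal hY hSl hSr
  have hL' : UniformlyLocallyCompactOp M.ρ (star (S - A)) := by
    rwa [star_sub, hSsa.star_eq, hAsa.star_eq]
  have h2 := cls_perturb hY hA (K := S - A)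
    (by rw [sub_mul, mul_sub, hAodd, hSodd]; abel)
    (fun i => by rw [sub_mul, mul_sub, hAe, hSe]) hL hL'
  have hS' : IsUniformFredholm M S := by
    have := hA.add hY (K := S - A)
      (by rw [sub_mul, mul_sub, hAodd, hSodd]; abel)
      (fun i => by rw [sub_mul, mul_sub, hAe, hSe]) hL hL'
    rwa [add_sub_cancel] at this
  refine ⟨S, hS', hSsa, commute_rep_of_forall_pt fun y => ?_, hSl, ?_⟩
  · rw [hSl, hSr]
  · refine h1.cls_eq.trans (Eq.trans ?_ (h2.cls_eq.trans ?_))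
    · congr 2; abel
    · congr 2; abel

end Diagonal

/-! ### Diagonal operators on Hilbert sums -/

section HilbertSum

variable {ι : Type*} {H : Type*} [NormedAddCommGroup H]

lemma norm_sq_lp (v : lp (fun _ : ι => H) 2) : ‖v‖ ^ 2 = ∑' i, ‖v i‖ ^ 2 := by
  have := lp.norm_rpow_eq_tsum (p := 2) (by simp) v
  simpa using this

lemma summable_norm_sq_lp (v : lp (fun _ : ι => H) 2) : Summable fun i => ‖v i‖ ^ 2 := by
  have := (lp.memℓp v).summable (by simp)
  simpa using this

lemma memℓp_two {v : ι → H} (h : Summable fun i => ‖v i‖ ^ 2) : Memℓp v 2 :=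
  memℓp_gen (by simpa using h)

/-- The sequence `h, v 0, v 1, …`. -/
def consFun (h : H) (v : ℕ → H) : ℕ → H
  | 0 => h
  | n + 1 => v n

lemma memℓp_consFun (h : H) (v : lp (fun _ : ℕ => H) 2) : Memℓp (consFun h v) 2 := by
  refine memℓp_two ((summable_nat_add_iff 1).1 ?_)
  exact summable_norm_sq_lp v

lemma memℓp_tail (v : lp (fun _ : ℕ => H) 2) : Memℓp (fun n => v (n + 1)) 2 :=
  memℓp_two ((summable_nat_add_iff (f := fun n => ‖v n‖ ^ 2) 1).2 (summable_norm_sq_lp v))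

variable [InnerProductSpace ℂ H]

/-- The operator on `ℓ²(ι, H)` that acts on the `i`-th coordinate by `B i`. -/
def diagOp (B : ι → (H →L[ℂ] H)) (hB : ∃ C, ∀ i, ‖B i‖ ≤ C) :
    lp (fun _ : ι => H) 2 →L[ℂ] lp (fun _ : ι => H) 2 :=
  have hle (v : lp (fun _ : ι => H) 2) (i : ι) : ‖B i (v i)‖ ≤ |hB.choose| * ‖v i‖ :=
    (B i).le_of_opNorm_le ((hB.choose_spec i).trans (le_abs_self _)) _
  LinearMap.mkContinuous
    { toFun := fun v => ⟨fun i => B i (v i), ((lp.memℓp v).norm.const_mul |hB.choose|).mono (hle v)⟩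
      map_add' := fun v w => lp.ext (funext fun i =>
        map_add (B i) (v i) (w i))
      map_smul' := fun c v => lp.ext (funext fun i =>
        map_smul (B i) c (v i)) }
    |hB.choose| fun v => by
      have h2 : 0 < (2 : ENNReal).toReal := by simp
      refine lp.norm_le_of_forall_sum_le h2 (by positivity) fun s => ?_
      calc _ ≤ ∑ i ∈ s, |hB.choose| ^ (2 : ENNReal).toReal * ‖v i‖ ^ (2 : ENNReal).toReal := by
            refine Finset.sum_le_sum fun i _ => ?_
            rw [← Real.mul_rpow (by positivity) (by positivity)]
            exact Real.rpow_le_rpow (norm_nonneg _) (hle v i) (by positivity)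
        _ ≤ |hB.choose| ^ (2 : ENNReal).toReal * ‖v‖ ^ (2 : ENNReal).toReal := by
            rw [← Finset.mul_sum]
            gcongr
            exact lp.sum_rpow_le_norm_rpow h2 v s
        _ = _ := by rw [← Real.mul_rpow (by positivity) (by positivity)]

lemma diagOp_apply (B : ι → (H →L[ℂ] H)) (hB : ∃ C, ∀ i, ‖B i‖ ≤ C)
    (v : lp (fun _ : ι => H) 2) (i : ι) : diagOp B hB v i = B i (v i) := rfl

lemma lp_clm_ext {A B : lp (fun _ : ι => H) 2 →L[ℂ] lp (fun _ : ι => H) 2}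
    (h : ∀ v i, A v i = B v i) : A = B :=
  ContinuousLinearMap.ext fun v => lp.ext (funext (h v))

lemma diagOp_mul {B B' B'' : ι → (H →L[ℂ] H)} (hB : ∃ C, ∀ i, ‖B i‖ ≤ C)
    (hB' : ∃ C, ∀ i, ‖B' i‖ ≤ C) (hB'' : ∃ C, ∀ i, ‖B'' i‖ ≤ C) (h : ∀ i, B i * B' i = B'' i) :
    diagOp B hB * diagOp B' hB' = diagOp B'' hB'' :=
  lp_clm_ext fun v i => by rw [diagOp_apply, ← h]; rfl

lemma diagOp_add {B B' B'' : ι → (H →L[ℂ] H)} (hB : ∃ C, ∀ i, ‖B i‖ ≤ C)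
    (hB' : ∃ C, ∀ i, ‖B' i‖ ≤ C) (hB'' : ∃ C, ∀ i, ‖B'' i‖ ≤ C) (h : ∀ i, B i + B' i = B'' i) :
    diagOp B hB + diagOp B' hB' = diagOp B'' hB'' :=
  lp_clm_ext fun v i => by rw [diagOp_apply, ← h]; rfl

lemma diagOp_smul {B B' : ι → (H →L[ℂ] H)} (hB : ∃ C, ∀ i, ‖B i‖ ≤ C)
    (hB' : ∃ C, ∀ i, ‖B' i‖ ≤ C) (c : ℂ) (h : ∀ i, c • B i = B' i) :
    c • diagOp B hB = diagOp B' hB' :=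
  lp_clm_ext fun v i => by rw [diagOp_apply, ← h]; rfl

lemma diagOp_neg {B B' : ι → (H →L[ℂ] H)} (hB : ∃ C, ∀ i, ‖B i‖ ≤ C)
    (hB' : ∃ C, ∀ i, ‖B' i‖ ≤ C) (h : ∀ i, -B i = B' i) :
    -diagOp B hB = diagOp B' hB' :=
  lp_clm_ext fun v i => by rw [diagOp_apply, ← h]; rfl

lemma diagOp_one {B : ι → (H →L[ℂ] H)} (hB : ∃ C, ∀ i, ‖B i‖ ≤ C) (h : ∀ i, B i = 1) :
    diagOp B hB = 1 :=
  lp_clm_ext fun v i => by rw [diagOp_apply, h]; rfl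

lemma diagOp_zero {B : ι → (H →L[ℂ] H)} (hB : ∃ C, ∀ i, ‖B i‖ ≤ C) (h : ∀ i, B i = 0) :
    diagOp B hB = 0 :=
  lp_clm_ext fun v i => by rw [diagOp_apply, h]; rfl

lemma diagOp_star [CompleteSpace H] {B B' : ι → (H →L[ℂ] H)} (hB : ∃ C, ∀ i, ‖B i‖ ≤ C)
    (hB' : ∃ C, ∀ i, ‖B' i‖ ≤ C) (h : ∀ i, star (B i) = B' i) :
    star (diagOp B hB) = diagOp B' hB' := by
  rw [ContinuousLinearMap.star_eq_adjoint]
  refine ((ContinuousLinearMap.eq_adjoint_iff _ _).2 fun v w => ?_).symm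
  rw [lp.inner_eq_tsum, lp.inner_eq_tsum]
  refine tsum_congr fun i => ?_
  rw [diagOp_apply, diagOp_apply, ← h, ContinuousLinearMap.star_eq_adjoint,
    ContinuousLinearMap.adjoint_inner_left]

instance separableSpace_lp {ι : Type*} [Countable ι] {H : Type*} [NormedAddCommGroup H]
    [InnerProductSpace ℂ H] [TopologicalSpace.SeparableSpace H] :
    TopologicalSpace.SeparableSpace (lp (fun _ : ι => H) 2) := by
  classical
  rw [← TopologicalSpace.isSeparable_univ_iff]
  let s : Set (lp (fun _ : ι => H) 2) :=
    ⋃ i, Set.range (lp.singleContinuousLinearMap ℂ (fun _ : ι => H) 2 i)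
  have hs : TopologicalSpace.IsSeparable s :=
    TopologicalSpace.IsSeparable.iUnion fun i =>
      TopologicalSpace.isSeparable_range (ContinuousLinearMap.continuous _)
  refine (hs.span (R := ℂ)).closure.mono fun v _ => ?_
  refine mem_closure_of_tendsto (lp.hasSum_single (by simp) v)
    (Filter.Eventually.of_forall fun t => ?_)
  exact Submodule.sum_mem _ fun i _ => Submodule.subset_span (Set.mem_iUnion.2 ⟨i, v i, rfl⟩)

/-- Prepending a vector to a sequence, as a unitary operator. -/
def consEquiv (H : Type*) [NormedAddCommGroup H] [InnerProductSpace ℂ H] :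
    WithLp 2 (H × lp (fun _ : ℕ => H) 2) ≃ₗᵢ[ℂ] lp (fun _ : ℕ => H) 2 where
  toFun v := ⟨consFun v.fst v.snd, memℓp_consFun v.fst v.snd⟩
  invFun v := WithLp.toLp 2 (v 0, ⟨fun n => v (n + 1), memℓp_tail v⟩)
  left_inv v := rfl
  right_inv v := lp.ext (funext fun n => by cases n <;> rfl)
  map_add' v w := lp.ext (funext fun n => by cases n <;> rfl)
  map_smul' c v := lp.ext (funext fun n => by cases n <;> rfl)
  norm_map' v := by
    refine (sq_eq_sq₀ (norm_nonneg _) (norm_nonneg _)).1 ?_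
    rw [norm_sq_lp, WithLp.prod_norm_sq_eq_of_L2, norm_sq_lp,
      (summable_norm_sq_lp _).tsum_eq_zero_add]
    rfl

end HilbertSum

/-! ### Degenerate modules -/

section Degenerate

variable {Y : Type*} [MetricSpace Y] {p : ℕ}

lemma bdd_const {ι H : Type*} [NormedAddCommGroup H] [InnerProductSpace ℂ H] (A : H →L[ℂ] H) :
    ∃ C, ∀ _ : ι, ‖A‖ ≤ C := ⟨‖A‖, fun _ => le_rfl⟩

/-- The operator on `ℓ²(ℕ, H)` that acts on each coordinate by `A`. -/
abbrev ampl {H : Type*} [NormedAddCommGroup H] [InnerProductSpace ℂ H] (A : H →L[ℂ] H) :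
    lp (fun _ : ℕ => H) 2 →L[ℂ] lp (fun _ : ℕ => H) 2 :=
  diagOp (fun _ => A) (bdd_const A)

section Ampl

variable {H : Type*} [NormedAddCommGroup H] [InnerProductSpace ℂ H] (A B : H →L[ℂ] H)

lemma ampl_mul : ampl A * ampl B = ampl (A * B) := diagOp_mul _ _ _ fun _ => rfl

lemma ampl_add : ampl A + ampl B = ampl (A + B) := diagOp_add _ _ _ fun _ => rfl

lemma ampl_neg : -ampl A = ampl (-A) := diagOp_neg _ _ fun _ => rfl

lemma ampl_sub : ampl A - ampl B = ampl (A - B) := by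
  rw [sub_eq_add_neg, ampl_neg, ampl_add, sub_eq_add_neg]

lemma ampl_one : ampl (1 : H →L[ℂ] H) = 1 := diagOp_one _ fun _ => rfl

lemma ampl_zero : ampl (0 : H →L[ℂ] H) = 0 := diagOp_zero _ fun _ => rfl

lemma ampl_star [CompleteSpace H] : star (ampl A) = ampl (star A) := diagOp_star _ _ fun _ => rfl

end Ampl

/-- The direct sum of countably many copies of a multigraded Hilbert space with representation. -/
def MultigradedRep.ampl (M : MultigradedRep p Y) : MultigradedRep p Y where
  H := lp (fun _ : ℕ => M.H) 2
  γ := UniformKHomology.ampl M.γ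
  γ_selfAdjoint := by rw [IsSelfAdjoint, ampl_star, M.γ_selfAdjoint.star_eq]
  γ_sq := by rw [ampl_mul, M.γ_sq, ampl_one]
  e i := UniformKHomology.ampl (M.e i)
  e_unitary i := by
    rw [Unitary.mem_iff, ampl_star, ampl_mul, ampl_mul,
      Unitary.star_mul_self_of_mem (M.e_unitary i), Unitary.mul_star_self_of_mem (M.e_unitary i),
      ampl_one]
    exact ⟨rfl, rfl⟩
  e_odd i := by rw [ampl_mul, ampl_mul, M.e_odd, ampl_neg]
  e_sq i := by rw [ampl_mul, M.e_sq, ← ampl_neg, ampl_one]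
  e_anticomm i j hij := by rw [ampl_mul, ampl_mul, ampl_add, M.e_anticomm i j hij, ampl_zero]
  ρ :=
    { toFun := fun f => UniformKHomology.ampl (M.ρ f)
      map_smul' := fun c f => (diagOp_smul _ _ c fun _ => (map_smul M.ρ c f).symm).symm
      map_zero' := by rw [map_zero, ampl_zero]
      map_add' := fun f g => by rw [ampl_add, map_add]
      map_mul' := fun f g => by rw [ampl_mul, map_mul]
      map_star' := fun f => by rw [ampl_star, map_star] }
  ρ_even f := by
    change UniformKHomology.ampl (M.ρ f) * _ = _ * UniformKHomology.ampl (M.ρ f)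
    rw [ampl_mul, ampl_mul, M.ρ_even]
  ρ_multigraded f i := by
    change UniformKHomology.ampl (M.ρ f) * _ = _ * UniformKHomology.ampl (M.ρ f)
    rw [ampl_mul, ampl_mul, M.ρ_multigraded]

/-- The operator is odd and multigraded, and the other conditions on a Fredholm module hold
exactly instead of up to compact operators. -/
structure IsDegenerate (M : MultigradedRep p Y) (W : M.H →L[ℂ] M.H) : Prop where
  odd : W * M.γ = -(M.γ * W)
  multigraded : ∀ i, W * M.e i = M.e i * W
  isSelfAdjoint : IsSelfAdjoint W
  commute : ∀ f, W * M.ρ f = M.ρ f * W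
  rho_mul : ∀ f, M.ρ f * (W * W - 1) = 0

namespace IsDegenerate

variable {M : MultigradedRep p Y} {W : M.H →L[ℂ] M.H}

lemma mul_rho (h : IsDegenerate M W) (f : C₀(Y, ℂ)) : (W * W - 1) * M.ρ f = 0 := by
  rw [← h.rho_mul f, sub_mul, mul_sub, mul_assoc, h.commute, ← mul_assoc, h.commute, mul_assoc,
    one_mul, mul_one]

lemma isUniformFredholm (h : IsDegenerate M W) : IsUniformFredholm M W := by
  have hz : IsCompactOperator (0 : M.H →L[ℂ] M.H) := isCompactOperator_zero
  have hsub : W - star W = 0 := by rw [h.isSelfAdjoint.star_eq, sub_self]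
  have hc (f : C₀(Y, ℂ)) : W * M.ρ f - M.ρ f * W = 0 := by rw [h.commute, sub_self]
  have hu (ε : ℝ) (hε : 0 < ε) : ∃ k : M.H →L[ℂ] M.H,
      LinearMap.rank (k : M.H →ₗ[ℂ] M.H) ≤ (0 : ℕ) ∧ ‖0 - k‖ < ε :=
    ⟨0, by simp, by simpa using hε⟩
  refine ⟨⟨h.odd, h.multigraded, fun f => ?_, fun f => ?_, fun f => ?_⟩, fun L R _ _ ε hε => ⟨0, ?_⟩,
    fun L R _ _ ε hε => ⟨0, ?_⟩, fun L R _ _ ε hε => ⟨0, ?_⟩⟩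
  · rw [h.rho_mul, h.mul_rho]
    exact ⟨hz, hz⟩
  · rw [hsub, mul_zero, zero_mul]
    exact ⟨hz, hz⟩
  · rw [hc]
    exact hz
  · rintro A ⟨f, -, rfl⟩
    rw [hc]
    exact hu ε hε
  · rintro A ⟨f, -, rfl | rfl⟩
    · rw [h.rho_mul]
      exact hu ε hε
    · rw [h.mul_rho]
      exact hu ε hε
  · rintro A ⟨f, -, rfl | rfl⟩
    · rw [hsub, mul_zero]
      exact hu ε hε
    · rw [hsub, zero_mul]
      exact hu ε hε

lemma ampl (h : IsDegenerate M W) : IsDegenerate M.ampl (UniformKHomology.ampl W) where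
  odd := by
    change UniformKHomology.ampl W * UniformKHomology.ampl M.γ =
      -(UniformKHomology.ampl M.γ * UniformKHomology.ampl W)
    rw [ampl_mul, ampl_mul, h.odd, ampl_neg]
  multigraded i := by
    change UniformKHomology.ampl W * UniformKHomology.ampl (M.e i) =
      UniformKHomology.ampl (M.e i) * UniformKHomology.ampl W
    rw [ampl_mul, ampl_mul, h.multigraded]
  isSelfAdjoint := by
    change star (UniformKHomology.ampl W) = UniformKHomology.ampl W
    rw [ampl_star, h.isSelfAdjoint.star_eq]
  commute f := by
    change UniformKHomology.ampl W * UniformKHomology.ampl (M.ρ f) =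
      UniformKHomology.ampl (M.ρ f) * UniformKHomology.ampl W
    rw [ampl_mul, ampl_mul, h.commute]
  rho_mul f := by
    change UniformKHomology.ampl (M.ρ f) *
      (UniformKHomology.ampl W * UniformKHomology.ampl W - 1) = 0
    rw [ampl_mul, ← ampl_one, ampl_sub, ampl_mul, h.rho_mul, ampl_zero]

/-- Degenerate modules have trivial class: the direct sum of countably many copies of such a module
absorbs a further copy. -/
theorem cls_eq_zero (h : IsDegenerate M W) :
    cls (⟨M, W, h.isUniformFredholm⟩ : UniformFredholmModule p Y) = 0 := by
  let x : UniformFredholmModule p Y := ⟨M, W, h.isUniformFredholm⟩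
  let z : UniformFredholmModule p Y := ⟨M.ampl, UniformKHomology.ampl W, h.ampl.isUniformFredholm⟩
  have hz : UnitarilyEquivalent (x.directSum z) z := by
    refine ⟨consEquiv M.H, fun v => ?_, fun i v => ?_, fun f v => ?_, fun v => ?_⟩ <;>
    exact lp.ext (funext fun n => by cases n <;> rfl)
  have := hz.cls_eq
  rw [cls_directSum] at this
  simpa using this

end IsDegenerate

end Degenerate

/-! ### The sign of a selfadjoint operator -/

section Sign

variable {H : Type*} [NormedAddCommGroup H] [InnerProductSpace ℂ H] [CompleteSpace H]

lemma selfAdjoint_inner {B : H →L[ℂ] H} (hB : IsSelfAdjoint B) (v w : H) :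
    inner ℂ (B v) w = inner ℂ v (B w) :=
  (ContinuousLinearMap.isSelfAdjoint_iff_isSymmetric.1 hB) v w

lemma apply_eq_zero_of_apply_apply {B : H →L[ℂ] H} (hB : IsSelfAdjoint B) {v : H}
    (h : B (B v) = 0) : B v = 0 := by
  rw [← inner_self_eq_zero (𝕜 := ℂ), selfAdjoint_inner hB, h, inner_zero_right]

lemma norm_le_one_of_projection {P : H →L[ℂ] H} (hP : IsSelfAdjoint P) (hP2 : P * P = P) :
    ‖P‖ ≤ 1 := by
  have h := CStarRing.norm_star_mul_self (x := P)
  rw [hP.star_eq, hP2] at h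
  by_contra! hlt
  nlinarith

lemma norm_le_one_of_sq_projection {W P : H →L[ℂ] H} (hW : IsSelfAdjoint W) (hWP : W * W = P)
    (hP : ‖P‖ ≤ 1) : ‖W‖ ≤ 1 := by
  have h := CStarRing.norm_star_mul_self (x := W)
  rw [hW.star_eq, hWP] at h
  by_contra! hlt
  nlinarith

/-- If the selfadjoint operator `B` on the range of the projection `P` is injective and its square
is close to `P` up to finite rank, then `W = B |B|⁻¹` is a symmetry of the range of `P`. The
operator `Z` is `W (1 + |B|)⁻¹`. -/
lemma exists_sign {P B : H →L[ℂ] H} (hP : IsSelfAdjoint P) (hP2 : P * P = P)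
    (hB : IsSelfAdjoint B) (hPB : P * B = B) (hBP : B * P = B)
    (hinj : ∀ v, P v = v → B v = 0 → v = 0)
    (hk : ∃ (k : H →L[ℂ] H) (N : ℕ), LinearMap.rank (k : H →ₗ[ℂ] H) ≤ N ∧ ‖B * B - P - k‖ < 1) :
    ∃ W Z : H →L[ℂ] H, IsSelfAdjoint W ∧ W * W = P ∧ P * W = W ∧ W * P = W ∧ ‖W‖ ≤ 1 ∧
      P * Z = Z ∧ Z * P = Z ∧ ‖Z‖ ≤ 1 ∧ B - W = (B * B - P) * Z ∧
      (∀ X, B * X = X * B → P * X = X * P → W * X = X * W) ∧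
      (∀ X, B * X = -(X * B) → P * X = X * P → W * X = -(X * W)) := by
  have hPn := norm_le_one_of_projection hP hP2
  set Q : H →L[ℂ] H := B * B + (1 - P) with hQdef
  have hPQ : P * Q = B * B := by
    rw [hQdef, mul_add, ← mul_assoc, hPB, mul_sub, hP2, mul_one, sub_self, add_zero]
  have hQinj : Function.Injective Q := by
    refine (injective_iff_map_eq_zero Q).2 fun v hv => ?_
    have h1 : B (B v) = 0 := by
      have : (P * Q) v = 0 := by simp [hv]
      rwa [hPQ] at this
    have h2 : P v = v := by
      have h3 : B (B v) + (v - P v) = 0 := hv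
      rw [h1, zero_add, sub_eq_zero] at h3
      exact h3.symm
    exact hinj v h2 (apply_eq_zero_of_apply_apply hB h1)
  have hQunit : IsUnit Q := by
    obtain ⟨k, N, hk1, hk2⟩ := hk
    refine isUnit_of_injective_of_rank_le hk1 ?_ hQinj
    have : Q - 1 - k = B * B - P - k := by rw [hQdef]; abel
    rwa [this]
  have hQnn : 0 ≤ Q := by
    have h1 : B * B = star B * B := by rw [hB.star_eq]
    have h2 : 1 - P = star (1 - P) * (1 - P) := by
      have h3 : (1 - P) * (1 - P) = 1 - P - P + P * P := by noncomm_ring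
      rw [star_sub, star_one, hP.star_eq, h3, hP2]
      abel
    rw [hQdef, h1, h2]
    exact add_nonneg (star_mul_self_nonneg _) (star_mul_self_nonneg _)
  set R : H →L[ℂ] H := CFC.sqrt Q with hRdef
  have hRR : R * R = Q := CFC.sqrt_mul_sqrt_self Q hQnn
  have hRnn : 0 ≤ R := CFC.sqrt_nonneg Q
  have hRunit : IsUnit R := (CFC.isUnit_sqrt_iff Q hQnn).2 hQunit
  have hR1unit : IsUnit (1 + R) := (isStrictlyPositive_one.add_nonneg hRnn).isUnit
  have hcomm (X : H →L[ℂ] H) (h : Commute X Q) : Commute X R := (h.symm.cfcₙ_nnreal _).symm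
  have hcommQ (X : H →L[ℂ] H) (h : Commute (B * B) X) (h' : P * X = X * P) : Commute X Q := by
    rw [Commute, SemiconjBy, hQdef, mul_add, add_mul, h.eq, mul_sub, sub_mul, mul_one, one_mul, h']
  obtain ⟨u, hu⟩ := hRunit
  obtain ⟨w, hw⟩ := hR1unit
  have hRr : R * (↑u⁻¹ : H →L[ℂ] H) = 1 := by rw [← hu, Units.mul_inv]
  have hrR : (↑u⁻¹ : H →L[ℂ] H) * R = 1 := by rw [← hu, Units.inv_mul]
  set r : H →L[ℂ] H := ↑u⁻¹ with hr
  have hDD : (1 + R) * (↑w⁻¹ : H →L[ℂ] H) = 1 := by rw [← hw, Units.mul_inv]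
  set D : H →L[ℂ] H := ↑w⁻¹ with hD
  have hcommr (X : H →L[ℂ] H) (h : Commute X Q) : Commute X r := by
    have := hcomm X h
    rw [← hu] at this
    exact this.units_inv_right
  have hcommD (X : H →L[ℂ] H) (h : Commute X Q) : Commute X D := by
    have := (Commute.one_right X).add_right (hcomm X h)
    rw [← hw] at this
    exact this.units_inv_right
  have hBQ : Commute B Q := hcommQ B (Commute.mul_left rfl rfl) (by rw [hPB, hBP])
  have hPQ' : Commute P Q := hcommQ P (by
    rw [Commute, SemiconjBy, mul_assoc, hBP, ← mul_assoc, hPB]) rfl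
  have hrsa : IsSelfAdjoint r := by
    have hRsa : star R = R := (IsSelfAdjoint.of_nonneg hRnn).star_eq
    have h1 : star r * R = 1 := by
      rw [← hRsa, ← star_mul, hRr, star_one]
    calc star r = star r * (R * r) := by rw [hRr, mul_one]
      _ = r := by rw [← mul_assoc, h1, one_mul]
  have hWsa : IsSelfAdjoint (B * r) := by
    rw [IsSelfAdjoint, star_mul, hrsa.star_eq, hB.star_eq, (hcommr B hBQ).eq]
  have hWW : B * r * (B * r) = P := by
    calc B * r * (B * r) = B * (r * B) * r := by simp only [mul_assoc]
      _ = B * B * (r * r) := by rw [← (hcommr B hBQ).eq]; simp only [mul_assoc]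
      _ = P * (R * R) * (r * r) := by rw [hRR, hPQ]
      _ = P * (R * (R * r) * r) := by simp only [mul_assoc]
      _ = P := by rw [hRr, mul_one, hRr, mul_one]
  have hPW : P * (B * r) = B * r := by rw [← mul_assoc, hPB]
  have hWP : B * r * P = B * r := by rw [mul_assoc, ← (hcommr P hPQ').eq, ← mul_assoc, hBP]
  have hWn : ‖B * r‖ ≤ 1 := norm_le_one_of_sq_projection hWsa hWW hPn
  have hDn : ‖D‖ ≤ 1 := by
    refine ContinuousLinearMap.opNorm_le_bound _ zero_le_one fun v => ?_
    have h1 : D v + R (D v) = v := congrArg (fun C : H →L[ℂ] H => C v) hDD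
    have h2 : 0 ≤ (inner ℂ (R (D v)) (D v) : ℂ).re :=
      (Complex.nonneg_iff.1
        (((ContinuousLinearMap.nonneg_iff_isPositive R).1 hRnn).inner_nonneg_left (D v))).1
    have h3 : ‖D v‖ ^ 2 ≤ (inner ℂ v (D v) : ℂ).re := by
      nth_rewrite 2 [← h1]
      rw [inner_add_left, Complex.add_re, inner_self_eq_norm_sq_to_K]
      have : (((‖D v‖ : ℝ) : ℂ) ^ 2).re = ‖D v‖ ^ 2 := by norm_cast
      change _ ≤ (((‖D v‖ : ℝ) : ℂ) ^ 2).re + _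
      rw [this]
      linarith
    have h4 : (inner ℂ v (D v) : ℂ).re ≤ ‖v‖ * ‖D v‖ :=
      (Complex.re_le_norm _).trans (norm_inner_le_norm _ _)
    rw [one_mul]
    by_contra! hlt
    nlinarith [norm_nonneg v]
  refine ⟨B * r, B * r * D, hWsa, hWW, hPW, hWP, hWn, ?_, ?_, ?_, ?_, ?_, ?_⟩
  · rw [← mul_assoc, hPW]
  · rw [mul_assoc, ← (hcommD P hPQ').eq, ← mul_assoc, hWP]
  · exact (norm_mul_le _ _).trans (mul_le_one₀ hWn (norm_nonneg _) hDn)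
  · -- `B - W = W (|B| - 1) = W (|B|² - 1) (1 + |B|)⁻¹`
    have h1 : B * r * R = B := by rw [mul_assoc, hrR, mul_one]
    have h2 : R - 1 = (R * R - 1) * D := by
      calc R - 1 = (R - 1) * ((1 + R) * D) := by rw [hDD, mul_one]
        _ = (R * R - 1) * D := by
            rw [← mul_assoc]
            congr 1
            noncomm_ring
    have h3 : R * R - 1 = B * B - P := by rw [hRR, hQdef]; abel
    have h4 : Commute (B * r) (B * B - P) := by
      have h5 : Commute (B * r) B := (Commute.refl B).mul_left (hcommr B hBQ).symm
      exact (h5.mul_right h5).sub_right (by rw [Commute, SemiconjBy, hWP, hPW])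
    calc B - B * r = B * r * (R - 1) := by rw [mul_sub, h1, mul_one]
      _ = B * r * (B * B - P) * D := by rw [h2, h3, ← mul_assoc]
      _ = _ := by rw [h4.eq, mul_assoc]
  · intro X hX hX'
    have h1 : Commute X Q := hcommQ X (Commute.mul_left hX hX) hX'
    rw [mul_assoc, ← (hcommr X h1).eq, ← mul_assoc, hX, mul_assoc]
  · intro X hX hX'
    have h1 : Commute X Q := hcommQ X (by
      rw [Commute, SemiconjBy, mul_assoc, hX, mul_neg, ← mul_assoc, hX, neg_mul, neg_neg,
        mul_assoc]) hX'
    rw [mul_assoc, ← (hcommr X h1).eq, ← mul_assoc, hX, neg_mul, mul_assoc]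

end Sign

/-! ### Vanishing of classes -/

section Vanishing

variable {Y : Type*} [MetricSpace Y] {p : ℕ} {M : MultigradedRep p Y}

/-- The vectors in the kernel of `S` that are supported over the points where `f` is `1`. -/
def kerOver {H : Type*} [NormedAddCommGroup H] [InnerProductSpace ℂ H] [CompleteSpace H]
    (ρ : C₀(Y, ℂ) →⋆ₙₐ[ℂ] (H →L[ℂ] H)) (S : H →L[ℂ] H) (f : C₀(Y, ℂ)) : Submodule ℂ H where
  carrier := {v | ρ f v = v ∧ S v = 0}
  add_mem' := by
    rintro v w ⟨h1, h2⟩ ⟨h3, h4⟩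
    exact ⟨by rw [map_add, h1, h3], by rw [map_add, h2, h4, add_zero]⟩
  zero_mem' := ⟨map_zero _, map_zero _⟩
  smul_mem' := by
    rintro c v ⟨h1, h2⟩
    exact ⟨by rw [map_smul, h1], by rw [map_smul, h2, smul_zero]⟩

variable [DiscreteTopology Y]

/-- On the kernel of `S` the operator `S² - 1` is invertible, so that uniform approximability bounds
the dimension of the kernel. -/
lemma exists_finrank_kerOver_le (hY : UniformlyDiscrete Y) {S : M.H →L[ℂ] M.H}
    (hS : IsUniformFredholm M S) {R : ℝ} (hR : 0 < R) :
    ∃ N : ℕ, ∀ F : SmallSet Y R, FiniteDimensional ℂ (kerOver M.ρ S (chi F.1)) ∧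
      Module.finrank ℂ (kerOver M.ρ S (chi F.1)) ≤ N := by
  obtain ⟨N, hN⟩ := ((uniformlyLocallyCompactOp_iff hY).1 hS.uniformly_sq_sub_one R hR).1 1 one_pos
  refine ⟨N, fun F => ?_⟩
  obtain ⟨k, hk, hk'⟩ := hN F
  have := finiteDimensional_range_of_rank_le hk
  have hinj : Function.Injective
      ((k : M.H →ₗ[ℂ] M.H).rangeRestrict ∘ₗ (kerOver M.ρ S (chi F.1)).subtype) := by
    refine (injective_iff_map_eq_zero _).2 fun v hv => ?_
    obtain ⟨v, h1, h2⟩ := v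
    have h3 : k v = 0 := congrArg Subtype.val hv
    have h4 : (M.ρ (chi F.1) * (S * S - 1) - k) v = -v := by
      change M.ρ (chi F.1) (S (S v) - v) - k v = -v
      rw [h2, h3, map_zero, zero_sub, map_neg, h1, sub_zero]
    have h5 := (M.ρ (chi F.1) * (S * S - 1) - k).le_opNorm v
    rw [h4, norm_neg] at h5
    refine Subtype.ext (norm_eq_zero.1 (le_antisymm ?_ (norm_nonneg v)))
    nlinarith [norm_nonneg v]
  exact ⟨FiniteDimensional.of_injective _ hinj,
    (LinearMap.finrank_le_finrank_of_injective hinj).trans (finrank_range_le_of_rank_le hk)⟩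

/-- The class of a diagonal selfadjoint operator that is injective over each point vanishes: the
sign of the operator is degenerate. The operator need not be bounded below uniformly over all points,
so that the sign is formed over each point separately. -/
theorem cls_eq_zero_of_injective (hY : UniformlyDiscrete Y) {T : M.H →L[ℂ] M.H}
    (hT : IsUniformFredholm M T) (hTsa : IsSelfAdjoint T) (hTc : ∀ f, T * M.ρ f = M.ρ f * T)
    (hTinj : ∀ y v, M.ρ (pt y) v = v → T v = 0 → v = 0) :
    cls (⟨M, T, hT⟩ : UniformFredholmModule p Y) = 0 := by
  have hP := isProjFamily_rep M.ρ
  have hTu := (uniformlyLocallyCompactOp_iff hY).1 hT.uniformly_sq_sub_one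
  have hBB (y : Y) : M.ρ (pt y) * T * (M.ρ (pt y) * T) - M.ρ (pt y) =
      M.ρ (pt y) * (T * T - 1) := by
    rw [mul_assoc, ← mul_assoc T, hTc, mul_assoc, ← mul_assoc (M.ρ (pt y)) (M.ρ (pt y)), hP.idem,
      mul_sub, mul_one]
  have hsign (y : Y) := exists_sign (P := M.ρ (pt y)) (B := M.ρ (pt y) * T) (hP.isSelfAdjoint y)
    (hP.idem y)
    (by rw [IsSelfAdjoint, star_mul, hTsa.star_eq, (hP.isSelfAdjoint y).star_eq, hTc])
    (by rw [← mul_assoc, hP.idem]) (by rw [mul_assoc, hTc, ← mul_assoc, hP.idem])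
    (fun v hv h0 => hTinj y v hv (by
      rw [← hTc] at h0
      change T (M.ρ (pt y) v) = 0 at h0
      rwa [hv] at h0))
    (by
      obtain ⟨N, hN⟩ := (hTu 1 one_pos).1 1 one_pos
      obtain ⟨k, hk, hk'⟩ := hN ⟨{y}, by simp⟩
      refine ⟨k, N, hk, ?_⟩
      rw [hBB]
      exact hk')
  choose W Z hWsa hWW hPW hWP hWn hPZ hZP hZn hBW hcomm hanti using hsign
  obtain ⟨W', hW'⟩ := hP.exists_isStrongSum hPW hWP hWn
  obtain ⟨Z', hZ'⟩ := hP.exists_isStrongSum hPZ hZP hZn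
  have hW'l := hP.mul_strongSum hW' hPW
  have hW'r := hP.strongSum_mul hW' hWP
  have hZ'l := hP.mul_strongSum hZ' hPZ
  have hγ (y : Y) : M.ρ (pt y) * T * M.γ = -(M.γ * (M.ρ (pt y) * T)) := by
    rw [mul_assoc, hT.odd, mul_neg, ← mul_assoc, M.ρ_even, mul_assoc]
  have he (y : Y) (i : Fin p) : M.ρ (pt y) * T * M.e i = M.e i * (M.ρ (pt y) * T) := by
    rw [mul_assoc, hT.multigraded, ← mul_assoc, M.ρ_multigraded, mul_assoc]
  have hdeg : IsDegenerate M W' :=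
    { odd := hW'.mul_anticomm_of_forall fun y => hanti y _ (hγ y) (M.ρ_even _)
      multigraded := fun i => hW'.mul_comm_of_forall fun y =>
        hcomm y _ (he y i) (M.ρ_multigraded _ i)
      isSelfAdjoint := hW'.isSelfAdjoint hWsa
      commute := commute_rep_of_forall_pt fun y => by rw [hW'l, hW'r]
      rho_mul := rep_mul_eq_zero_of_forall_pt fun y => by
        have h1 : M.ρ (pt y) * (W' * W') = W y * W y := by
          rw [← mul_assoc, hW'l, ← hWP, mul_assoc, hW'l, ← hWP]
          simp only [mul_assoc, hP.idem]
        rw [mul_sub, h1, hWW, mul_one, sub_self] }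
  -- the sign differs from the operator by a multiple of `T² - 1`
  have hdiff (f : C₀(Y, ℂ)) : M.ρ f * (T - W') = M.ρ f * (T * T - 1) * Z' := by
    have := rep_mul_eq_zero_of_forall_pt (ρ := M.ρ) (A := T - W' - (T * T - 1) * Z')
      (fun y => by
        have h1 := hBW y
        rw [hBB, ← hZ'l] at h1
        have h2 : M.ρ (pt y) * (T * T - 1) * (M.ρ (pt y) * Z') =
            M.ρ (pt y) * ((T * T - 1) * Z') := by
          have h3 : (T * T - 1) * M.ρ (pt y) = M.ρ (pt y) * (T * T - 1) := by
            rw [sub_mul, mul_sub, mul_assoc, hTc, ← mul_assoc, hTc, mul_assoc, one_mul, mul_one]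
          rw [mul_assoc, ← mul_assoc _ _ Z', h3, ← mul_assoc, ← mul_assoc, hP.idem, mul_assoc]
        rw [mul_sub, mul_sub, hW'l, h1, h2, sub_self]) f
    rw [mul_sub, sub_eq_zero] at this
    rw [this, mul_assoc]
  have hK : UniformlyLocallyCompactOp M.ρ (T - W') := by
    rw [uniformlyLocallyCompactOp_iff hY]
    intro R hR
    have h1 : UnifApprox fun F : SmallSet Y R => M.ρ (chi F.1) * (T - W') :=
      ((hTu R hR).1.mul_right (b := fun _ => Z') (fun _ => le_rfl)).congr fun F => hdiff _
    refine ⟨h1, h1.congr fun F => ?_⟩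
    rw [sub_mul, mul_sub, hTc, hdeg.commute]
  have hK' : UniformlyLocallyCompactOp M.ρ (star (T - W')) := by
    rwa [star_sub, hTsa.star_eq, hdeg.isSelfAdjoint.star_eq]
  have hfin := (cls_perturb hY hdeg.isUniformFredholm (K := T - W')
    (by rw [sub_mul, mul_sub, hT.odd, hdeg.odd]; abel)
    (fun i => by rw [sub_mul, mul_sub, hT.multigraded, hdeg.multigraded]) hK hK').cls_eq
  rw [hdeg.cls_eq_zero] at hfin
  rw [hfin]
  congr 2
  abel

/-- The class of a diagonal selfadjoint operator vanishes as soon as there is an odd multigraded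
symmetry of its kernel. The operator is perturbed by this symmetry to make it injective over each
point. -/
theorem cls_eq_zero_of_kernel_symmetry (hY : UniformlyDiscrete Y) {S J : M.H →L[ℂ] M.H}
    (hS : IsUniformFredholm M S) (hSsa : IsSelfAdjoint S) (hSc : ∀ f, S * M.ρ f = M.ρ f * S)
    (hJsa : IsSelfAdjoint J) (hJodd : J * M.γ = -(M.γ * J)) (hJe : ∀ i, J * M.e i = M.e i * J)
    (hJc : ∀ y, J * M.ρ (pt y) = M.ρ (pt y) * J) (hSJ : ∀ y, S * (J * M.ρ (pt y)) = 0)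
    (hJJ : ∀ y v, M.ρ (pt y) v = v → S v = 0 → J (J v) = v) :
    cls (⟨M, S, hS⟩ : UniformFredholmModule p Y) = 0 := by
  have hJc' := commute_rep_of_forall_pt hJc
  have hJF (F : Finset Y) (v : M.H) : M.ρ (chi F) (J v) ∈ kerOver M.ρ S (chi F) := by
    constructor
    · rw [← mul_apply_eq_comp, ← map_mul, chi_mul_self]
    · have : S * (J * M.ρ (chi F)) = 0 := by
        rw [chi_eq_sum, map_sum, Finset.mul_sum, Finset.mul_sum]
        exact Finset.sum_eq_zero fun y _ => hSJ y
      rw [hJc'] at this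
      exact congrArg (fun C : M.H →L[ℂ] M.H => C v) this
  have hJu : UniformlyLocallyCompactOp M.ρ J := by
    rw [uniformlyLocallyCompactOp_iff hY]
    intro R hR
    obtain ⟨N, hN⟩ := exists_finrank_kerOver_le hY hS hR
    have h1 : UnifApprox fun F : SmallSet Y R => M.ρ (chi F.1) * J :=
      UnifApprox.of_rank_le (N := N) fun F => by
        have := (hN F).1
        exact rank_le_of_finrank (hN F).2 (hJF F.1)
    exact ⟨h1, h1.congr fun F => hJc' _⟩
  have hJu' : UniformlyLocallyCompactOp M.ρ (star J) := by rwa [hJsa.star_eq]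
  have hT := hS.add hY hJodd hJe hJu hJu'
  rw [(cls_perturb hY hS hJodd hJe hJu hJu').cls_eq]
  refine cls_eq_zero_of_injective hY hT (hSsa.add hJsa) (fun f => ?_) fun y v hv h0 => ?_
  · rw [add_mul, mul_add, hSc, hJc']
  · have h1 : S (J v) = 0 := by
      have := congrArg (fun C : M.H →L[ℂ] M.H => C v) (hSJ y)
      simpa [hv] using this
    have h2 : S v + J v = 0 := h0
    have h3 : S v = 0 := by
      refine apply_eq_zero_of_apply_apply hSsa ?_
      have := congrArg S h2
      rwa [map_add, h1, add_zero, map_zero] at this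
    rw [h3, zero_add] at h2
    rw [← hJJ y v hv h3, h2, map_zero]

end Vanishing

/-! ### Symmetries of the kernel -/

section KernelSymmetry

variable {H : Type*} [NormedAddCommGroup H] [InnerProductSpace ℂ H] [CompleteSpace H]

/-- The orthogonal projection onto an invariant subspace of `X` and `X*` commutes with `X`. -/
lemma starProjection_commute {K : Submodule ℂ H} [K.HasOrthogonalProjection] {X : H →L[ℂ] H}
    (h : ∀ v ∈ K, X v ∈ K) (h' : ∀ v ∈ K, star X v ∈ K) :
    K.starProjection * X = X * K.starProjection := by
  ext v
  refine Submodule.eq_starProjection_of_mem_of_inner_eq_zero (h _ (K.starProjection_apply_mem v))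
    fun w hw => ?_
  change inner ℂ (X v - X (K.starProjection v)) w = 0
  rw [← map_sub, ← ContinuousLinearMap.adjoint_inner_right]
  exact Submodule.inner_left_of_mem_orthogonal (h' w hw) (K.sub_starProjection_mem_orthogonal v)

lemma starProjection_commute_of_isSelfAdjoint {K : Submodule ℂ H} [K.HasOrthogonalProjection]
    {X : H →L[ℂ] H} (hX : IsSelfAdjoint X) (h : ∀ v ∈ K, X v ∈ K) :
    K.starProjection * X = X * K.starProjection :=
  starProjection_commute h (by rwa [hX.star_eq])

/-- Two orthogonal subspaces of the same finite dimension are interchanged by a selfadjoint partial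
isometry. -/
lemma exists_swap {V W : Submodule ℂ H} [FiniteDimensional ℂ V] [FiniteDimensional ℂ W]
    (hdim : Module.finrank ℂ V = Module.finrank ℂ W)
    (horth : ∀ a ∈ V, ∀ b ∈ W, inner ℂ a b = 0) :
    ∃ J : H →L[ℂ] H, IsSelfAdjoint J ∧ ‖J‖ ≤ 1 ∧ (∀ v, J v ∈ V ⊔ W) ∧
      (∀ v ∈ V ⊔ W, J (J v) = v) ∧
      ∀ X : H →L[ℂ] H, IsSelfAdjoint X → (∀ a ∈ V, X a = a) → (∀ b ∈ W, X b = -b) →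
        J * X = -(X * J) := by
  let a := stdOrthonormalBasis ℂ V
  let b := (stdOrthonormalBasis ℂ W).reindex (finCongr hdim.symm)
  let J : H →L[ℂ] H := ∑ j, ((innerSL ℂ (a j : H)).smulRight (b j : H) +
    (innerSL ℂ (b j : H)).smulRight (a j : H))
  have hJ (v : H) : J v = ∑ j, (inner ℂ (a j : H) v • (b j : H) + inner ℂ (b j : H) v • (a j : H)) := by
    simp [J]
  have hJsa : IsSelfAdjoint J := by
    rw [ContinuousLinearMap.isSelfAdjoint_iff_isSymmetric]
    intro v w
    change inner ℂ (J v) w = inner ℂ v (J w)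
    rw [hJ, hJ, sum_inner, inner_sum]
    refine Finset.sum_congr rfl fun j _ => ?_
    rw [inner_add_left, inner_add_right, inner_smul_left, inner_smul_left, inner_smul_right,
      inner_smul_right, inner_conj_symm, inner_conj_symm]
    ring
  have hJV (v : H) (hv : v ∈ V) : J v = ∑ j, inner ℂ (a j : H) v • (b j : H) := by
    rw [hJ]
    refine Finset.sum_congr rfl fun j _ => ?_
    have h0 : inner ℂ (b j : H) v = 0 := by
      rw [← inner_conj_symm, horth v hv _ (b j).2, map_zero]
    rw [h0, zero_smul, add_zero]
  have hJW (v : H) (hv : v ∈ W) : J v = ∑ j, inner ℂ (b j : H) v • (a j : H) := by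
    rw [hJ]
    refine Finset.sum_congr rfl fun j _ => ?_
    rw [horth _ (a j).2 v hv, zero_smul, zero_add]
  have ha (v : H) (hv : v ∈ V) : ∑ j, inner ℂ (a j : H) v • (a j : H) = v := by
    have := congrArg Subtype.val (a.sum_repr' ⟨v, hv⟩)
    simpa using this
  have hb (v : H) (hv : v ∈ W) : ∑ j, inner ℂ (b j : H) v • (b j : H) = v := by
    have := congrArg Subtype.val (b.sum_repr' ⟨v, hv⟩)
    simpa using this
  have hab (j) : J (a j) = b j := by
    rw [hJV _ (a j).2, Finset.sum_eq_single j]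
    · have : inner ℂ (a j : H) (a j : H) = (1 : ℂ) := by
        have := orthonormal_iff_ite.1 a.orthonormal j j
        rwa [if_pos rfl] at this
      rw [this, one_smul]
    · intro i _ hij
      have : inner ℂ (a i : H) (a j : H) = (0 : ℂ) := a.orthonormal.2 hij
      rw [this, zero_smul]
    · simp
  have hba (j) : J (b j) = a j := by
    rw [hJW _ (b j).2, Finset.sum_eq_single j]
    · have : inner ℂ (b j : H) (b j : H) = (1 : ℂ) := by
        have := orthonormal_iff_ite.1 b.orthonormal j j
        rwa [if_pos rfl] at this
      rw [this, one_smul]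
    · intro i _ hij
      have : inner ℂ (b i : H) (b j : H) = (0 : ℂ) := b.orthonormal.2 hij
      rw [this, zero_smul]
    · simp
  have hmem (v : H) : J v ∈ V ⊔ W := by
    rw [hJ]
    refine Submodule.sum_mem _ fun j _ => Submodule.add_mem _ ?_ ?_
    · exact Submodule.smul_mem _ _ (Submodule.mem_sup_right (b j).2)
    · exact Submodule.smul_mem _ _ (Submodule.mem_sup_left (a j).2)
  have hJJ (v : H) (hv : v ∈ V ⊔ W) : J (J v) = v := by
    obtain ⟨x, hx, y, hy, rfl⟩ := Submodule.mem_sup.1 hv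
    rw [map_add, map_add, hJV x hx, hJW y hy, map_sum, map_sum]
    simp only [map_smul, hab, hba]
    rw [ha x hx, hb y hy]
  refine ⟨J, hJsa, ?_, hmem, hJJ, fun X hX hXV hXW => ?_⟩
  · refine norm_le_one_of_sq_projection hJsa (P := J * J) rfl (norm_le_one_of_projection ?_ ?_)
    · rw [IsSelfAdjoint, star_mul, hJsa.star_eq]
    · ext v
      exact congrArg J (hJJ _ (hmem v))
  · ext v
    change J (X v) = -X (J v)
    rw [hJ, hJ, map_sum, ← Finset.sum_neg_distrib]
    refine Finset.sum_congr rfl fun j _ => ?_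
    rw [← selfAdjoint_inner hX, ← selfAdjoint_inner hX, hXV _ (a j).2, hXW _ (b j).2, map_add,
      map_smul, map_smul, hXV _ (a j).2, hXW _ (b j).2, inner_neg_left, neg_smul, smul_neg, neg_add,
      neg_neg]

end KernelSymmetry

section Vanishing

variable {Y : Type*} [MetricSpace Y]

/-- Every `1`-multigraded uniform Fredholm module has trivial class: the multigrading operator `e`
gives the odd symmetry `i e`, which commutes with `e`, and preserves the kernel. -/
theorem cls_eq_zero_one (hY : UniformlyDiscrete Y) (x : UniformFredholmModule 1 Y) : cls x = 0 := by
  have := hY.discreteTopology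
  obtain ⟨M, T, hT⟩ := x
  obtain ⟨S, hS, hSsa, hSc, -, hcls⟩ := exists_diagonal hY hT
  rw [hcls]
  let K : Submodule ℂ M.H := LinearMap.ker (S : M.H →ₗ[ℂ] M.H)
  have hKc : IsClosed (K : Set M.H) := S.isClosed_ker
  have : CompleteSpace K := hKc.completeSpace_coe
  have hK (v : M.H) : v ∈ K ↔ S v = 0 := LinearMap.mem_ker
  have hcom (X : M.H →L[ℂ] M.H) (hX : S * X = X * S) (v : M.H) (hv : v ∈ K) : X v ∈ K := by
    have := congrArg (fun C : M.H →L[ℂ] M.H => C v) hX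
    rw [hK] at hv ⊢
    change S (X v) = X (S v) at this
    rw [this, hv, map_zero]
  have hγ : K.starProjection * M.γ = M.γ * K.starProjection := by
    refine starProjection_commute_of_isSelfAdjoint M.γ_selfAdjoint fun v hv => ?_
    have := congrArg (fun C : M.H →L[ℂ] M.H => C v) hS.odd
    rw [hK] at hv ⊢
    change S (M.γ v) = -(M.γ (S v)) at this
    rw [this, hv, map_zero, neg_zero]
  have he : K.starProjection * M.e 0 = M.e 0 * K.starProjection := by
    refine starProjection_commute (hcom _ (hS.multigraded 0)) (hcom _ ?_)
    rw [M.star_e, mul_neg, neg_mul, hS.multigraded]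
  have hρ (y : Y) : K.starProjection * M.ρ (pt y) = M.ρ (pt y) * K.starProjection :=
    starProjection_commute_of_isSelfAdjoint ((isProjFamily_rep M.ρ).isSelfAdjoint y)
      (hcom _ (hSc _))
  have hsa : star K.starProjection = K.starProjection := isSelfAdjoint_starProjection K
  have hproj (v : M.H) (hv : v ∈ K) : K.starProjection v = v :=
    Submodule.starProjection_eq_self_iff.2 hv
  refine cls_eq_zero_of_kernel_symmetry hY (J := Complex.I • (M.e 0 * K.starProjection)) hS hSsa hSc
    ?_ ?_ (fun i => ?_) (fun y => ?_) (fun y => ?_) fun y v _ hv => ?_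
  · rw [IsSelfAdjoint, star_smul, star_mul, hsa, M.star_e, mul_neg, he]
    simp
  · rw [smul_mul_assoc, mul_smul_comm, mul_assoc, hγ, ← mul_assoc, M.e_odd, neg_mul, smul_neg,
      mul_assoc]
  · rw [Subsingleton.elim i 0, smul_mul_assoc, mul_smul_comm, mul_assoc, he]
  · rw [smul_mul_assoc, mul_smul_comm, mul_assoc, hρ, ← mul_assoc, ← mul_assoc, M.ρ_multigraded]
  · ext v
    have h1 : M.e 0 (K.starProjection (M.ρ (pt y) v)) ∈ K :=
      hcom _ (hS.multigraded 0) _ (K.starProjection_apply_mem _)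
    rw [hK] at h1
    change S (Complex.I • M.e 0 (K.starProjection (M.ρ (pt y) v))) = 0
    rw [map_smul, h1, smul_zero]
  · have hv' : v ∈ K := hv
    have h1 : M.e 0 v ∈ K := hcom _ (hS.multigraded 0) v hv'
    have h2 : M.e 0 (M.e 0 v) = -v := congrArg (fun C : M.H →L[ℂ] M.H => C v) (M.e_sq 0)
    change Complex.I • M.e 0 (K.starProjection (Complex.I • M.e 0 (K.starProjection v))) = v
    rw [hproj v hv', map_smul, map_smul, hproj _ h1, h2, smul_smul, Complex.I_mul_I]
    simp

/-- The part of degree `ε = ±1` of the kernel of `S` in the range of `P`. -/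
def gradedKer {H : Type*} [NormedAddCommGroup H] [InnerProductSpace ℂ H]
    (P γ S : H →L[ℂ] H) (ε : ℂ) : Submodule ℂ H where
  carrier := {v | P v = v ∧ γ v = ε • v ∧ S v = 0}
  add_mem' := by
    rintro v w ⟨h1, h2, h3⟩ ⟨h4, h5, h6⟩
    exact ⟨by rw [map_add, h1, h4], by rw [map_add, h2, h5, smul_add],
      by rw [map_add, h3, h6, add_zero]⟩
  zero_mem' := ⟨map_zero _, by rw [map_zero, smul_zero], map_zero _⟩
  smul_mem' := by
    rintro c v ⟨h1, h2, h3⟩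
    exact ⟨by rw [map_smul, h1], by rw [map_smul, h2, smul_comm], by rw [map_smul, h3, smul_zero]⟩

lemma mem_gradedKer {H : Type*} [NormedAddCommGroup H] [InnerProductSpace ℂ H]
    {P γ S : H →L[ℂ] H} {ε : ℂ} {v : H} :
    v ∈ gradedKer P γ S ε ↔ P v = v ∧ γ v = ε • v ∧ S v = 0 := Iff.rfl

variable [DiscreteTopology Y] {p : ℕ} {M : MultigradedRep p Y}

lemma gradedKer_le_kerOver {S : M.H →L[ℂ] M.H} (hSc : ∀ f, S * M.ρ f = M.ρ f * S) (y : Y) (ε : ℂ) :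
    gradedKer (M.ρ (pt y)) M.γ (M.ρ (pt y) * S) ε ≤ kerOver M.ρ S (pt y) := by
  rintro v ⟨h1, -, h3⟩
  refine ⟨h1, ?_⟩
  rw [← hSc] at h3
  change S (M.ρ (pt y) v) = 0 at h3
  rwa [h1] at h3

lemma finiteDimensional_kerOver_pt (hY : UniformlyDiscrete Y) {S : M.H →L[ℂ] M.H}
    (hS : IsUniformFredholm M S) (y : Y) : FiniteDimensional ℂ (kerOver M.ρ S (pt y)) := by
  obtain ⟨N, hN⟩ := exists_finrank_kerOver_le hY hS one_pos
  exact (hN ⟨{y}, by simp⟩).1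

lemma finiteDimensional_gradedKer (hY : UniformlyDiscrete Y) {S : M.H →L[ℂ] M.H}
    (hS : IsUniformFredholm M S) (hSc : ∀ f, S * M.ρ f = M.ρ f * S) (y : Y) (ε : ℂ) :
    FiniteDimensional ℂ (gradedKer (M.ρ (pt y)) M.γ (M.ρ (pt y) * S) ε) := by
  have := finiteDimensional_kerOver_pt hY hS y
  exact Submodule.finiteDimensional_of_le (gradedKer_le_kerOver hSc y ε)

/-- Without multigrading operators, the class of a diagonal selfadjoint operator vanishes if the even
and the odd part of its kernel over each point have the same dimension. -/
theorem cls_eq_zero_of_finrank_eq {M : MultigradedRep 0 Y} (hY : UniformlyDiscrete Y)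
    {S : M.H →L[ℂ] M.H} (hS : IsUniformFredholm M S) (hSsa : IsSelfAdjoint S)
    (hSc : ∀ f, S * M.ρ f = M.ρ f * S)
    (hdim : ∀ y, Module.finrank ℂ (gradedKer (M.ρ (pt y)) M.γ (M.ρ (pt y) * S) 1) =
      Module.finrank ℂ (gradedKer (M.ρ (pt y)) M.γ (M.ρ (pt y) * S) (-1))) :
    cls (⟨M, S, hS⟩ : UniformFredholmModule 0 Y) = 0 := by
  have hfin := finiteDimensional_gradedKer hY hS hSc
  have hP := isProjFamily_rep M.ρ
  have hswap (y : Y) := exists_swap (hdim y) (fun a ha b hb => by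
    have h1 : inner ℂ (M.γ a) b = inner ℂ a (M.γ b) := selfAdjoint_inner M.γ_selfAdjoint a b
    rw [ha.2.1, hb.2.1, one_smul, neg_one_smul, inner_neg_right] at h1
    exact self_eq_neg.1 h1)
  choose J hJsa hJn hJmem hJJ hJodd using hswap
  have hle (y : Y) : gradedKer (M.ρ (pt y)) M.γ (M.ρ (pt y) * S) 1 ⊔
      gradedKer (M.ρ (pt y)) M.γ (M.ρ (pt y) * S) (-1) ≤ kerOver M.ρ S (pt y) :=
    sup_le (gradedKer_le_kerOver hSc y 1) (gradedKer_le_kerOver hSc y (-1))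
  have hPJ (y : Y) : M.ρ (pt y) * J y = J y := by
    ext v
    exact (hle y (hJmem y v)).1
  have hJP (y : Y) : J y * M.ρ (pt y) = J y := by
    have := congrArg star (hPJ y)
    rwa [star_mul, (hJsa y).star_eq, (hP.isSelfAdjoint y).star_eq] at this
  obtain ⟨J', hJ'⟩ := hP.exists_isStrongSum hPJ hJP hJn
  have hl := hP.mul_strongSum hJ' hPJ
  have hr := hP.strongSum_mul hJ' hJP
  have hJv (y : Y) (v : M.H) (hv : M.ρ (pt y) v = v) : J' v = J y v := by
    have := congrArg (fun C : M.H →L[ℂ] M.H => C v) (hr y)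
    change J' (M.ρ (pt y) v) = J y v at this
    rwa [hv] at this
  refine cls_eq_zero_of_kernel_symmetry hY hS hSsa hSc (hJ'.isSelfAdjoint hJsa)
    (hJ'.mul_anticomm_of_forall fun y => hJodd y M.γ M.γ_selfAdjoint (fun a ha => ?_) fun b hb => ?_)
    (fun i => i.elim0) (fun y => by rw [hl, hr]) (fun y => ?_) fun y v hv hSv => ?_
  · rw [ha.2.1, one_smul]
  · rw [hb.2.1, neg_one_smul]
  · rw [hr]
    ext v
    exact (hle y (hJmem y v)).2
  · have h1 : M.ρ (pt y) (J y v) = J y v := (hle y (hJmem y v)).1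
    rw [hJv y v hv, hJv y _ h1]
    refine hJJ y v ?_
    -- the even and the odd part of `v` lie in the two parts of the kernel
    have hγγ : M.γ (M.γ v) = v := congrArg (fun C : M.H →L[ℂ] M.H => C v) M.γ_sq
    have hPγ : M.ρ (pt y) (M.γ v) = M.γ v := by
      have := congrArg (fun C : M.H →L[ℂ] M.H => C v) (M.ρ_even (pt y))
      change M.ρ (pt y) (M.γ v) = M.γ (M.ρ (pt y) v) at this
      rwa [hv] at this
    have hSγ : S (M.γ v) = 0 := by
      have := congrArg (fun C : M.H →L[ℂ] M.H => C v) hS.odd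
      change S (M.γ v) = -(M.γ (S v)) at this
      rw [this, hSv, map_zero, neg_zero]
    have hsum : v = (1 / 2 : ℂ) • (v + M.γ v) + (1 / 2 : ℂ) • (v - M.γ v) := by module
    rw [hsum]
    refine Submodule.add_mem_sup (Submodule.smul_mem _ _ ⟨?_, ?_, ?_⟩)
      (Submodule.smul_mem _ _ ⟨?_, ?_, ?_⟩)
    · rw [map_add, hv, hPγ]
    · rw [map_add, hγγ, one_smul, add_comm]
    · change M.ρ (pt y) (S (v + M.γ v)) = 0
      rw [map_add, hSv, hSγ, add_zero, map_zero]
    · rw [map_sub, hv, hPγ]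
    · rw [map_sub, hγγ, neg_one_smul, neg_sub]
    · change M.ρ (pt y) (S (v - M.γ v)) = 0
      rw [map_sub, hSv, hSγ, sub_zero, map_zero]

end Vanishing

/-! ### Stability of the graded dimension of the kernel -/

section GradedDim

lemma finrank_ker_add_eq_of_adjoint {E F : Type*} [NormedAddCommGroup E] [InnerProductSpace ℂ E]
    [NormedAddCommGroup F] [InnerProductSpace ℂ F] [FiniteDimensional ℂ E] [FiniteDimensional ℂ F]
    (A : E →ₗ[ℂ] F) (B : F →ₗ[ℂ] E) (h : ∀ x y, inner ℂ (A x) y = inner ℂ x (B y)) :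
    Module.finrank ℂ (LinearMap.ker A) + Module.finrank ℂ F =
      Module.finrank ℂ (LinearMap.ker B) + Module.finrank ℂ E := by
  have hker : LinearMap.ker B = (LinearMap.range A)ᗮ := by
    ext y
    rw [LinearMap.mem_ker, Submodule.mem_orthogonal]
    constructor
    · rintro hy _ ⟨x, rfl⟩
      rw [h, hy, inner_zero_right]
    · intro hy
      rw [← inner_self_eq_zero (𝕜 := ℂ), ← h]
      exact hy _ ⟨_, rfl⟩
  have h1 := A.finrank_range_add_finrank_ker
  have h2 := (LinearMap.range A).finrank_add_finrank_orthogonal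
  rw [← hker] at h2
  omega

variable {H : Type*} [NormedAddCommGroup H] [InnerProductSpace ℂ H]

/-- The graded dimension of the kernel of `S` in the range of `P`. -/
def gradedDim (P γ S : H →L[ℂ] H) : ℤ :=
  (Module.finrank ℂ (gradedKer P γ S 1) : ℤ) - Module.finrank ℂ (gradedKer P γ S (-1))

/-- The operator `K + (1 - K) S + (1 - P)`, used for the projection `K` onto a finite-dimensional
subspace of the range of the projection `P`. If it is invertible, then the kernel of `S` in the range
of `P` can be computed in the range of `K`. -/
def schurOp (K P S : H →L[ℂ] H) : H →L[ℂ] H := K + (1 - K) * S + (1 - P)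

variable [CompleteSpace H]

/-- If the Schur operator of the odd selfadjoint operator `S` with respect to `K` is invertible,
then the kernel of `S` is isomorphic to the kernel of an odd selfadjoint operator on the
finite-dimensional space `K`, and therefore has the same graded dimension as `K`. -/
lemma gradedDim_eq_of_isUnit {P γ S : H →L[ℂ] H} {K : Submodule ℂ H} [FiniteDimensional ℂ K]
    (hS : IsSelfAdjoint S) (hP : IsSelfAdjoint P) (hP2 : P * P = P) (hPS : P * S = S)
    (hPγ : P * γ = γ * P) (hγ : IsSelfAdjoint γ)
    (hSγ : S * γ = -(γ * S)) (hKP : ∀ v ∈ K, P v = v) (hKγ : ∀ v ∈ K, γ v ∈ K)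
    (hu : IsUnit (schurOp K.starProjection P S)) :
    gradedDim P γ S = (Module.finrank ℂ (gradedKer K.starProjection γ 0 1) : ℤ) -
      Module.finrank ℂ (gradedKer K.starProjection γ 0 (-1)) := by
  set Q : H →L[ℂ] H := K.starProjection with hQdef
  have hQK (v : H) : Q v ∈ K := K.starProjection_apply_mem v
  have hQid (v : H) (hv : v ∈ K) : Q v = v := Submodule.starProjection_eq_self_iff.2 hv
  have hQmem (v : H) : Q v = v ↔ v ∈ K := Submodule.starProjection_eq_self_iff
  have hQsa : IsSelfAdjoint Q := isSelfAdjoint_starProjection K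
  have hQγ (v : H) : Q (γ v) = γ (Q v) := congrArg (fun C : H →L[ℂ] H => C v)
    (starProjection_commute_of_isSelfAdjoint hγ hKγ)
  have hPS' (v : H) : P (S v) = S v := congrArg (fun C : H →L[ℂ] H => C v) hPS
  have hPQ (v : H) : P (Q v) = Q v := hKP _ (hQK v)
  have hQP (v : H) : Q (P v) = Q v := by
    have h1 : P * Q = Q := ContinuousLinearMap.ext hPQ
    have h2 := congrArg star h1
    rw [star_mul, hP.star_eq, hQsa.star_eq] at h2
    exact congrArg (fun C : H →L[ℂ] H => C v) h2
  have hSγ' (v : H) : S (γ v) = -γ (S v) := congrArg (fun C : H →L[ℂ] H => C v) hSγ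
  have hPγ' (v : H) : P (γ v) = γ (P v) := congrArg (fun C : H →L[ℂ] H => C v) hPγ
  have hL (v : H) : schurOp Q P S v = Q v + (S v - Q (S v)) + (v - P v) := by
    simp [schurOp]
  obtain ⟨u, hu⟩ := hu
  set r : H →L[ℂ] H := ↑u⁻¹ with hr
  have hLr (g : H) : schurOp Q P S (r g) = g := by
    rw [← hu, ← mul_apply_eq_comp, Units.mul_inv]
    rfl
  have hrL (v : H) : r (schurOp Q P S v) = v := by
    rw [← hu, ← mul_apply_eq_comp, Units.inv_mul]
    rfl
  -- for `g` in `K`, the vector `r g` is the only `v` with `P v = v`, `Q v = g` and `S v` in `K`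
  have hex (g : H) (hg : g ∈ K) : P (r g) = r g ∧ Q (r g) = g ∧ S (r g) ∈ K := by
    have h1 := hL (r g)
    rw [hLr] at h1
    have hPP : P (P (r g)) = P (r g) := congrArg (fun C : H →L[ℂ] H => C (r g)) hP2
    have hPr : P (r g) = r g := by
      have h2 := congrArg P h1
      rw [map_add, map_add, map_sub, map_sub, hPQ, hPS', hPQ, hKP g hg, hPP, sub_self,
        add_zero] at h2
      rw [← h2, left_eq_add, sub_eq_zero] at h1
      exact h1.symm
    rw [hPr, sub_self, add_zero] at h1
    have hQr : Q (r g) = g := by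
      have h2 := congrArg Q h1
      rw [map_add, map_sub, hQid _ (hQK _), hQid _ (hQK _), sub_self, add_zero, hQid g hg] at h2
      exact h2.symm
    rw [hQr, left_eq_add, sub_eq_zero] at h1
    exact ⟨hPr, hQr, h1 ▸ hQK _⟩
  have huniq (v : H) (hPv : P v = v) (hSv : S v ∈ K) : r (Q v) = v := by
    have h1 := hL v
    rw [hQid _ hSv, hPv, sub_self, sub_self, add_zero, add_zero] at h1
    rw [← h1, hrL]
  have hrγ (g : H) (hg : g ∈ K) : r (γ g) = γ (r g) := by
    obtain ⟨h1, h2, h3⟩ := hex g hg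
    have h4 := huniq (γ (r g)) (by rw [hPγ', h1]) (by
      rw [hSγ']
      exact K.neg_mem (hKγ _ h3))
    rwa [hQγ, h2] at h4
  have hmemK (ε : ℂ) (g : H) : g ∈ gradedKer Q γ 0 ε ↔ g ∈ K ∧ γ g = ε • g := by
    rw [mem_gradedKer, hQmem]
    simp
  have hd (ε ε' : ℂ) (hε : ε' = -ε) (g : H) (hg : g ∈ gradedKer Q γ 0 ε) :
      ((S * r : H →L[ℂ] H) : H →ₗ[ℂ] H) g ∈ gradedKer Q γ 0 ε' := by
    rw [hmemK] at hg ⊢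
    refine ⟨(hex g hg.1).2.2, ?_⟩
    change γ (S (r g)) = ε' • S (r g)
    rw [← neg_eq_iff_eq_neg.2 (hSγ' (r g)), ← hrγ g hg.1, hg.2, map_smul, map_smul, hε, neg_smul]
  have hfd (ε : ℂ) : FiniteDimensional ℂ (gradedKer Q γ 0 ε) :=
    Submodule.finiteDimensional_of_le (S₂ := K) fun g hg => ((hmemK ε g).1 hg).1
  have hequiv (ε ε' : ℂ) (hε : ε' = -ε) : Module.finrank ℂ (gradedKer P γ S ε) =
      Module.finrank ℂ (LinearMap.ker (LinearMap.restrict _ (hd ε ε' hε))) := by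
    have hf (v : gradedKer P γ S ε) : Q v ∈ gradedKer Q γ 0 ε := by
      rw [hmemK, ← hQγ, v.2.2.1, map_smul]
      exact ⟨hQK _, rfl⟩
    have hrQ (v : gradedKer P γ S ε) : r (Q v) = v :=
      huniq v v.2.1 (by rw [v.2.2.2]; exact K.zero_mem)
    have hf' (v : gradedKer P γ S ε) : (⟨Q v, hf v⟩ : gradedKer Q γ 0 ε) ∈
        LinearMap.ker (LinearMap.restrict _ (hd ε ε' hε)) := by
      refine LinearMap.mem_ker.2 (Subtype.ext ?_)
      change S (r (Q v)) = 0
      rw [hrQ, v.2.2.2]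
    have hb (g : LinearMap.ker (LinearMap.restrict _ (hd ε ε' hε))) :
        r (g : gradedKer Q γ 0 ε) ∈ gradedKer P γ S ε := by
      have hg := (hmemK ε _).1 g.1.2
      refine ⟨(hex _ hg.1).1, ?_, congrArg Subtype.val (LinearMap.mem_ker.1 g.2)⟩
      rw [← hrγ _ hg.1, hg.2, map_smul]
    exact LinearEquiv.finrank_eq
      { toFun := fun v => ⟨⟨Q v, hf v⟩, hf' v⟩
        invFun := fun g => ⟨r (g : gradedKer Q γ 0 ε), hb g⟩
        left_inv := fun v => Subtype.ext (hrQ v)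
        right_inv := fun g =>
          Subtype.ext (Subtype.ext (hex _ ((hmemK ε _).1 g.1.2).1).2.1)
        map_add' := fun v w => Subtype.ext (Subtype.ext (map_add Q _ _))
        map_smul' := fun c v => Subtype.ext (Subtype.ext (map_smul Q c (v : H))) }
  have hadj := finrank_ker_add_eq_of_adjoint (LinearMap.restrict _ (hd 1 (-1) rfl))
    (LinearMap.restrict _ (hd (-1) 1 (neg_neg 1).symm)) fun g h => by
      have hg := ((hmemK _ _).1 g.2).1
      have hh := ((hmemK _ _).1 h.2).1
      obtain ⟨-, hg2, hg3⟩ := hex g hg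
      obtain ⟨-, hh2, hh3⟩ := hex h hh
      change inner ℂ (S (r g)) (h : H) = inner ℂ (g : H) (S (r h))
      calc inner ℂ (S (r g)) (h : H) = inner ℂ (S (r g)) (Q (r h)) := by rw [hh2]
        _ = inner ℂ (S (r g)) (r h) := by rw [← selfAdjoint_inner hQsa, hQid _ hg3]
        _ = inner ℂ (r g) (S (r h)) := selfAdjoint_inner hS _ _
        _ = inner ℂ (Q (r g)) (S (r h)) := by rw [selfAdjoint_inner hQsa, hQid _ hh3]
        _ = _ := by rw [hg2]
  rw [gradedDim, hequiv 1 (-1) rfl, hequiv (-1) 1 (neg_neg 1).symm]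
  omega

/-- The Schur operator of `S` with respect to the kernel of `S` is invertible. -/
lemma isUnit_schurOp {P S : H →L[ℂ] H} {K : Submodule ℂ H} [FiniteDimensional ℂ K]
    (hS : IsSelfAdjoint S) (hP : IsSelfAdjoint P) (hP2 : P * P = P) (hPS : P * S = S)
    (hK : ∀ v, v ∈ K ↔ P v = v ∧ S v = 0)
    (hk : ∃ (k : H →L[ℂ] H) (N : ℕ), LinearMap.rank (k : H →ₗ[ℂ] H) ≤ N ∧ ‖S * S - P - k‖ < 1) :
    IsUnit (schurOp K.starProjection P S) := by
  set Q : H →L[ℂ] H := K.starProjection with hQdef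
  have hQK (v : H) : Q v ∈ K := K.starProjection_apply_mem v
  have hQsa : IsSelfAdjoint Q := isSelfAdjoint_starProjection K
  have hQ2 : Q * Q = Q := ContinuousLinearMap.ext fun v =>
    Submodule.starProjection_eq_self_iff.2 (hQK v)
  have hSQ : S * Q = 0 := ContinuousLinearMap.ext fun v => ((hK _).1 (hQK v)).2
  have hPQ : P * Q = Q := ContinuousLinearMap.ext fun v => ((hK _).1 (hQK v)).1
  have hQS : Q * S = 0 := by
    have := congrArg star hSQ
    rwa [star_mul, star_zero, hS.star_eq, hQsa.star_eq] at this
  have hQP : Q * P = Q := by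
    have := congrArg star hPQ
    rwa [star_mul, hP.star_eq, hQsa.star_eq] at this
  have hSP : S * P = S := by
    have := congrArg star hPS
    rwa [star_mul, hP.star_eq, hS.star_eq] at this
  have hL : schurOp Q P S = Q + S + (1 - P) := by
    rw [schurOp, sub_mul, hQS, one_mul, sub_zero]
  have hLL : schurOp Q P S ^ 2 = S * S + Q + (1 - P) := by
    have : (Q + S + (1 - P)) ^ 2 = Q * Q + Q * S + S * Q + S * S + 2 * Q - Q * P - P * Q +
        2 * S - S * P - P * S + 1 - 2 * P + P * P := by noncomm_ring
    rw [hL, this, hQ2, hQS, hSQ, hQP, hPQ, hSP, hPS, hP2]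
    noncomm_ring
  refine (isUnit_pow_iff two_ne_zero).1 ?_
  obtain ⟨k, N, hk1, hk2⟩ := hk
  refine isUnit_of_injective_of_rank_le (k := k + Q) (N := N + Module.finrank ℂ K) ?_ ?_ ?_
  · push_cast
    exact (LinearMap.rank_add_le _ _).trans (add_le_add hk1 (rank_le_of_finrank le_rfl hQK))
  · have : schurOp Q P S ^ 2 - 1 - (k + Q) = S * S - P - k := by rw [hLL]; abel
    rwa [this]
  · have hLsa : IsSelfAdjoint (schurOp Q P S) := by
      rw [hL]
      exact (hQsa.add hS).add ((IsSelfAdjoint.one _).sub hP)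
    refine (injective_iff_map_eq_zero _).2 fun v hv => ?_
    rw [pow_two] at hv
    have h0 := apply_eq_zero_of_apply_apply hLsa hv
    have hmul (X : H →L[ℂ] H) : (X * schurOp Q P S) v = 0 := by
      rw [mul_apply_eq_comp, h0, map_zero]
    have h1 : Q v = 0 := by
      have := hmul Q
      rwa [hL, mul_add, mul_add, mul_sub, hQ2, hQS, hQP, mul_one, sub_self, add_zero,
        add_zero] at this
    have h2 : S v + Q v = 0 := by
      have := hmul P
      rw [hL, mul_add, mul_add, mul_sub, hPQ, hPS, hP2, mul_one, sub_self, add_zero] at this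
      rwa [add_comm]
    have h3 : v - P v = 0 := by
      rw [hL] at h0
      change Q v + S v + (v - P v) = 0 at h0
      rwa [add_comm (Q v), h2, zero_add] at h0
    rw [h1, add_zero] at h2
    rw [← h1]
    exact (Submodule.starProjection_eq_self_iff.2 ((hK v).2 ⟨(sub_eq_zero.1 h3).symm, h2⟩)).symm

end GradedDim

/-! ### The index of a uniform Fredholm module -/

section Index

variable {Y : Type*} [MetricSpace Y] [DiscreteTopology Y] {p : ℕ}

/-- The compression of the real part of `T` to the range of the projection of the point `y`. -/
def compress (M : MultigradedRep p Y) (T : M.H →L[ℂ] M.H) (y : Y) : M.H →L[ℂ] M.H :=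
  M.ρ (pt y) * ((1 / 2 : ℂ) • (T + star T)) * M.ρ (pt y)

/-- The index of `T` over the point `y`, as the graded dimension of the kernel of the compression
of the real part of `T`. -/
def ind (M : MultigradedRep p Y) (T : M.H →L[ℂ] M.H) (y : Y) : ℤ :=
  gradedDim (M.ρ (pt y)) M.γ (compress M T y)

variable {M : MultigradedRep p Y}

/-- Any operator of a uniform Fredholm module has the same index as some diagonal one. -/
lemma exists_diagonal_compress (hY : UniformlyDiscrete Y) {T : M.H →L[ℂ] M.H}
    (hT : IsUniformFredholm M T) : ∃ (S : M.H →L[ℂ] M.H) (hS : IsUniformFredholm M S),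
      IsSelfAdjoint S ∧ (∀ f, S * M.ρ f = M.ρ f * S) ∧
      (∀ y, compress M T y = M.ρ (pt y) * S) ∧
      cls (⟨M, T, hT⟩ : UniformFredholmModule p Y) = cls ⟨M, S, hS⟩ := by
  obtain ⟨S, hS, h1, h2, h3, h4⟩ := exists_diagonal hY hT
  exact ⟨S, hS, h1, h2, fun y => (h3 y).symm, h4⟩

lemma finiteDimensional_gradedKer_compress (hY : UniformlyDiscrete Y) {T : M.H →L[ℂ] M.H}
    (hT : IsUniformFredholm M T) (y : Y) (ε : ℂ) :
    FiniteDimensional ℂ (gradedKer (M.ρ (pt y)) M.γ (compress M T y) ε) := by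
  obtain ⟨S, hS, -, hSc, h, -⟩ := exists_diagonal_compress hY hT
  rw [h]
  exact finiteDimensional_gradedKer hY hS hSc y ε

/-- The index is constant along norm continuous paths: near `t₀` it is the graded dimension of the
kernel at `t₀`, even if the kernel itself becomes smaller. -/
lemma ind_eq_of_path (hY : UniformlyDiscrete Y) {T : unitInterval → (M.H →L[ℂ] M.H)}
    (hT : ∀ t, IsUniformFredholm M (T t)) (hc : Continuous T) (y : Y) :
    ind M (T 0) y = ind M (T 1) y := by
  have hP := isProjFamily_rep M.ρ
  have hcc : Continuous fun t => compress M (T t) y := by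
    unfold compress
    fun_prop
  suffices h : IsLocallyConstant fun t => ind M (T t) y from
    h.apply_eq_of_isPreconnected isPreconnected_univ (Set.mem_univ _) (Set.mem_univ _)
  refine (IsLocallyConstant.iff_eventually_eq _).2 fun t₀ => ?_
  obtain ⟨D, hD, hDsa, hDc, hDT, -⟩ := exists_diagonal_compress hY (hT t₀)
  let K := kerOver M.ρ (compress M (T t₀) y) (pt y)
  have hKle : K ≤ kerOver M.ρ D (pt y) := by
    rintro v ⟨h1, h2⟩
    refine ⟨h1, ?_⟩
    rw [hDT, ← hDc] at h2
    change D (M.ρ (pt y) v) = 0 at h2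
    rwa [h1] at h2
  have := finiteDimensional_kerOver_pt hY hD y
  have : FiniteDimensional ℂ K := Submodule.finiteDimensional_of_le hKle
  have hsa (t : unitInterval) : IsSelfAdjoint (compress M (T t) y) := by
    have h1 : IsSelfAdjoint ((1 / 2 : ℂ) • (T t + star (T t))) := by
      rw [IsSelfAdjoint, star_smul, star_add, star_star, add_comm]
      simp
    rw [IsSelfAdjoint, compress, star_mul, star_mul, h1.star_eq, (hP.isSelfAdjoint y).star_eq,
      mul_assoc]
  have hPS (t : unitInterval) : M.ρ (pt y) * compress M (T t) y = compress M (T t) y := by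
    rw [compress, ← mul_assoc, ← mul_assoc, hP.idem]
  have hodd (t : unitInterval) : compress M (T t) y * M.γ = -(M.γ * compress M (T t) y) := by
    obtain ⟨E, hE, -, -, hET, -⟩ := exists_diagonal_compress hY (hT t)
    rw [hET, mul_assoc, hE.odd, mul_neg, ← mul_assoc, M.ρ_even, mul_assoc]
  have hunit : IsUnit (schurOp K.starProjection (M.ρ (pt y)) (compress M (T t₀) y)) := by
    refine isUnit_schurOp (hsa t₀) (hP.isSelfAdjoint y) (hP.idem y) (hPS t₀)
      (fun v => Iff.rfl) ?_
    obtain ⟨N, hN⟩ :=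
      ((uniformlyLocallyCompactOp_iff hY).1 hD.uniformly_sq_sub_one 1 one_pos).1 1 one_pos
    obtain ⟨k, hk, hk'⟩ := hN ⟨{y}, by simp⟩
    refine ⟨k, N, hk, ?_⟩
    have : compress M (T t₀) y * compress M (T t₀) y - M.ρ (pt y) =
        M.ρ (pt y) * (D * D - 1) := by
      rw [hDT, mul_assoc, ← mul_assoc D, hDc, mul_assoc, ← mul_assoc (M.ρ (pt y)) (M.ρ (pt y)),
        hP.idem, mul_sub, mul_one]
    rw [this]
    exact hk'
  have hnear : ∀ᶠ t in nhds t₀,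
      IsUnit (schurOp K.starProjection (M.ρ (pt y)) (compress M (T t) y)) := by
    have h1 : Continuous fun t => schurOp K.starProjection (M.ρ (pt y)) (compress M (T t) y) := by
      unfold schurOp
      fun_prop
    exact h1.continuousAt.eventually (Units.isOpen.mem_nhds hunit)
  have hKγ (v : M.H) (hv : v ∈ K) : M.γ v ∈ K := by
    constructor
    · have := congrArg (fun C : M.H →L[ℂ] M.H => C v) (M.ρ_even (pt y))
      change M.ρ (pt y) (M.γ v) = M.γ (M.ρ (pt y) v) at this
      rw [this, hv.1]
    · have := congrArg (fun C : M.H →L[ℂ] M.H => C v) (hodd t₀)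
      change compress M (T t₀) y (M.γ v) = -(M.γ (compress M (T t₀) y v)) at this
      rw [this, hv.2, map_zero, neg_zero]
  have heq (t : unitInterval)
      (ht : IsUnit (schurOp K.starProjection (M.ρ (pt y)) (compress M (T t) y))) :=
    gradedDim_eq_of_isUnit (hsa t) (hP.isSelfAdjoint y) (hP.idem y) (hPS t) (M.ρ_even _)
      M.γ_selfAdjoint (hodd t) (K := K) (fun v hv => hv.1) hKγ ht
  filter_upwards [hnear] with t ht
  exact (heq t ht).trans (heq t₀ hunit).symm

lemma sum_finrank_kerOver_le (S : M.H →L[ℂ] M.H) (F : Finset Y)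
    [FiniteDimensional ℂ (kerOver M.ρ S (chi F))] :
    ∑ y ∈ F, Module.finrank ℂ (kerOver M.ρ S (pt y)) ≤
      Module.finrank ℂ (kerOver M.ρ S (chi F)) := by
  classical
  have hP := isProjFamily_rep M.ρ
  have hle (y : Y) (hy : y ∈ F) : kerOver M.ρ S (pt y) ≤ kerOver M.ρ S (chi F) := by
    rintro v ⟨h1, h2⟩
    refine ⟨?_, h2⟩
    rw [← h1, ← mul_apply_eq_comp, ← map_mul, mul_comm, pt_mul_chi hy]
  have hfd (y : F) : FiniteDimensional ℂ (kerOver M.ρ S (pt (y : Y))) :=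
    Submodule.finiteDimensional_of_le (hle y y.2)
  let Φ : (∀ y : F, kerOver M.ρ S (pt (y : Y))) →ₗ[ℂ] kerOver M.ρ S (chi F) :=
    ∑ y : F, (Submodule.inclusion (hle y y.2)) ∘ₗ LinearMap.proj y
  have hΦ (v : ∀ y : F, kerOver M.ρ S (pt (y : Y))) : (Φ v : M.H) = ∑ y : F, (v y : M.H) := by
    simp [Φ]
  have hinj : Function.Injective Φ := by
    refine (injective_iff_map_eq_zero Φ).2 fun v hv => funext fun y => Subtype.ext ?_
    have h1 : M.ρ (pt (y : Y)) (Φ v : M.H) = v y := by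
      rw [hΦ, map_sum, Finset.sum_eq_single y]
      · exact (v y).2.1
      · intro z _ hz
        rw [← (v z).2.1]
        exact hP.apply_apply_ne (fun h => hz (Subtype.ext h.symm)) _
      · simp
    rw [← h1, hv]
    exact map_zero _
  have := LinearMap.finrank_le_finrank_of_injective hinj
  rwa [Module.finrank_pi_fintype, Finset.sum_coe_sort F
    fun y => Module.finrank ℂ (kerOver M.ρ S (pt y))] at this

/-- The absolute values of the indices are summable over sets of bounded diameter, uniformly. -/
lemma exists_sum_abs_ind_le (hY : UniformlyDiscrete Y) {T : M.H →L[ℂ] M.H}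
    (hT : IsUniformFredholm M T) {R : ℝ} (hR : 0 < R) :
    ∃ C : ℤ, ∀ F : SmallSet Y R, ∑ y ∈ F.1, |ind M T y| ≤ C := by
  obtain ⟨S, hS, -, hSc, h, -⟩ := exists_diagonal_compress hY hT
  obtain ⟨N, hN⟩ := exists_finrank_kerOver_le hY hS hR
  refine ⟨2 * N, fun F => ?_⟩
  have hy (y : Y) : |ind M T y| ≤ 2 * (Module.finrank ℂ (kerOver M.ρ S (pt y)) : ℤ) := by
    have := finiteDimensional_kerOver_pt hY hS y
    have h1 := Submodule.finrank_mono (gradedKer_le_kerOver (M := M) hSc y 1)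
    have h2 := Submodule.finrank_mono (gradedKer_le_kerOver (M := M) hSc y (-1))
    rw [ind, h, gradedDim, abs_le]
    constructor <;> omega
  have := (hN F).1
  calc ∑ y ∈ F.1, |ind M T y| ≤ ∑ y ∈ F.1, 2 * (Module.finrank ℂ (kerOver M.ρ S (pt y)) : ℤ) :=
        Finset.sum_le_sum fun y _ => hy y
    _ = 2 * ((∑ y ∈ F.1, Module.finrank ℂ (kerOver M.ρ S (pt y)) : ℕ) : ℤ) := by
        rw [← Finset.mul_sum]
        push_cast
        rfl
    _ ≤ 2 * N := by
        have := (sum_finrank_kerOver_le S F.1).trans (hN F).2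
        gcongr

lemma gradedDim_opSum {H₁ H₂ : Type*} [NormedAddCommGroup H₁] [InnerProductSpace ℂ H₁]
    [NormedAddCommGroup H₂] [InnerProductSpace ℂ H₂] {P γ S : H₁ →L[ℂ] H₁} {P' γ' S' : H₂ →L[ℂ] H₂}
    (h : ∀ ε, FiniteDimensional ℂ (gradedKer P γ S ε))
    (h' : ∀ ε, FiniteDimensional ℂ (gradedKer P' γ' S' ε)) :
    gradedDim (opSum P P') (opSum γ γ') (opSum S S') = gradedDim P γ S + gradedDim P' γ' S' := by
  have hker (ε : ℂ) : Module.finrank ℂ (gradedKer (opSum P P') (opSum γ γ') (opSum S S') ε) =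
      Module.finrank ℂ (gradedKer P γ S ε) + Module.finrank ℂ (gradedKer P' γ' S' ε) := by
    have := h ε
    have := h' ε
    rw [← Module.finrank_prod]
    exact LinearEquiv.finrank_eq
      { toFun := fun v => (⟨v.1.fst, congrArg WithLp.fst v.2.1,
          congrArg WithLp.fst v.2.2.1, congrArg WithLp.fst v.2.2.2⟩,
          ⟨v.1.snd, congrArg WithLp.snd v.2.1,
          congrArg WithLp.snd v.2.2.1, congrArg WithLp.snd v.2.2.2⟩)
        invFun := fun w => ⟨WithLp.toLp 2 (w.1.1, w.2.1),
          sum_ext w.1.2.1 w.2.2.1, sum_ext w.1.2.2.1 w.2.2.2.1, sum_ext w.1.2.2.2 w.2.2.2.2⟩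
        left_inv := fun v => rfl
        right_inv := fun w => rfl
        map_add' := fun v w => rfl
        map_smul' := fun c v => rfl }
  rw [gradedDim, hker, hker, gradedDim, gradedDim]
  push_cast
  ring

lemma ind_directSum (hY : UniformlyDiscrete Y) (x z : UniformFredholmModule p Y) (y : Y) :
    ind (x.directSum z).toMultigradedRep (x.directSum z).T y =
      ind x.toMultigradedRep x.T y + ind z.toMultigradedRep z.T y := by
  have hcomp : compress (x.directSum z).toMultigradedRep (x.directSum z).T y =
      opSum (compress x.toMultigradedRep x.T y) (compress z.toMultigradedRep z.T y) := by
    change opSum (x.ρ (pt y)) (z.ρ (pt y)) * ((1 / 2 : ℂ) • (opSum x.T z.T + star (opSum x.T z.T))) *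
      opSum (x.ρ (pt y)) (z.ρ (pt y)) = _
    rw [opSum_star, opSum_add, opSum_smul, opSum_mul, opSum_mul]
    rfl
  have hfd (ε : ℂ) := finiteDimensional_gradedKer_compress hY x.isUniformFredholm y ε
  have hfd' (ε : ℂ) := finiteDimensional_gradedKer_compress hY z.isUniformFredholm y ε
  rw [ind, hcomp]
  exact gradedDim_opSum hfd hfd'

lemma UnitarilyEquivalent.ind_eq {x z : UniformFredholmModule p Y} (h : UnitarilyEquivalent x z)
    (y : Y) : ind x.toMultigradedRep x.T y = ind z.toMultigradedRep z.T y := by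
  obtain ⟨U, hγ, -, hρ, hT⟩ := h
  have hstar (v : x.H) : U (star x.T v) = star z.T (U v) := by
    refine ext_inner_right ℂ fun w => ?_
    obtain ⟨w, rfl⟩ := U.surjective w
    rw [U.inner_map_map, ContinuousLinearMap.star_eq_adjoint, ContinuousLinearMap.star_eq_adjoint,
      ContinuousLinearMap.adjoint_inner_left, ContinuousLinearMap.adjoint_inner_left, ← hT,
      U.inner_map_map]
  have hcomp (v : x.H) : U (compress x.toMultigradedRep x.T y v) =
      compress z.toMultigradedRep z.T y (U v) := by
    change U (x.ρ (pt y) ((1 / 2 : ℂ) • (x.T (x.ρ (pt y) v) + star x.T (x.ρ (pt y) v)))) =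
      z.ρ (pt y) ((1 / 2 : ℂ) • (z.T (z.ρ (pt y) (U v)) + star z.T (z.ρ (pt y) (U v))))
    rw [hρ, map_smul, map_add, hT, hstar, hρ]
  have hker (ε : ℂ) :
      (gradedKer (x.ρ (pt y)) x.γ (compress x.toMultigradedRep x.T y) ε).map
        (U.toLinearEquiv : x.H →ₗ[ℂ] z.H) =
      gradedKer (z.ρ (pt y)) z.γ (compress z.toMultigradedRep z.T y) ε := by
    ext w
    rw [Submodule.mem_map]
    constructor
    · rintro ⟨v, ⟨h1, h2, h3⟩, rfl⟩
      refine ⟨?_, ?_, ?_⟩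
      · exact (hρ _ v).symm.trans (congrArg U h1)
      · exact (hγ v).symm.trans ((congrArg U h2).trans (map_smul U _ _))
      · exact (hcomp v).symm.trans ((congrArg U h3).trans (map_zero U))
    · rintro ⟨h1, h2, h3⟩
      obtain ⟨v, rfl⟩ := U.surjective w
      refine ⟨v, ⟨U.injective ?_, U.injective ?_, U.injective ?_⟩, rfl⟩
      · rw [hρ, h1]
      · rw [hγ, h2, map_smul]
      · rw [hcomp, h3, map_zero]
  rw [ind, ind, gradedDim, gradedDim, ← hker, ← hker, LinearEquiv.finrank_map_eq,
    LinearEquiv.finrank_map_eq]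

/-- The integer-valued functions that are summable over sets of bounded diameter, uniformly. If the
space itself has bounded geometry, these are the bounded functions, but in general there are fewer of
them. -/
def uniformlySummable (Y : Type*) [MetricSpace Y] : AddSubgroup (Y → ℤ) where
  carrier := {a | ∀ R : ℝ, 0 < R → ∃ C : ℤ, ∀ F : SmallSet Y R, ∑ y ∈ F.1, |a y| ≤ C}
  zero_mem' := fun R _ => ⟨0, fun F => by simp⟩
  add_mem' := by
    intro a b ha hb R hR
    obtain ⟨C, hC⟩ := ha R hR
    obtain ⟨D, hD⟩ := hb R hR
    refine ⟨C + D, fun F => ?_⟩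
    calc ∑ y ∈ F.1, |(a + b) y| ≤ ∑ y ∈ F.1, (|a y| + |b y|) :=
          Finset.sum_le_sum fun y _ => abs_add_le _ _
      _ ≤ C + D := by
          rw [Finset.sum_add_distrib]
          exact add_le_add (hC F) (hD F)
  neg_mem' := by
    intro a ha R hR
    obtain ⟨C, hC⟩ := ha R hR
    exact ⟨C, fun F => by simpa using hC F⟩

/-- The index as a homomorphism on uniform K-homology. -/
def indexHom (hY : UniformlyDiscrete Y) (p : ℕ) :
    UniformKHomologyGroup p Y →+ uniformlySummable Y :=
  QuotientAddGroup.lift (relations p Y)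
    (FreeAbelianGroup.lift fun x => ⟨ind x.toMultigradedRep x.T,
      fun _ hR => exists_sum_abs_ind_le hY x.isUniformFredholm hR⟩) (by
    refine (AddSubgroup.closure_le _).2 ?_
    rintro a ((⟨x, z, h, rfl⟩ | ⟨x, z, h, rfl⟩) | ⟨x, z, rfl⟩)
    · simp only [SetLike.mem_coe, AddMonoidHom.mem_ker, map_sub, FreeAbelianGroup.lift_apply_of]
      rw [sub_eq_zero]
      exact Subtype.ext (funext h.ind_eq)
    · simp only [SetLike.mem_coe, AddMonoidHom.mem_ker, map_sub, FreeAbelianGroup.lift_apply_of]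
      rw [sub_eq_zero]
      obtain ⟨M, T, hT, hc, rfl, rfl⟩ := h
      exact Subtype.ext (funext (ind_eq_of_path hY hT hc))
    · simp only [SetLike.mem_coe, AddMonoidHom.mem_ker, map_sub, map_add,
        FreeAbelianGroup.lift_apply_of]
      rw [sub_eq_zero]
      exact Subtype.ext (funext fun y => (ind_directSum hY x z y).symm))

lemma indexHom_cls (hY : UniformlyDiscrete Y) (x : UniformFredholmModule p Y) :
    ((indexHom hY p (cls x) : uniformlySummable Y) : Y → ℤ) = ind x.toMultigradedRep x.T :=
  congrArg Subtype.val (FreeAbelianGroup.lift_apply_of _ x)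

/-- Without multigrading operators, modules of vanishing index have trivial class. -/
lemma cls_eq_zero_of_ind_eq_zero (hY : UniformlyDiscrete Y) (x : UniformFredholmModule 0 Y)
    (h : ∀ y, ind x.toMultigradedRep x.T y = 0) : cls x = 0 := by
  obtain ⟨M, T, hT⟩ := x
  obtain ⟨S, hS, hSsa, hSc, hcomp, hcls⟩ := exists_diagonal_compress hY hT
  rw [hcls]
  refine cls_eq_zero_of_finrank_eq hY hS hSsa hSc fun y => ?_
  have := h y
  rw [ind, hcomp, gradedDim, sub_eq_zero] at this
  exact_mod_cast this

end Index

/-! ### Modules with prescribed index -/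

section Surjective

lemma gradedKer_zero_finrank {I : Type*} {P γ : lp (fun _ : I => ℂ) 2 →L[ℂ] lp (fun _ : I => ℂ) 2}
    {c s : I → ℂ} (hP : ∀ v i, P v i = c i * v i) (hγ : ∀ v i, γ v i = s i * v i) (ε : ℂ)
    [Finite {i // c i = 1 ∧ s i = ε}] :
    Module.finrank ℂ (gradedKer P γ 0 ε) = Nat.card {i // c i = 1 ∧ s i = ε} := by
  classical
  have := Fintype.ofFinite {i // c i = 1 ∧ s i = ε}
  have hmem (v : lp (fun _ : I => ℂ) 2) :
      v ∈ gradedKer P γ 0 ε ↔ ∀ i, v i ≠ 0 → c i = 1 ∧ s i = ε := by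
    constructor
    · rintro ⟨h1, h2, -⟩ i hi
      constructor
      · refine mul_right_cancel₀ hi ?_
        rw [← hP, h1, one_mul]
      · refine mul_right_cancel₀ hi ?_
        rw [← hγ, h2]
        rfl
    · intro h
      refine ⟨lp.ext (funext fun i => ?_), lp.ext (funext fun i => ?_), rfl⟩
      · rw [hP]
        by_cases hi : v i = 0
        · rw [hi, mul_zero]
        · rw [(h i hi).1, one_mul]
      · rw [hγ]
        change s i * v i = ε * v i
        by_cases hi : v i = 0
        · rw [hi, mul_zero, mul_zero]
        · rw [(h i hi).2]
  let g (w : {i // c i = 1 ∧ s i = ε} → ℂ) : I → ℂ := fun i =>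
    if h : c i = 1 ∧ s i = ε then w ⟨i, h⟩ else 0
  have hg0 (w : {i // c i = 1 ∧ s i = ε} → ℂ) (i : I) (h : ¬ (c i = 1 ∧ s i = ε)) : g w i = 0 :=
    dif_neg h
  have hg1 (w : {i // c i = 1 ∧ s i = ε} → ℂ) (i : I) (h : c i = 1 ∧ s i = ε) : g w i = w ⟨i, h⟩ :=
    dif_pos h
  have hgm (w : {i // c i = 1 ∧ s i = ε} → ℂ) : Memℓp (g w) 2 := by
    have hfin : {i | c i = 1 ∧ s i = ε}.Finite :=
      Set.finite_coe_iff.1 ‹Finite {i // c i = 1 ∧ s i = ε}›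
    refine memℓp_two (summable_of_hasFiniteSupport (hfin.subset fun i hi => ?_))
    by_contra h
    exact hi (by simp [hg0 w i h])
  have hgK (w : {i // c i = 1 ∧ s i = ε} → ℂ) : (⟨g w, hgm w⟩ : lp (fun _ : I => ℂ) 2) ∈
      gradedKer P γ 0 ε := by
    refine (hmem _).2 fun i hi => ?_
    by_contra h
    exact hi (hg0 w i h)
  have hgl (v : gradedKer P γ 0 ε) (i : I) : g (fun j => v.1 j.1) i = v.1 i := by
    by_cases h : c i = 1 ∧ s i = ε
    · exact hg1 (fun j => v.1 j.1) i h
    · refine (hg0 (fun j => v.1 j.1) i h).trans (Eq.symm ?_)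
      by_contra hi
      exact h ((hmem _).1 v.2 i hi)
  have e : gradedKer P γ 0 ε ≃ₗ[ℂ] ({i // c i = 1 ∧ s i = ε} → ℂ) :=
    { toFun := fun v i => v.1 i.1
      invFun := fun w => ⟨⟨g w, hgm w⟩, hgK w⟩
      left_inv := fun v => Subtype.ext (lp.ext (funext (hgl v)))
      right_inv := fun w => funext fun i => hg1 w i i.2
      map_add' := fun v w => rfl
      map_smul' := fun c v => rfl }
  rw [e.finrank_eq, Module.finrank_pi, Nat.card_eq_fintype_card]

variable {Y : Type*} [MetricSpace Y] {I : Type}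

lemma bdd_smul_one {g : I → ℂ} {C : ℝ} (h : ∀ i, ‖g i‖ ≤ C) :
    ∃ C, ∀ i, ‖g i • (1 : ℂ →L[ℂ] ℂ)‖ ≤ C :=
  ⟨C, fun i => by simpa using h i⟩

lemma norm_apply_le_norm (f : C₀(Y, ℂ)) (y : Y) : ‖f y‖ ≤ ‖f‖ := by
  rw [← ZeroAtInftyContinuousMap.norm_toBCF_eq_norm]
  exact f.toBCF.norm_coe_le_norm y

/-- The representation of `C₀(Y)` by multiplication operators on `ℓ²(I)`, for a map `I → Y`. -/
def mulRep (π : I → Y) :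
    C₀(Y, ℂ) →⋆ₙₐ[ℂ] (lp (fun _ : I => ℂ) 2 →L[ℂ] lp (fun _ : I => ℂ) 2) where
  toFun f := diagOp (fun i => f (π i) • 1) (bdd_smul_one fun i => norm_apply_le_norm f (π i))
  map_smul' c f := (diagOp_smul _ _ c fun i => by
    rw [smul_smul]
    rfl).symm
  map_zero' := diagOp_zero _ fun i => zero_smul _ _
  map_add' f g := (diagOp_add _ _ _ fun i => (add_smul _ _ _).symm).symm
  map_mul' f g := (diagOp_mul _ _ _ fun i => by
    rw [smul_mul_smul_comm, one_mul]
    rfl).symm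
  map_star' f := (diagOp_star _ _ fun i => by
    rw [star_smul, star_one]
    rfl).symm

/-- The Hilbert space `ℓ²(I)` for a map `I → Y`, graded by signs on `I`. -/
def mulModule [Countable I] (π : I → Y) (s : I → ℤˣ) : MultigradedRep 0 Y where
  H := lp (fun _ : I => ℂ) 2
  γ := diagOp (fun i => ((s i : ℤ) : ℂ) • 1) (bdd_smul_one (C := 1) fun i => by
    rcases Int.units_eq_one_or (s i) with h | h <;> simp [h])
  γ_selfAdjoint := diagOp_star _ _ fun i => by
    rw [star_smul, star_one]
    simp
  γ_sq := (diagOp_mul _ _ ⟨1, fun i => by simp⟩ fun i => by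
    rw [smul_mul_smul_comm, one_mul]
    rcases Int.units_eq_one_or (s i) with h | h <;> simp [h]).trans
      (diagOp_one (B := fun _ => 1) _ fun i => rfl)
  e i := i.elim0
  e_unitary i := i.elim0
  e_odd i := i.elim0
  e_sq i := i.elim0
  e_anticomm i := i.elim0
  ρ := mulRep π
  ρ_even f := by
    refine lp_clm_ext fun v i => ?_
    change f (π i) * (((s i : ℤ) : ℂ) * v i) = ((s i : ℤ) : ℂ) * (f (π i) * v i)
    ring
  ρ_multigraded f i := i.elim0

variable [DiscreteTopology Y]

lemma rank_mulRep_chi_le (π : I → Y) (F : Finset Y) {N : ℕ} (hf : {i | π i ∈ F}.Finite)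
    (hN : {i | π i ∈ F}.ncard ≤ N) :
    LinearMap.rank (mulRep π (chi F) :
      lp (fun _ : I => ℂ) 2 →ₗ[ℂ] lp (fun _ : I => ℂ) 2) ≤ N := by
  classical
  have := hf.fintype
  let g : lp (fun _ : I => ℂ) 2 →ₗ[ℂ] ({i | π i ∈ F} → ℂ) :=
    { toFun := fun v i => v i
      map_add' := fun v w => rfl
      map_smul' := fun c v => rfl }
  let h : ({i | π i ∈ F} → ℂ) →ₗ[ℂ] lp (fun _ : I => ℂ) 2 :=
    ∑ i : {i | π i ∈ F}, (lp.singleContinuousLinearMap ℂ (fun _ : I => ℂ) 2 (i : I) :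
      ℂ →ₗ[ℂ] lp (fun _ : I => ℂ) 2) ∘ₗ LinearMap.proj i
  have hfac : (mulRep π (chi F) : lp (fun _ : I => ℂ) 2 →ₗ[ℂ] lp (fun _ : I => ℂ) 2) = h ∘ₗ g := by
    refine LinearMap.ext fun v => lp.ext (funext fun i => ?_)
    have h1 : h (g v) = ∑ j : {i | π i ∈ F}, lp.single 2 (j : I) (v j) := by
      simp only [h, LinearMap.sum_apply]
      rfl
    change chi F (π i) * v i = h (g v) i
    rw [h1, lp.coeFn_sum, Finset.sum_apply]
    by_cases hi : π i ∈ F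
    · rw [Finset.sum_eq_single (⟨i, hi⟩ : {i | π i ∈ F})]
      · simp [chi, finFun_apply, hi]
      · intro j _ hj
        exact lp.single_apply_ne (E := fun _ : I => ℂ) 2 (j : I) _ fun h => hj (Subtype.ext h.symm)
      · simp
    · rw [Finset.sum_eq_zero]
      · simp [chi, finFun_apply, hi]
      · intro j _
        exact lp.single_apply_ne (E := fun _ : I => ℂ) 2 (j : I) _ fun h => hi (h ▸ j.2)
  rw [hfac]
  refine (LinearMap.rank_comp_le_right _ _).trans ((LinearMap.rank_le_range _).trans ?_)
  rw [rank_fun']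
  rw [Set.ncard_eq_toFinset_card', Set.toFinset_card] at hN
  exact_mod_cast hN

/-- If the fibres of `I → Y` are uniformly finite over sets of bounded diameter, then the zero
operator defines a uniform Fredholm module on `ℓ²(I)`. -/
lemma isUniformFredholm_zero (hY : UniformlyDiscrete Y) [Countable I] (π : I → Y) (s : I → ℤˣ)
    (h : ∀ R : ℝ, 0 < R → ∃ N : ℕ, ∀ F : SmallSet Y R,
      {i | π i ∈ F.1}.Finite ∧ {i | π i ∈ F.1}.ncard ≤ N) :
    IsUniformFredholm (mulModule π s) 0 := by
  have h1 : UniformlyLocallyCompactOp (mulModule π s).ρ (1 : (mulModule π s).H →L[ℂ] _) := by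
    refine (uniformlyLocallyCompactOp_iff hY).2 fun R hR => ?_
    obtain ⟨N, hN⟩ := h R hR
    simp only [mul_one, one_mul, and_self]
    exact UnifApprox.of_rank_le (N := N) fun F => rank_mulRep_chi_le π F.1 (hN F).1 (hN F).2
  have h2 : UniformlyLocallyCompactOp (mulModule π s).ρ (0 * 0 - 1 : (mulModule π s).H →L[ℂ] _) := by
    rw [mul_zero, zero_sub]
    exact h1.neg hY
  have h3 : UniformlyLocallyCompactOp (mulModule π s).ρ (0 - star 0 : (mulModule π s).H →L[ℂ] _) := by
    rw [star_zero, sub_zero]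
    exact UniformlyLocallyCompactOp.zero
  have h0 : IsCompactOperator (0 : (mulModule π s).H →L[ℂ] (mulModule π s).H) :=
    isCompactOperator_zero
  exact
    { odd := by rw [zero_mul, mul_zero, neg_zero]
      multigraded := fun i => i.elim0
      sq_sub_one := h2.locallyCompactOp hY
      sub_star := h3.locallyCompactOp hY
      pseudolocal := fun f => by
        rw [zero_mul, mul_zero, sub_zero]
        exact h0
      uniformly_pseudolocal := UniformlyLocallyCompactOp.zero.uniformlyPseudolocalOp
      uniformly_sq_sub_one := h2
      uniformly_sub_star := h3 }

lemma ind_mulModule [Countable I] (π : I → Y) (s : I → ℤˣ) (y : Y)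
    (hf : {i | π i = y}.Finite) : ind (mulModule π s) 0 y =
      (Nat.card {i // π i = y ∧ s i = 1} : ℤ) - Nat.card {i // π i = y ∧ s i = -1} := by
  have h0 : compress (mulModule π s) 0 y = 0 := by
    rw [compress, star_zero, add_zero, smul_zero, mul_zero, zero_mul]
  have hc (i : I) : pt y (π i) = 1 ↔ π i = y := by
    by_cases h : π i = y
    · simp [h, pt_apply_self]
    · simp [h, pt_apply_ne h]
  have key (u : ℤˣ) : Module.finrank ℂ (gradedKer ((mulModule π s).ρ (pt y)) (mulModule π s).γ 0
      ((u : ℤ) : ℂ)) = Nat.card {i // π i = y ∧ s i = u} := by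
    have hiff (i : I) : (pt y (π i) = 1 ∧ ((s i : ℤ) : ℂ) = ((u : ℤ) : ℂ)) ↔ π i = y ∧ s i = u := by
      rw [hc, Int.cast_inj, Units.val_inj]
    have : Finite {i // pt y (π i) = 1 ∧ ((s i : ℤ) : ℂ) = ((u : ℤ) : ℂ)} :=
      (hf.subset fun i hi => ((hiff i).1 hi).1).to_subtype
    refine (gradedKer_zero_finrank (I := I) (c := fun i => pt y (π i))
      (s := fun i => ((s i : ℤ) : ℂ)) (fun v i => rfl) (fun v i => rfl) _).trans ?_
    exact Nat.card_congr (Equiv.subtypeEquivRight hiff)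
  have k1 := key 1
  have k2 := key (-1)
  rw [Units.val_one, Int.cast_one] at k1
  rw [Units.val_neg, Units.val_one, Int.cast_neg, Int.cast_one] at k2
  rw [ind, h0, gradedDim, k1, k2]

/-- Every uniformly summable function is the index of a module: take `ℓ²` of a set with `|a y|`
elements over each point `y`, graded by the sign of `a`, with the zero operator. -/
lemma exists_ind_eq [ProperSpace Y] (hY : UniformlyDiscrete Y) (a : uniformlySummable Y) :
    ∃ x : UniformFredholmModule 0 Y, ind x.toMultigradedRep x.T = a := by
  obtain ⟨a, ha⟩ := a
  have : Countable Y := by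
    have := secondCountable_of_proper (α := Y)
    exact TopologicalSpace.separableSpace_iff_countable.1 inferInstance
  let I : Type := Shrink.{0} (Σ y : Y, Fin (a y).natAbs)
  let e : I ≃ (Σ y : Y, Fin (a y).natAbs) := (equivShrink _).symm
  have : Countable I := e.countable_iff.2 inferInstance
  let π : I → Y := fun i => (e i).1
  let s : I → ℤˣ := fun i => if 0 ≤ a (π i) then 1 else -1
  have hfib (y : Y) : Nat.card {i // π i = y} = (a y).natAbs := by
    rw [Nat.card_congr ((e.subtypeEquiv fun i => Iff.rfl :
      {i // π i = y} ≃ {j : Σ y : Y, Fin (a y).natAbs // j.1 = y}).trans (Equiv.sigmaSubtype y)),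
      Nat.card_eq_fintype_card, Fintype.card_fin]
  have hfibfin (y : Y) : {i | π i = y}.Finite := by
    have : Finite {i // π i = y} := Finite.of_equiv _ ((e.subtypeEquiv fun i => Iff.rfl :
      {i // π i = y} ≃ {j : Σ y : Y, Fin (a y).natAbs // j.1 = y}).trans (Equiv.sigmaSubtype y)).symm
    exact Set.finite_coe_iff.1 this
  have hT : IsUniformFredholm (mulModule π s) 0 := by
    refine isUniformFredholm_zero hY π s fun R hR => ?_
    obtain ⟨C, hC⟩ := ha R hR
    refine ⟨C.toNat, fun F => ?_⟩
    have hU : {i | π i ∈ F.1} = ⋃ y ∈ F.1, {i | π i = y} := by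
      ext i
      simp
    have hfin : {i | π i ∈ F.1}.Finite := by
      rw [hU]
      exact F.1.finite_toSet.biUnion fun y _ => hfibfin y
    refine ⟨hfin, ?_⟩
    rw [hU]
    have h1 : (⋃ y ∈ F.1, {i | π i = y}).ncard ≤ ∑ y ∈ F.1, {i | π i = y}.ncard :=
      Finset.set_ncard_biUnion_le F.1 _
    have h2 := hC F
    have h3 : ∑ y ∈ F.1, {i | π i = y}.ncard = ∑ y ∈ F.1, (a y).natAbs :=
      Finset.sum_congr rfl fun y _ => hfib y
    have h4 : ((∑ y ∈ F.1, (a y).natAbs : ℕ) : ℤ) = ∑ y ∈ F.1, |a y| := by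
      push_cast
      rfl
    omega
  refine ⟨⟨mulModule π s, 0, hT⟩, funext fun y => ?_⟩
  refine (ind_mulModule π s y (hfibfin y)).trans ?_
  have hs (i : I) (hi : π i = y) : s i = if 0 ≤ a y then 1 else -1 := by rw [← hi]
  have key (u : ℤˣ) (hu : u = if 0 ≤ a y then 1 else -1) :
      Nat.card {i // π i = y ∧ s i = u} = (a y).natAbs := by
    rw [← hfib y]
    exact Nat.card_congr (Equiv.subtypeEquivRight fun i =>
      ⟨fun h => h.1, fun h => ⟨h, (hs i h).trans hu.symm⟩⟩)
  have key' (u : ℤˣ) (hu : u ≠ if 0 ≤ a y then 1 else -1) :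
      Nat.card {i // π i = y ∧ s i = u} = 0 := by
    have : IsEmpty {i // π i = y ∧ s i = u} :=
      ⟨fun i => hu (i.2.2.symm.trans (hs i i.2.1))⟩
    exact Nat.card_of_isEmpty
  by_cases h : 0 ≤ a y
  · rw [key 1 (by rw [if_pos h]), key' (-1) (by rw [if_pos h]; decide)]
    change _ = a y
    omega
  · rw [key' 1 (by rw [if_neg h]; decide), key (-1) (by rw [if_neg h])]
    change _ = a y
    omega

end Surjective

/-! ### Submodules of free modules over principal ideal domains -/

section FreeModule

variable {R : Type*} [CommRing R] [IsDomain R] [IsPrincipalIdealRing R]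

/-- With respect to a well-ordering of `ι`, choose for each `i` an element of the submodule supported
in `Iic i` whose `i`-th coefficient generates the ideal of all such coefficients. The chosen elements
with nonzero leading coefficient form a basis. -/
lemma free_submodule_finsupp {ι : Type*} (N : Submodule R (ι →₀ R)) : Module.Free R N := by
  classical
  obtain ⟨_, _⟩ := exists_wellFoundedLT ι
  let I (i : ι) : Ideal R :=
    (N ⊓ Finsupp.supported R R (Set.Iic i)).map (Finsupp.lapply i)
  have hex (i : ι) : ∃ x : ι →₀ R, x ∈ N ∧ (∀ j, x j ≠ 0 → j ≤ i) ∧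
      x i = Submodule.IsPrincipal.generator (I i) := by
    obtain ⟨x, hx, hxi⟩ := Submodule.mem_map.1 (Submodule.IsPrincipal.generator_mem (I i))
    refine ⟨x, hx.1, fun j hj => ?_, hxi⟩
    exact (Finsupp.mem_supported R x).1 hx.2 (Finsupp.mem_support_iff.2 hj)
  choose x hxN hxs hxi using hex
  have hgen (i : ι) (z : ι →₀ R) (hz : z ∈ N) (hzs : ∀ j, z j ≠ 0 → j ≤ i) :
      ∃ c, z i = c * x i i := by
    have : z i ∈ I i := Submodule.mem_map.2 ⟨z, ⟨hz, (Finsupp.mem_supported R z).2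
      fun j hj => hzs j (Finsupp.mem_support_iff.1 hj)⟩, rfl⟩
    obtain ⟨c, hc⟩ := (Submodule.IsPrincipal.mem_iff_eq_smul_generator (I i)).1 this
    exact ⟨c, by rw [hc, hxi, smul_eq_mul]⟩
  let v : {i // x i i ≠ 0} → N := fun i => ⟨x i, hxN i⟩
  have hli : LinearIndependent R v := by
    refine LinearIndependent.of_comp N.subtype (linearIndependent_iff.2 fun l hl => ?_)
    by_contra h0
    have hne := Finsupp.support_nonempty_iff.2 h0
    let m := l.support.max' hne
    have h1 := DFunLike.congr_fun hl (m : ι)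
    rw [Finsupp.linearCombination_apply, Finsupp.sum, Finsupp.finsetSum_apply,
      Finset.sum_eq_single m] at h1
    · exact (mul_ne_zero (Finsupp.mem_support_iff.1 (l.support.max'_mem hne)) m.2) h1
    · intro j hj hjm
      change l j * x j m = 0
      by_contra h2
      have h3 : (m : ι) ≤ j := hxs _ _ (right_ne_zero_of_mul h2)
      exact hjm (le_antisymm (l.support.le_max' j hj) h3)
    · intro h
      exact absurd (l.support.max'_mem hne) h
  have hspan : ∀ i (z : ι →₀ R) (hz : z ∈ N), (∀ j, z j ≠ 0 → j ≤ i) →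
      (⟨z, hz⟩ : N) ∈ Submodule.span R (Set.range v) := by
    intro i
    induction i using WellFoundedLT.induction with
    | ind i ih =>
      have hlt (z : ι →₀ R) (hz : z ∈ N) (h : ∀ j, z j ≠ 0 → j < i) :
          (⟨z, hz⟩ : N) ∈ Submodule.span R (Set.range v) := by
        by_cases h0 : z = 0
        · subst h0
          exact Submodule.zero_mem _
        · have hne := Finsupp.support_nonempty_iff.2 h0
          refine ih (z.support.max' hne)
            (h _ (Finsupp.mem_support_iff.1 (z.support.max'_mem hne))) z hz fun j hj => ?_
          exact z.support.le_max' j (Finsupp.mem_support_iff.2 hj)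
      intro z hz hzs
      obtain ⟨c, hc⟩ := hgen i z hz hzs
      by_cases hi : x i i = 0
      · refine hlt z hz fun j hj => lt_of_le_of_ne (hzs j hj) ?_
        rintro rfl
        exact hj (by rw [hc, hi, mul_zero])
      · have h1 := hlt (z - c • x i) (N.sub_mem hz (N.smul_mem c (hxN i))) fun j hj => by
          refine lt_of_le_of_ne ?_ ?_
          · by_contra h2
            have h3 : z j = 0 := by_contra fun h => h2 (hzs j h)
            have h4 : x i j = 0 := by_contra fun h => h2 (hxs i j h)
            exact hj (by simp [h3, h4])
          · rintro rfl
            exact hj (by simp [hc])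
        have h2 : (⟨z, hz⟩ : N) =
            ⟨z - c • x i, N.sub_mem hz (N.smul_mem c (hxN i))⟩ + c • v ⟨i, hi⟩ :=
          Subtype.ext (sub_add_cancel _ _).symm
        rw [h2]
        exact Submodule.add_mem _ h1
          (Submodule.smul_mem _ _ (Submodule.subset_span ⟨_, rfl⟩))
  refine Module.Free.of_basis (Module.Basis.mk hli fun z _ => ?_)
  obtain ⟨z, hz⟩ := z
  by_cases h0 : z = 0
  · subst h0
    exact Submodule.zero_mem _
  · have hne := Finsupp.support_nonempty_iff.2 h0
    exact hspan (z.support.max' hne) z hz fun j hj =>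
      z.support.le_max' j (Finsupp.mem_support_iff.2 hj)

theorem free_submodule_of_pid {V : Type*} [AddCommGroup V] [Module R V] [Module.Free R V]
    (N : Submodule R V) : Module.Free R N := by
  let e := (Module.Free.chooseBasis R V).repr
  have := free_submodule_finsupp (N.map e.toLinearMap)
  exact Module.Free.of_equiv (e.submoduleMap N).symm

end FreeModule

/-! ### Groups of bounded integer-valued functions -/

section BoundedFunctions

/-- Restriction of locally constant functions from the Stone–Čech compactification of a discrete
space. -/
def restrictUltrafilter (Y : Type*) : LocallyConstant (Ultrafilter Y) ℤ →ₗ[ℤ] (Y → ℤ) where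
  toFun f y := f (pure y)
  map_add' _ _ := rfl
  map_smul' _ _ := rfl

lemma restrictUltrafilter_injective (Y : Type*) : Function.Injective (restrictUltrafilter Y) := by
  intro f g h
  refine LocallyConstant.ext fun u => congrFun ?_ u
  exact denseRange_pure.equalizer f.continuous g.continuous h

lemma exists_restrictUltrafilter_eq {Y : Type*} {a : Y → ℤ} {C : ℤ} (h : ∀ y, |a y| ≤ C) :
    ∃ f, restrictUltrafilter Y f = a := by
  let b : Y → Set.Icc (-C) C := fun y => ⟨a y, abs_le.1 (h y)⟩
  refine ⟨⟨Subtype.val ∘ Ultrafilter.extend b, (IsLocallyConstant.iff_continuous _).2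
    (continuous_subtype_val.comp (continuous_ultrafilter_extend b))⟩, ?_⟩
  exact funext fun y => congrArg Subtype.val (congrFun (ultrafilter_extend_extends b) y)

/-- Groups of bounded integer-valued functions are free, as a consequence of Nöbeling's theorem for
the Stone–Čech compactification. -/
lemma free_of_bounded {Y : Type*} (A : AddSubgroup (Y → ℤ))
    (h : ∀ a ∈ A, ∃ C : ℤ, ∀ y, |a y| ≤ C) : Module.Free ℤ A := by
  have h1 : Module.Free ℤ (LocallyConstant (Ultrafilter Y) ℤ) :=
    LocallyConstant.freeOfProfinite (Profinite.of (Ultrafilter Y))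
  have h2 : Module.Free ℤ (LinearMap.range (restrictUltrafilter Y)) :=
    Module.Free.of_equiv (LinearEquiv.ofInjective _ (restrictUltrafilter_injective Y))
  have hle : AddSubgroup.toIntSubmodule A ≤ LinearMap.range (restrictUltrafilter Y) := by
    intro a ha
    obtain ⟨C, hC⟩ := h a ha
    exact exists_restrictUltrafilter_eq hC
  have h3 := free_submodule_of_pid
    ((AddSubgroup.toIntSubmodule A).submoduleOf (LinearMap.range (restrictUltrafilter Y)))
  exact Module.Free.of_equiv (Submodule.submoduleOfEquivOfLe hle)

open Cardinal in
/-- A group of bounded integer-valued functions on a countable set with as many elements as there are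
sets of natural numbers is free of rank the cardinality of the continuum. -/
lemma rank_eq_continuum_of_bounded {Y : Type*} [Countable Y] (A : AddSubgroup (Y → ℤ))
    (h : ∀ a ∈ A, ∃ C : ℤ, ∀ y, |a y| ≤ C) {s : Set ℕ → A} (hs : Function.Injective s) :
    Module.rank ℤ A = 𝔠 := by
  have := free_of_bounded A h
  have hge : 𝔠 ≤ #A := by
    simpa using Cardinal.lift_mk_le_lift_mk_of_injective hs
  have hle : #A ≤ 𝔠 := by
    refine (Cardinal.mk_subtype_le _).trans ?_
    rw [mk_arrow, mk_int, lift_aleph0, ← aleph0_power_aleph0]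
    exact power_le_power_left aleph0_ne_zero (lift_le_aleph0.2 (mk_le_aleph0 (α := Y)))
  have heq : #A = 𝔠 := le_antisymm hle hge
  rw [Module.Free.rank_eq_mk_of_infinite_lt ℤ A, heq]
  rw [heq]
  simpa using aleph0_lt_continuum

end BoundedFunctions

/-! ### The range of the index -/

section Range

variable {Y : Type*} [MetricSpace Y]

lemma uniformlySummable_le : uniformlySummable Y ≤ boundedIntSequences Y := by
  intro a ha
  obtain ⟨C, hC⟩ := ha 1 one_pos
  exact ⟨C, fun y => by simpa using hC ⟨{y}, by simp⟩⟩

/-- The distances of the points of the sequence to `o` more than double at each step, so that the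
points are also far from each other. -/
lemma exists_sparse_sequence [ProperSpace Y] [DiscreteTopology Y] [Infinite Y] :
    ∃ (o : Y) (y : ℕ → Y), ∀ m n, m < n → 2 * dist (y m) o + 1 ≤ dist (y n) o := by
  obtain ⟨o⟩ := (inferInstance : Nonempty Y)
  obtain ⟨y, -, hy⟩ := exists_seq_of_forall_finset_exists (fun _ : Y => True)
    (fun x z => 2 * dist x o + 1 ≤ dist z o) fun s _ => by
      have hfin : (⋃ x ∈ s, Metric.closedBall o (2 * dist x o + 1)).Finite :=
        s.finite_toSet.biUnion fun x _ => (isCompact_closedBall _ _).finite_of_discrete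
      obtain ⟨z, hz⟩ := hfin.exists_notMem
      refine ⟨z, trivial, fun x hx => ?_⟩
      by_contra h
      exact hz (Set.mem_biUnion hx (Metric.mem_closedBall.2 (not_le.1 h).le))
  exact ⟨o, y, hy⟩

/-- An infinite proper discrete space contains a sequence of which every set of bounded diameter
contains only boundedly many elements, and the indicator functions of its subsets are uniformly
summable. -/
lemma exists_injective_uniformlySummable [ProperSpace Y] [DiscreteTopology Y] [Infinite Y] :
    ∃ s : Set ℕ → uniformlySummable Y, Function.Injective s := by
  classical
  obtain ⟨o, y, hy⟩ := exists_sparse_sequence (Y := Y)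
  have hd (n : ℕ) : (n : ℝ) ≤ dist (y n) o := by
    induction n with
    | zero => simp
    | succ n ih =>
      have := hy n (n + 1) n.lt_succ_self
      push_cast
      linarith [dist_nonneg (x := y n) (y := o)]
  have hdist (m n : ℕ) (hmn : m < n) : (m : ℝ) < dist (y m) (y n) := by
    have h1 := hy m n hmn
    have h2 := dist_triangle (y n) (y m) o
    rw [dist_comm (y n) (y m)] at h2
    linarith [hd m]
  have hinj : Function.Injective y := by
    intro m n h
    by_contra hne
    rcases lt_or_gt_of_ne hne with h' | h'
    · have := hdist m n h'
      rw [h, dist_self] at this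
      exact absurd this (not_lt.2 m.cast_nonneg)
    · have := hdist n m h'
      rw [h, dist_self] at this
      exact absurd this (not_lt.2 n.cast_nonneg)
  have hmem (S : Set ℕ) : (y '' S).indicator (1 : Y → ℤ) ∈ uniformlySummable Y := by
    intro R hR
    obtain ⟨N, hN⟩ := exists_nat_ge R
    refine ⟨(N + 1 : ℕ), fun F => ?_⟩
    let G := F.1.filter fun z => z ∈ Set.range y
    have hsub : G ⊆ (Finset.range N).image y ∪ G.filter fun z => ∃ n, N ≤ n ∧ y n = z := by
      intro z hz
      obtain ⟨n, rfl⟩ := (Finset.mem_filter.1 hz).2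
      by_cases hn : n < N
      · exact Finset.mem_union_left _ (Finset.mem_image_of_mem _ (Finset.mem_range.2 hn))
      · exact Finset.mem_union_right _ (Finset.mem_filter.2 ⟨hz, n, not_lt.1 hn, rfl⟩)
    have hfar (m n : ℕ) (hm : N ≤ m) (hmn : m < n) (h1 : y m ∈ G) (h2 : y n ∈ G) : False := by
      have h3 := Metric.dist_le_diam_of_mem F.1.finite_toSet.isBounded
        (Finset.mem_coe.2 (Finset.mem_filter.1 h1).1) (Finset.mem_coe.2 (Finset.mem_filter.1 h2).1)
      have h4 : (N : ℝ) ≤ m := by exact_mod_cast hm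
      linarith [hdist m n hmn, F.2]
    have hone : (G.filter fun z => ∃ n, N ≤ n ∧ y n = z).card ≤ 1 := by
      refine Finset.card_le_one.2 fun a ha b hb => ?_
      obtain ⟨haG, m, hm, rfl⟩ := Finset.mem_filter.1 ha
      obtain ⟨hbG, n, hn, rfl⟩ := Finset.mem_filter.1 hb
      rcases lt_trichotomy m n with h | rfl | h
      · exact (hfar m n hm h haG hbG).elim
      · rfl
      · exact (hfar n m hn h hbG haG).elim
    have hcard : G.card ≤ N + 1 := by
      refine (Finset.card_le_card hsub).trans ((Finset.card_union_le _ _).trans ?_)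
      exact add_le_add (Finset.card_image_le.trans (Finset.card_range N).le) hone
    calc ∑ z ∈ F.1, |(y '' S).indicator (1 : Y → ℤ) z|
        ≤ ∑ z ∈ F.1, if z ∈ Set.range y then 1 else 0 := by
          refine Finset.sum_le_sum fun z _ => ?_
          by_cases hz : z ∈ y '' S
          · rw [Set.indicator_of_mem hz, if_pos (Set.image_subset_range _ _ hz)]
            simp
          · rw [Set.indicator_of_notMem hz]
            split_ifs <;> simp
      _ = (G.card : ℤ) := by rw [Finset.sum_ite, Finset.sum_const_zero, add_zero]; simp [G]
      _ ≤ (N + 1 : ℕ) := by exact_mod_cast hcard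
  refine ⟨fun S => ⟨_, hmem S⟩, fun S S' h => ?_⟩
  have h1 : (y '' S).indicator (1 : Y → ℤ) = (y '' S').indicator 1 := congrArg Subtype.val h
  exact hinj.image_injective (Set.indicator_one_inj ℤ h1)

/-- The uniformly summable functions may form a proper subgroup of the bounded functions, but
abstractly the two groups are isomorphic: they are equal if the space is finite, and free of the same
rank otherwise. -/
lemma nonempty_addEquiv_boundedIntSequences [ProperSpace Y] [DiscreteTopology Y] :
    Nonempty (uniformlySummable Y ≃+ boundedIntSequences Y) := by
  have : Countable Y := by
    have := secondCountable_of_proper (α := Y)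
    exact TopologicalSpace.separableSpace_iff_countable.1 inferInstance
  rcases finite_or_infinite Y with hfin | hinf
  · have := Fintype.ofFinite Y
    refine ⟨AddEquiv.addSubgroupCongr (le_antisymm uniformlySummable_le fun a _ R _ =>
      ⟨∑ y, |a y|, fun F => ?_⟩)⟩
    exact Finset.sum_le_sum_of_subset_of_nonneg (Finset.subset_univ _) fun y _ _ => abs_nonneg _
  · obtain ⟨s, hs⟩ := exists_injective_uniformlySummable (Y := Y)
    have hb : ∀ a ∈ boundedIntSequences Y, ∃ C : ℤ, ∀ y, |a y| ≤ C := fun a ha => ha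
    have hu : ∀ a ∈ uniformlySummable Y, ∃ C : ℤ, ∀ y, |a y| ≤ C :=
      fun a ha => uniformlySummable_le ha
    have h1 := free_of_bounded _ hb
    have h2 := free_of_bounded _ hu
    have h3 := rank_eq_continuum_of_bounded _ hu hs
    have h4 := rank_eq_continuum_of_bounded _ hb
      ((AddSubgroup.inclusion_injective uniformlySummable_le).comp hs)
    exact (nonempty_linearEquiv_of_rank_eq (h3.trans h4.symm)).map LinearEquiv.toAddEquiv

end Range

/-! ### Computation of uniform K-homology -/

section Computation

variable {Y : Type*} [MetricSpace Y]

lemma uniformKHomologyGroup_induction {p : ℕ} {P : UniformKHomologyGroup p Y → Prop} (h0 : P 0)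
    (h1 : ∀ x : UniformFredholmModule p Y, P (cls x)) (h2 : ∀ g, P g → P (-g))
    (h3 : ∀ g h, P g → P h → P (g + h)) (g : UniformKHomologyGroup p Y) : P g := by
  obtain ⟨g, rfl⟩ := QuotientAddGroup.mk_surjective g
  induction g using FreeAbelianGroup.induction_on with
  | zero => exact h0
  | of x => exact h1 x
  | neg x hx => exact h2 _ hx
  | add g h hg hh => exact h3 _ _ hg hh

variable [ProperSpace Y]

/-- Additive inverses of classes of modules are classes of modules, because there is a module with
the opposite index. -/
lemma exists_cls_eq (hY : UniformlyDiscrete Y) (g : UniformKHomologyGroup 0 Y) :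
    ∃ x : UniformFredholmModule 0 Y, cls x = g := by
  have := hY.discreteTopology
  induction g using uniformKHomologyGroup_induction with
  | h0 =>
    obtain ⟨x, hx⟩ := exists_ind_eq hY 0
    exact ⟨x, cls_eq_zero_of_ind_eq_zero hY x fun y => congrFun hx y⟩
  | h1 x => exact ⟨x, rfl⟩
  | h2 g hg =>
    obtain ⟨x, rfl⟩ := hg
    obtain ⟨z, hz⟩ := exists_ind_eq hY (-indexHom hY 0 (cls x))
    refine ⟨z, eq_neg_of_add_eq_zero_right ?_⟩
    rw [← cls_directSum]
    refine cls_eq_zero_of_ind_eq_zero hY _ fun y => ?_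
    rw [ind_directSum hY, hz, AddSubgroup.coe_neg, indexHom_cls]
    exact add_neg_cancel _
  | h3 g h hg hh =>
    obtain ⟨x, rfl⟩ := hg
    obtain ⟨z, rfl⟩ := hh
    exact ⟨x.directSum z, cls_directSum x z⟩

lemma indexHom_bijective [DiscreteTopology Y] (hY : UniformlyDiscrete Y) :
    Function.Bijective (indexHom hY 0) := by
  refine ⟨(injective_iff_map_eq_zero _).2 fun g hg => ?_, fun a => ?_⟩
  · obtain ⟨x, rfl⟩ := exists_cls_eq hY g
    refine cls_eq_zero_of_ind_eq_zero hY x fun y => ?_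
    rw [← indexHom_cls hY, hg]
    rfl
  · obtain ⟨x, hx⟩ := exists_ind_eq hY a
    exact ⟨cls x, Subtype.ext ((indexHom_cls hY x).trans hx)⟩

end Computation

end UniformKHomology

end

theorem mainTheorem11 (Y : Type*) [MetricSpace Y] [ProperSpace Y]
    (hdisc : UniformKHomology.UniformlyDiscrete Y)
    (hgeom : UniformKHomology.CoarselyBoundedGeometry Y) :
    Nonempty (UniformKHomology.UniformKHomologyGroup 0 Y ≃+
      UniformKHomology.boundedIntSequences Y) ∧
    Subsingleton (UniformKHomology.UniformKHomologyGroup 1 Y) := by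
  have := hdisc.discreteTopology
  constructor
  · obtain ⟨e⟩ := UniformKHomology.nonempty_addEquiv_boundedIntSequences (Y := Y)
    exact ⟨(AddEquiv.ofBijective _ (UniformKHomology.indexHom_bijective hdisc)).trans e⟩
  · refine subsingleton_of_forall_eq 0 fun g => ?_
    induction g using UniformKHomology.uniformKHomologyGroup_induction with
    | h0 => rfl
    | h1 x => exact UniformKHomology.cls_eq_zero_one hdisc x
    | h2 g hg => rw [hg, neg_zero]
    | h3 g h hg hh => rw [hg, hh, add_zero]
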